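/- **Setting.** Let $\mathcal X,\widetilde{\mathcal X},\mathcal Y$ be finite sets and let $(X_i,\widetilde X_i,Y_i)$, $i=1,\dots,n$, be i.i.d. copies of $(X,\widetilde X,Y)\sim P_{X\widetilde XY}=P_X P_{\widetilde XY|X}$. Logarithms, entropies and mutual informations are in nats. A generated-secret (GS) code of blocklength $n$ has finite sets $\mathcal S,\mathcal W$, an encoder $f_1:\widetilde{\mathcal X}^n\to\mathcal W\times\mathcal S$, giving $(W,S)=f_1(\widetilde X^n)$, and a decoder $g:\mathcal W\times\mathcal Y^n\to\mathcal S$, giving $\hat S=g(W,Y^n)$. A chosen-secret (CS) code has instead a key $S\in\mathcal S$ independent of $(X^n,\widetilde X^n,Y^n)$, an encoder $f_2:\widetilde{\mathcal X}^n\times\mathcal S\to\mathcal W$ with $W=f_2(\widetilde X^n,S)$, and a decoder as before. A tuple $(R_s,R_\ell,R_w)\in\mathbb R^3$ is achievable for the GS (CS) model if for every $\delta>0$ there are $n\ge1$ and a GS (CS) code of blocklength $n$ with $R_s=\frac1n\log|\mathcal S|$ and $$\Pr[S\ne\hat S]\le\delta,\quad I(S;W)\le\delta,\quad \tfrac1nI(X^n;W)\le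 R_\ell+\delta,\quad \tfrac1nH(S)\ge R_s-\delta,\quad \tfrac1n\log|\mathcal W|\le R_w+\delta .$$ The key-leakage-storage regions $\mathcal C_{gs}$ and $\mathcal C_{cs}$ are the closures in $\mathbb R^3$ of the sets of achievable tuples. In the CS model the law of $S$ may be chosen with the code. For a conditional distribution $P_{U|\widetilde X}$ with a finite alphabet $\mathcal U$, let $(U,X,\widetilde X,Y)\sim P_{U|\widetilde X}P_{X\widetilde XY}$, so that $U-\widetilde X-(X,Y)$ is a Markov chain. Let $\mathcal R_2$ be the set of all $(R_s,R_\ell,R_w)$ for which there is such a $P_{U|\widetilde X}$ with $\max\{0,I(U;X)-I(U;Y)\}=0$ and $$0\le R_s\le I(U;Y),\qquad R_\ell\ge \max\{0,I(U;X)-I(U;Y)\}=0,\qquad R_w\ge I(U;\widetilde X)-I(U;Y),$$ and let $\mathcal R_4$ be defined in the same way with the last inequality replaced by $R_w\ge I(U;\widetilde X)$. **Theorem 2 (physically-degraded broadcast channels).** Suppose that $\widetilde X-Y-X$ is a Markov chain. Then $$\mathcal C_{gs}=\mathcal R_2,\qquad \mathcal C_{cs}=\mathcal R_4 ,$$ and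 $\mathcal C_{cs}$ is the same set if the key of the CS model is required to be exactly uniform on $\mathcal S$. Moreover, in $\mathcal R_2$ and in $\mathcal R_4$ it suffices to take $|\mathcal U|\le|\widetilde{\mathcal X}|+1$. -/

import Mathlib

namespace KeyAgreement

section Information

variable {Ω α β γ : Type*} [Fintype Ω]

/-- Law of the random variable `f` on the finite probability space with mass function `p`. -/
noncomputable def law (p : Ω → ℝ) (f : Ω → α) (a : α) : ℝ :=
  open scoped Classical in ∑ ω, if f ω = a then p ω else 0

/-- Probability of the event `E`. -/
noncomputable def prob (p : Ω → ℝ) (E : Ω → Prop) : ℝ :=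
  open scoped Classical in ∑ ω, if E ω then p ω else 0

/-- Shannon entropy of the random variable `f`, in nats. -/
noncomputable def entropy [Fintype α] (p : Ω → ℝ) (f : Ω → α) : ℝ :=
  ∑ a, Real.negMulLog (law p f a)

/-- Mutual information `I(f; g) = H(f) + H(g) - H(f, g)`, in nats. -/
noncomputable def mutualInfo [Fintype α] [Fintype β] (p : Ω → ℝ) (f : Ω → α) (g : Ω → β) : ℝ :=
  entropy p f + entropy p g - entropy p (fun ω => (f ω, g ω))

/-- `f - g - h` is a Markov chain: `f` and `h` are conditionally independent given `g`. -/
def IsMarkovChain (p : Ω → ℝ) (f : Ω → α) (g : Ω → β) (h : Ω → γ) : Prop :=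
  ∀ a b c, law p (fun ω => (f ω, g ω, h ω)) (a, b, c) * law p g b =
    law p (fun ω => (f ω, g ω)) (a, b) * law p (fun ω => (g ω, h ω)) (b, c)

end Information

section Model

/- `P` is the joint mass function of `(X, X̃, Y)`, that is `P_X` times the channel `P_{X̃Y|X}`. -/
variable {𝒳 𝒳t 𝒴 : Type*} [Fintype 𝒳] [Fintype 𝒳t] [Fintype 𝒴]

/-- Mass function of `n` i.i.d. copies of `(X, X̃, Y)`. -/
def iid (P : 𝒳 × 𝒳t × 𝒴 → ℝ) (n : ℕ) (ω : Fin n → 𝒳 × 𝒳t × 𝒴) : ℝ :=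
  ∏ i, P (ω i)

/-- The sequence `Xⁿ` of hidden identifier outputs. -/
def seqX {n : ℕ} (ω : Fin n → 𝒳 × 𝒳t × 𝒴) : Fin n → 𝒳 := fun i => (ω i).1

/-- The sequence `X̃ⁿ` of encoder measurements. -/
def seqXt {n : ℕ} (ω : Fin n → 𝒳 × 𝒳t × 𝒴) : Fin n → 𝒳t := fun i => (ω i).2.1

/-- The sequence `Yⁿ` of decoder measurements. -/
def seqY {n : ℕ} (ω : Fin n → 𝒳 × 𝒳t × 𝒴) : Fin n → 𝒴 := fun i => (ω i).2.2

/-- The conditions on key `S`, key estimate `Ŝ`, helper data `W` and identifier sequence `Xⁿ` at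
blocklength `n`, for the rate tuple `R = (R_s, R_ℓ, R_w)` and the tolerance `δ`. -/
structure MeetsConstraints {Ω : Type*} [Fintype Ω] (p : Ω → ℝ) {n s w : ℕ}
    (S Shat : Ω → Fin s) (W : Ω → Fin w) (Xn : Ω → (Fin n → 𝒳))
    (R : ℝ × ℝ × ℝ) (δ : ℝ) : Prop where
  key_rate : R.1 = Real.log s / n
  reliability : prob p (fun ω => S ω ≠ Shat ω) ≤ δ
  secrecy : mutualInfo p S W ≤ δ
  privacy : 1 / (n : ℝ) * mutualInfo p Xn W ≤ R.2.1 + δ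
  uniformity : 1 / (n : ℝ) * entropy p S ≥ R.1 - δ
  storage : 1 / (n : ℝ) * Real.log w ≤ R.2.2 + δ

/-- The generated-secret code `(enc, dec)` meets the constraints: `(W, S) = enc X̃ⁿ` and
`Ŝ = dec (W, Yⁿ)`. -/
def GSFeasible (P : 𝒳 × 𝒳t × 𝒴 → ℝ) {n s w : ℕ}
    (enc : (Fin n → 𝒳t) → Fin w × Fin s) (dec : Fin w × (Fin n → 𝒴) → Fin s)
    (R : ℝ × ℝ × ℝ) (δ : ℝ) : Prop :=
  MeetsConstraints (iid P n)
    (fun ω => (enc (seqXt ω)).2)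
    (fun ω => dec ((enc (seqXt ω)).1, seqY ω))
    (fun ω => (enc (seqXt ω)).1)
    seqX R δ

/-- The chosen-secret code `(enc, dec)` meets the constraints: the key `S` has law `PS` and is
independent of `(Xⁿ, X̃ⁿ, Yⁿ)`, `W = enc (X̃ⁿ, S)` and `Ŝ = dec (W, Yⁿ)`. -/
def CSFeasible (P : 𝒳 × 𝒳t × 𝒴 → ℝ) {n s w : ℕ} (PS : Fin s → ℝ)
    (enc : (Fin n → 𝒳t) × Fin s → Fin w) (dec : Fin w × (Fin n → 𝒴) → Fin s)
    (R : ℝ × ℝ × ℝ) (δ : ℝ) : Prop :=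
  MeetsConstraints (fun ω : (Fin n → 𝒳 × 𝒳t × 𝒴) × Fin s => iid P n ω.1 * PS ω.2)
    (fun ω => ω.2)
    (fun ω => dec (enc (seqXt ω.1, ω.2), seqY ω.1))
    (fun ω => enc (seqXt ω.1, ω.2))
    (fun ω => seqX ω.1) R δ

/-- Achievable rate tuples of the generated-secret model. -/
def GSAchievable (P : 𝒳 × 𝒳t × 𝒴 → ℝ) (R : ℝ × ℝ × ℝ) : Prop :=
  ∀ δ : ℝ, 0 < δ → ∃ n s w : ℕ, 1 ≤ n ∧
    ∃ (enc : (Fin n → 𝒳t) → Fin w × Fin s) (dec : Fin w × (Fin n → 𝒴) → Fin s),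
      GSFeasible P enc dec R δ

/-- Achievable rate tuples of the chosen-secret model; the law of the key is only constrained
through the uniformity condition. -/
def CSAchievable (P : 𝒳 × 𝒳t × 𝒴 → ℝ) (R : ℝ × ℝ × ℝ) : Prop :=
  ∀ δ : ℝ, 0 < δ → ∃ n s w : ℕ, 1 ≤ n ∧
    ∃ PS ∈ stdSimplex ℝ (Fin s),
    ∃ (enc : (Fin n → 𝒳t) × Fin s → Fin w) (dec : Fin w × (Fin n → 𝒴) → Fin s),
      CSFeasible P PS enc dec R δ

/-- Achievable rate tuples of the chosen-secret model with an exactly uniform key. -/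
def CSUniformAchievable (P : 𝒳 × 𝒳t × 𝒴 → ℝ) (R : ℝ × ℝ × ℝ) : Prop :=
  ∀ δ : ℝ, 0 < δ → ∃ n s w : ℕ, 1 ≤ n ∧ 1 ≤ s ∧
    ∃ (enc : (Fin n → 𝒳t) × Fin s → Fin w) (dec : Fin w × (Fin n → 𝒴) → Fin s),
      CSFeasible P (fun _ => 1 / (s : ℝ)) enc dec R δ

/-- Key-leakage-storage region of the generated-secret model. -/
def gsRegion (P : 𝒳 × 𝒳t × 𝒴 → ℝ) : Set (ℝ × ℝ × ℝ) := closure {R | GSAchievable P R}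

/-- Key-leakage-storage region of the chosen-secret model. -/
def csRegion (P : 𝒳 × 𝒳t × 𝒴 → ℝ) : Set (ℝ × ℝ × ℝ) := closure {R | CSAchievable P R}

/-- Key-leakage-storage region of the chosen-secret model with an exactly uniform key. -/
def csUniformRegion (P : 𝒳 × 𝒳t × 𝒴 → ℝ) : Set (ℝ × ℝ × ℝ) :=
  closure {R | CSUniformAchievable P R}

/-- Joint mass function of `(U, X, X̃, Y)` for the test channel `V = P_{U|X̃}`; by construction
`U - X̃ - (X, Y)` is a Markov chain. -/
def auxJoint (P : 𝒳 × 𝒳t × 𝒴 → ℝ) {k : ℕ} (V : 𝒳t → Fin k → ℝ)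
    (ω : Fin k × 𝒳 × 𝒳t × 𝒴) : ℝ :=
  P ω.2 * V ω.2.2.1 ω.1

/-- `I(U; X)` -/
noncomputable def infoUX (P : 𝒳 × 𝒳t × 𝒴 → ℝ) {k : ℕ} (V : 𝒳t → Fin k → ℝ) : ℝ :=
  mutualInfo (auxJoint P V) (fun ω => ω.1) (fun ω => ω.2.1)

/-- `I(U; X̃)` -/
noncomputable def infoUXt (P : 𝒳 × 𝒳t × 𝒴 → ℝ) {k : ℕ} (V : 𝒳t → Fin k → ℝ) : ℝ :=
  mutualInfo (auxJoint P V) (fun ω => ω.1) (fun ω => ω.2.2.1)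

/-- `I(U; Y)` -/
noncomputable def infoUY (P : 𝒳 × 𝒳t × 𝒴 → ℝ) {k : ℕ} (V : 𝒳t → Fin k → ℝ) : ℝ :=
  mutualInfo (auxJoint P V) (fun ω => ω.1) (fun ω => ω.2.2.2)

/-- The part of the region `𝓡₂` that comes from auxiliary alphabets with `k` letters. -/
def regionR2Card (P : 𝒳 × 𝒳t × 𝒴 → ℝ) (k : ℕ) : Set (ℝ × ℝ × ℝ) :=
  {R | ∃ V : 𝒳t → Fin k → ℝ, (∀ x, V x ∈ stdSimplex ℝ (Fin k)) ∧
    max 0 (infoUX P V - infoUY P V) = 0 ∧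
    0 ≤ R.1 ∧ R.1 ≤ infoUY P V ∧
    R.2.1 ≥ max 0 (infoUX P V - infoUY P V) ∧
    R.2.2 ≥ infoUXt P V - infoUY P V}

/-- The part of the region `𝓡₄` that comes from auxiliary alphabets with `k` letters. -/
def regionR4Card (P : 𝒳 × 𝒳t × 𝒴 → ℝ) (k : ℕ) : Set (ℝ × ℝ × ℝ) :=
  {R | ∃ V : 𝒳t → Fin k → ℝ, (∀ x, V x ∈ stdSimplex ℝ (Fin k)) ∧
    max 0 (infoUX P V - infoUY P V) = 0 ∧
    0 ≤ R.1 ∧ R.1 ≤ infoUY P V ∧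
    R.2.1 ≥ max 0 (infoUX P V - infoUY P V) ∧
    R.2.2 ≥ infoUXt P V}

/-- The region `𝓡₂`: the union over all test channels `P_{U|X̃}` with finite `U` alphabet. -/
def regionR2 (P : 𝒳 × 𝒳t × 𝒴 → ℝ) : Set (ℝ × ℝ × ℝ) := ⋃ k, regionR2Card P k

/-- The region `𝓡₄`: the union over all test channels `P_{U|X̃}` with finite `U` alphabet. -/
def regionR4 (P : 𝒳 × 𝒳t × 𝒴 → ℝ) : Set (ℝ × ℝ × ℝ) := ⋃ k, regionR4Card P k

end Model

end KeyAgreement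

/-!
Degradedness makes `I(U; X) ≤ I(U; Y)` for every test channel, so the privacy constraints in `𝓡₂`
and `𝓡₄` are void, and `I(Xⁿ; W) ≤ I(Yⁿ; W)` for all helper data `W` computed from `X̃ⁿ`.

Converse. The pair `(S, W)` is the output of a channel from `X̃ⁿ`. Splitting off one letter at a
time and time sharing between the letters gives a test channel whose informations are `1 / n`
times those of the block. A dependency between the columns of a test channel can be used to shift
its weights without changing the law of `X̃` or decreasing the relevant informations until a
letter drops out, which bounds the alphabet. Test channels of bounded alphabet are a compact set,
so the tolerance `δ` may tend to `0`.

Achievability. A random codebook of about `exp (n I(U; X̃))` words covers `X̃ⁿ`. The index of the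
covering word has large min-entropy, so a random map sends it to an almost uniform pair `(W, S)`
of bin and position in the bin; about `exp (n I(U; Y))` words per bin can be told apart by means
of `Yⁿ`. The side information then determines nearly all of the index, hence `I(Yⁿ; W)` is small
compared with `n` although `W` has positive rate. For the chosen-secret model the generated key
serves as a one-time pad.
-/

namespace KeyAgreement

section Probability

variable {Ω α β : Type*} [Fintype Ω]

lemma prob_eq_sum_mul (p : Ω → ℝ) (E : Ω → Prop) [DecidablePred E] :
    prob p E = ∑ ω, p ω * (if E ω then 1 else 0) := by
  unfold prob
  refine Finset.sum_congr rfl fun ω _ => ?_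
  by_cases h : E ω <;> simp [h]

lemma prob_congr (p : Ω → ℝ) {E F : Ω → Prop} (h : ∀ ω, E ω ↔ F ω) : prob p E = prob p F := by
  rw [show E = F from funext fun ω => propext (h ω)]

lemma prob_nonneg {p : Ω → ℝ} (hp : ∀ ω, 0 ≤ p ω) (E : Ω → Prop) : 0 ≤ prob p E := by
  classical
  rw [prob_eq_sum_mul]
  exact Finset.sum_nonneg fun ω _ => mul_nonneg (hp ω) (by split_ifs <;> norm_num)

lemma prob_mono {p : Ω → ℝ} (hp : ∀ ω, 0 ≤ p ω) {E F : Ω → Prop} (h : ∀ ω, E ω → F ω) :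
    prob p E ≤ prob p F := by
  classical
  rw [prob_eq_sum_mul, prob_eq_sum_mul]
  refine Finset.sum_le_sum fun ω _ => mul_le_mul_of_nonneg_left ?_ (hp ω)
  have := h ω
  split_ifs <;> simp_all

lemma prob_le_one {p : Ω → ℝ} (hp : p ∈ stdSimplex ℝ Ω) (E : Ω → Prop) : prob p E ≤ 1 :=
  (prob_mono hp.1 (F := fun _ => True) fun _ _ => trivial).trans (by simp [prob, hp.2])

lemma le_prob {p : Ω → ℝ} (hp : ∀ ω, 0 ≤ p ω) {E : Ω → Prop} {ω : Ω} (h : E ω) :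
    p ω ≤ prob p E := by
  classical
  rw [prob_eq_sum_mul]
  simpa [h] using Finset.single_le_sum (f := fun ω => p ω * if E ω then (1 : ℝ) else 0)
    (fun ω _ => mul_nonneg (hp ω) (by split_ifs <;> norm_num)) (Finset.mem_univ ω)

lemma prob_or_le {p : Ω → ℝ} (hp : ∀ ω, 0 ≤ p ω) (E F : Ω → Prop) :
    prob p (fun ω => E ω ∨ F ω) ≤ prob p E + prob p F := by
  classical
  simp only [prob_eq_sum_mul, ← Finset.sum_add_distrib]
  refine Finset.sum_le_sum fun ω _ => ?_
  by_cases hE : E ω <;> by_cases hF : F ω <;> simp [hE, hF, hp]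

lemma prob_exists_le {ι : Type*} [Fintype ι] {p : Ω → ℝ} (hp : ∀ ω, 0 ≤ p ω) (E : ι → Ω → Prop) :
    prob p (fun ω => ∃ i, E i ω) ≤ ∑ i, prob p (E i) := by
  classical
  simp only [prob_eq_sum_mul]
  rw [Finset.sum_comm]
  refine Finset.sum_le_sum fun ω _ => ?_
  have hnonneg : ∀ i, 0 ≤ p ω * (if E i ω then 1 else 0) := fun i =>
    mul_nonneg (hp ω) (by split_ifs <;> norm_num)
  split_ifs with h
  · obtain ⟨i, hi⟩ := h
    simpa [hi] using Finset.single_le_sum (fun j _ => hnonneg j) (Finset.mem_univ i)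
  · simpa using Finset.sum_nonneg fun i _ => hnonneg i

lemma prob_not {p : Ω → ℝ} (hp : ∑ ω, p ω = 1) (E : Ω → Prop) :
    prob p (fun ω => ¬ E ω) = 1 - prob p E := by
  classical
  rw [eq_sub_iff_add_eq, prob_eq_sum_mul, prob_eq_sum_mul, ← Finset.sum_add_distrib]
  refine Eq.trans ?_ hp
  refine Finset.sum_congr rfl fun ω _ => ?_
  by_cases h : E ω <;> simp [h]

lemma sum_mul_ite_eq_prob (p : Ω → ℝ) (E : Ω → Prop) [DecidablePred E] (A B : ℝ) :
    ∑ ω, p ω * (if E ω then A else B) = prob p E * A + prob p (fun ω => ¬ E ω) * B := by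
  simp only [prob_eq_sum_mul, Finset.sum_mul, ← Finset.sum_add_distrib]
  refine Finset.sum_congr rfl fun ω _ => ?_
  by_cases h : E ω <;> simp [h]

lemma law_eq_prob (p : Ω → ℝ) (f : Ω → α) (a : α) : law p f a = prob p (fun ω => f ω = a) := rfl

lemma law_apply [DecidableEq α] (p : Ω → ℝ) (f : Ω → α) (a : α) :
    law p f a = ∑ ω, if f ω = a then p ω else 0 := by
  unfold law
  congr!

lemma sum_law_mul [Fintype α] (p : Ω → ℝ) (f : Ω → α) (g : α → ℝ) :
    ∑ a, law p f a * g a = ∑ ω, p ω * g (f ω) := by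
  classical
  simp only [law_apply, Finset.sum_mul, ite_mul, zero_mul]
  rw [Finset.sum_comm]
  simp

lemma sum_law [Fintype α] (p : Ω → ℝ) (f : Ω → α) : ∑ a, law p f a = ∑ ω, p ω := by
  simpa using sum_law_mul p f (fun _ => 1)

lemma law_nonneg {p : Ω → ℝ} (hp : ∀ ω, 0 ≤ p ω) (f : Ω → α) (a : α) : 0 ≤ law p f a :=
  prob_nonneg hp _

lemma law_mem_stdSimplex [Fintype α] {p : Ω → ℝ} (hp : p ∈ stdSimplex ℝ Ω) (f : Ω → α) :
    law p f ∈ stdSimplex ℝ α :=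
  ⟨law_nonneg hp.1 f, (sum_law p f).trans hp.2⟩

lemma le_law {p : Ω → ℝ} (hp : ∀ ω, 0 ≤ p ω) (f : Ω → α) (ω : Ω) : p ω ≤ law p f (f ω) :=
  le_prob hp rfl

lemma law_pos {p : Ω → ℝ} (hp : ∀ ω, 0 ≤ p ω) (f : Ω → α) {ω : Ω} (h : 0 < p ω) :
    0 < law p f (f ω) :=
  h.trans_le (le_law hp f ω)

lemma law_comp [Fintype α] (p : Ω → ℝ) (f : Ω → α) (g : α → β) :
    law (law p f) g = law p (fun ω => g (f ω)) := by
  classical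
  funext b
  simpa [law_apply] using sum_law_mul p f (fun a => if g a = b then 1 else 0)

lemma law_const (p : Ω → ℝ) (b : β) : law p (fun _ => b) b = ∑ ω, p ω := by
  simp [law]

lemma law_le_of_imp {p : Ω → ℝ} (hp : ∀ ω, 0 ≤ p ω) {f : Ω → α} {g : Ω → β} {a : α} {b : β}
    (h : ∀ ω, f ω = a → g ω = b) : law p f a ≤ law p g b :=
  prob_mono hp h

lemma law_congr_of_iff (p : Ω → ℝ) {f : Ω → α} {g : Ω → β} {a : α} {b : β}
    (h : ∀ ω, f ω = a ↔ g ω = b) : law p f a = law p g b :=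
  prob_congr p h

lemma sum_law_pair [Fintype β] (p : Ω → ℝ) (f : Ω → α) (g : Ω → β) (a : α) :
    ∑ b, law p (fun ω => (f ω, g ω)) (a, b) = law p f a := by
  classical
  simp only [law_apply, Prod.mk.injEq, ite_and]
  rw [Finset.sum_comm]
  refine Finset.sum_congr rfl fun ω _ => ?_
  split_ifs <;> simp

lemma sum_law_pair_left [Fintype α] (p : Ω → ℝ) (f : Ω → α) (g : Ω → β) (b : β) :
    ∑ a, law p (fun ω => (f ω, g ω)) (a, b) = law p g b := by
  rw [← sum_law_pair p g f b]
  exact Finset.sum_congr rfl fun a _ => law_congr_of_iff p fun ω => by simp [and_comm]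

lemma prob_law [Fintype α] (p : Ω → ℝ) (f : Ω → α) (E : α → Prop) :
    prob (law p f) E = prob p (fun ω => E (f ω)) := by
  classical
  rw [prob_eq_sum_mul, prob_eq_sum_mul, sum_law_mul]

end Probability

section Information

variable {Ω α β γ : Type*} [Fintype Ω] [Fintype α] [Fintype β] [Fintype γ]

lemma entropy_eq_neg_sum (p : Ω → ℝ) (f : Ω → α) :
    entropy p f = -∑ ω, p ω * Real.log (law p f (f ω)) := by
  rw [← sum_law_mul p f (fun a => Real.log (law p f a)), ← Finset.sum_neg_distrib]
  exact Finset.sum_congr rfl fun a _ => by simp [Real.negMulLog]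

lemma entropy_congr (p : Ω → ℝ) {f : Ω → α} {g : Ω → β}
    (h : ∀ ω ω', f ω = f ω' ↔ g ω = g ω') : entropy p f = entropy p g := by
  rw [entropy_eq_neg_sum, entropy_eq_neg_sum]
  congr 1
  refine Finset.sum_congr rfl fun ω _ => ?_
  rw [law_congr_of_iff p fun ω' => h ω' ω]

lemma entropy_mono {p : Ω → ℝ} (hp : ∀ ω, 0 ≤ p ω) {f : Ω → α} {g : Ω → β}
    (h : ∀ ω ω', f ω = f ω' → g ω = g ω') : entropy p g ≤ entropy p f := by
  rw [entropy_eq_neg_sum, entropy_eq_neg_sum]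
  refine neg_le_neg (Finset.sum_le_sum fun ω _ => ?_)
  rcases (hp ω).eq_or_lt with h0 | h0
  · simp [← h0]
  · exact mul_le_mul_of_nonneg_left
      (Real.log_le_log (law_pos hp f h0) (law_le_of_imp hp fun ω' => h ω' ω)) (hp ω)

lemma entropy_law (p : Ω → ℝ) (f : Ω → α) (g : α → β) :
    entropy (law p f) g = entropy p (fun ω => g (f ω)) := by
  unfold entropy
  rw [law_comp]

lemma mutualInfo_law (p : Ω → ℝ) (f : Ω → α) (g : α → β) (h : α → γ) :
    mutualInfo (law p f) g h = mutualInfo p (fun ω => g (f ω)) (fun ω => h (f ω)) := by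
  simp only [mutualInfo, entropy_law]

lemma mutualInfo_comm (p : Ω → ℝ) (f : Ω → α) (g : Ω → β) :
    mutualInfo p f g = mutualInfo p g f := by
  unfold mutualInfo
  rw [entropy_congr p (f := fun ω => (f ω, g ω)) (g := fun ω => (g ω, f ω))
    (by simp only [Prod.mk.injEq, and_comm, implies_true]), add_comm (entropy p f)]

lemma mutualInfo_eq_sum_log {p : Ω → ℝ} (hp : ∀ ω, 0 ≤ p ω) (f : Ω → α) (g : Ω → γ) :
    mutualInfo p f g = ∑ ω, p ω * Real.log (law p (fun ω => (f ω, g ω)) (f ω, g ω) /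
      (law p f (f ω) * law p g (g ω))) := by
  simp only [mutualInfo, entropy_eq_neg_sum, ← neg_add, ← Finset.sum_add_distrib,
    ← neg_sub', ← Finset.sum_sub_distrib, ← Finset.sum_neg_distrib]
  refine Finset.sum_congr rfl fun ω _ => ?_
  rcases (hp ω).eq_or_lt with h0 | h0
  · simp [← h0]
  · have hf := law_pos hp f h0
    have hg := law_pos hp g h0
    rw [Real.log_div (law_pos hp (fun ω => (f ω, g ω)) h0).ne' (by positivity),
      Real.log_mul hf.ne' hg.ne']
    ring

lemma entropy_le_crossEntropy {p : Ω → ℝ} (hp : p ∈ stdSimplex ℝ Ω) (f : Ω → α) {r : α → ℝ}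
    (hr : ∀ a, 0 ≤ r a) (hr1 : ∑ a, r a ≤ 1) (hpos : ∀ ω, 0 < p ω → 0 < r (f ω)) :
    entropy p f ≤ -∑ ω, p ω * Real.log (r (f ω)) := by
  have hlog (ω : Ω) : p ω * Real.log (r (f ω)) - p ω * Real.log (law p f (f ω)) ≤
      p ω * (r (f ω) / law p f (f ω)) - p ω := by
    rcases (hp.1 ω).eq_or_lt with h0 | h0
    · simp [← h0]
    · have hr0 := hpos ω h0
      have hl0 := law_pos hp.1 f h0
      rw [← mul_sub, ← Real.log_div hr0.ne' hl0.ne', ← mul_sub_one]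
      exact mul_le_mul_of_nonneg_left (Real.log_le_sub_one_of_pos (div_pos hr0 hl0)) (hp.1 ω)
  have hratio : ∑ ω, p ω * (r (f ω) / law p f (f ω)) ≤ 1 := by
    rw [← sum_law_mul p f fun a => r a / law p f a]
    refine (Finset.sum_le_sum fun a _ => ?_).trans hr1
    rcases eq_or_ne (law p f a) 0 with h0 | h0
    · simpa [h0] using hr a
    · rw [mul_div_cancel₀ _ h0]
  have hsum := Finset.sum_le_sum fun ω (_ : ω ∈ Finset.univ) => hlog ω
  rw [Finset.sum_sub_distrib, Finset.sum_sub_distrib, hp.2] at hsum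
  rw [entropy_eq_neg_sum]
  linarith

lemma entropy_pair_le_of_kernel {p : Ω → ℝ} (hp : p ∈ stdSimplex ℝ Ω)
    (f : Ω → α) (h : Ω → γ) (q : α → γ → ℝ) (hq : ∀ a c, 0 ≤ q a c) (hq1 : ∀ c, ∑ a, q a c ≤ 1)
    (hpos : ∀ ω, 0 < p ω → 0 < q (f ω) (h ω)) :
    entropy p (fun ω => (f ω, h ω)) ≤ entropy p h - ∑ ω, p ω * Real.log (q (f ω) (h ω)) := by
  have hsum : ∑ ac : α × γ, q ac.1 ac.2 * law p h ac.2 ≤ 1 := by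
    rw [Fintype.sum_prod_type_right, ← hp.2, ← sum_law p h]
    refine Finset.sum_le_sum fun c _ => ?_
    dsimp only
    rw [← Finset.sum_mul]
    exact mul_le_of_le_one_left (law_nonneg hp.1 h c) (hq1 c)
  have key := entropy_le_crossEntropy hp (fun ω => (f ω, h ω))
    (r := fun ac => q ac.1 ac.2 * law p h ac.2)
    (fun ac => mul_nonneg (hq _ _) (law_nonneg hp.1 h _)) hsum
    (fun ω h0 => mul_pos (hpos ω h0) (law_pos hp.1 h h0))
  have hsplit : ∑ ω, p ω * Real.log (q (f ω) (h ω) * law p h (h ω)) =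
      ∑ ω, p ω * Real.log (q (f ω) (h ω)) + ∑ ω, p ω * Real.log (law p h (h ω)) := by
    rw [← Finset.sum_add_distrib]
    refine Finset.sum_congr rfl fun ω _ => ?_
    rcases (hp.1 ω).eq_or_lt with h0 | h0
    · simp [← h0]
    · rw [Real.log_mul (hpos ω h0).ne' (law_pos hp.1 h h0).ne', mul_add]
  rw [entropy_eq_neg_sum p h]
  linarith

lemma entropy_submodular {p : Ω → ℝ} (hp : p ∈ stdSimplex ℝ Ω) (f : Ω → α) (g : Ω → β)
    (h : Ω → γ) :
    entropy p (fun ω => (f ω, g ω, h ω)) + entropy p h ≤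
      entropy p (fun ω => (f ω, h ω)) + entropy p (fun ω => (g ω, h ω)) := by
  have hgibbs := entropy_pair_le_of_kernel hp f (fun ω => (g ω, h ω))
    (fun a bc => law p (fun ω => (f ω, h ω)) (a, bc.2) / law p h bc.2)
    (fun a bc => div_nonneg (law_nonneg hp.1 _ _) (law_nonneg hp.1 _ _))
    (fun bc => by rw [← Finset.sum_div, sum_law_pair_left]; exact div_self_le_one _)
    (fun ω h0 => div_pos (law_pos hp.1 (fun ω => (f ω, h ω)) h0) (law_pos hp.1 h h0))
  have hcond : ∑ ω, p ω * Real.log (law p (fun ω => (f ω, h ω)) (f ω, h ω) / law p h (h ω)) =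
      entropy p h - entropy p (fun ω => (f ω, h ω)) := by
    rw [entropy_eq_neg_sum, entropy_eq_neg_sum, neg_sub_neg, ← Finset.sum_sub_distrib]
    refine Finset.sum_congr rfl fun ω _ => ?_
    rcases (hp.1 ω).eq_or_lt with h0 | h0
    · simp [← h0]
    · rw [Real.log_div (law_pos hp.1 (fun ω => (f ω, h ω)) h0).ne' (law_pos hp.1 h h0).ne',
        mul_sub]
  simp only [hcond] at hgibbs
  linarith

lemma entropy_const {p : Ω → ℝ} (hp : ∑ ω, p ω = 1) (a : α) : entropy p (fun _ => a) = 0 := by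
  rw [entropy_eq_neg_sum]
  simp [law_const, hp]

lemma mutualInfo_nonneg {p : Ω → ℝ} (hp : p ∈ stdSimplex ℝ Ω) (f : Ω → α) (g : Ω → β) :
    0 ≤ mutualInfo p f g := by
  have h := entropy_submodular hp f g (fun _ => ())
  rw [entropy_const hp.2, entropy_congr p (f := fun ω => (f ω, ())) (g := f) (by simp),
    entropy_congr p (f := fun ω => (g ω, ())) (g := g) (by simp),
    entropy_congr p (f := fun ω => (f ω, g ω, ())) (g := fun ω => (f ω, g ω)) (by simp)] at h
  unfold mutualInfo
  linarith

lemma entropy_le_log_card [Nonempty α] {p : Ω → ℝ} (hp : p ∈ stdSimplex ℝ Ω) (f : Ω → α) :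
    entropy p f ≤ Real.log (Fintype.card α) := by
  simpa [← Finset.sum_mul, hp.2] using entropy_le_crossEntropy hp f
    (r := fun _ => 1 / (Fintype.card α : ℝ)) (fun _ => by positivity) (by simp)
    (fun _ _ => by positivity)

lemma entropy_pair_of_indep {p : Ω → ℝ} (hp : ∀ ω, 0 ≤ p ω) {f : Ω → α} {g : Ω → β}
    (H : ∀ a b, law p (fun ω => (f ω, g ω)) (a, b) = law p f a * law p g b) :
    entropy p (fun ω => (f ω, g ω)) = entropy p f + entropy p g := by
  simp only [entropy_eq_neg_sum, ← neg_add, ← Finset.sum_add_distrib, ← mul_add]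
  congr 1
  refine Finset.sum_congr rfl fun ω _ => ?_
  rcases (hp ω).eq_or_lt with h0 | h0
  · simp [← h0]
  · rw [← Real.log_mul (law_pos hp f h0).ne' (law_pos hp g h0).ne', H]

lemma IsMarkovChain.entropy_eq {p : Ω → ℝ} (hp : ∀ ω, 0 ≤ p ω) {f : Ω → α} {g : Ω → β}
    {h : Ω → γ} (H : IsMarkovChain p f g h) :
    entropy p (fun ω => (f ω, g ω, h ω)) + entropy p g =
      entropy p (fun ω => (f ω, g ω)) + entropy p (fun ω => (g ω, h ω)) := by
  simp only [entropy_eq_neg_sum, ← neg_add, ← Finset.sum_add_distrib, ← mul_add]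
  congr 1
  refine Finset.sum_congr rfl fun ω _ => ?_
  rcases (hp ω).eq_or_lt with h0 | h0
  · simp [← h0]
  · rw [← Real.log_mul (law_pos hp (fun ω => (f ω, g ω, h ω)) h0).ne' (law_pos hp g h0).ne', H,
      Real.log_mul (law_pos hp (fun ω => (f ω, g ω)) h0).ne'
        (law_pos hp (fun ω => (g ω, h ω)) h0).ne']

lemma IsMarkovChain.mutualInfo_le {p : Ω → ℝ} (hp : p ∈ stdSimplex ℝ Ω) {f : Ω → α} {g : Ω → β}
    {h : Ω → γ} (H : IsMarkovChain p f g h) : mutualInfo p f h ≤ mutualInfo p f g := by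
  have hchain := H.entropy_eq hp.1
  have hsub := entropy_submodular hp g f h
  rw [entropy_congr p (f := fun ω => (g ω, f ω, h ω)) (g := fun ω => (f ω, g ω, h ω))
    (by simp only [Prod.mk.injEq]; tauto)] at hsub
  unfold mutualInfo
  linarith

lemma sum_ite_eq_sub_add_div_le_one [DecidableEq α] {e : ℝ} (he : 0 ≤ e) (a₀ : α) :
    ∑ a, (if a = a₀ then 1 - e else e / Fintype.card α) ≤ 1 := by
  have hcard : (0 : ℝ) < Fintype.card α := by exact_mod_cast Fintype.card_pos_iff.2 ⟨a₀⟩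
  calc ∑ a, (if a = a₀ then 1 - e else e / Fintype.card α)
      ≤ ∑ a, ((if a = a₀ then 1 - e else 0) + e / Fintype.card α) := by
        refine Finset.sum_le_sum fun a _ => ?_
        split_ifs
        · exact le_add_of_nonneg_right (by positivity)
        · rw [zero_add]
    _ = 1 := by
        rw [Finset.sum_add_distrib, Finset.sum_ite_eq' Finset.univ, if_pos (Finset.mem_univ _),
          Finset.sum_const, Finset.card_univ, nsmul_eq_mul, mul_div_cancel₀ _ hcard.ne',
          sub_add_cancel]

lemma fano_inequality {p : Ω → ℝ} (hp : p ∈ stdSimplex ℝ Ω) (f : Ω → α)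
    (h : Ω → γ) (d : γ → α) :
    entropy p (fun ω => (f ω, h ω)) - entropy p h ≤
      Real.binEntropy (prob p fun ω => f ω ≠ d (h ω)) +
        (prob p fun ω => f ω ≠ d (h ω)) * Real.log (Fintype.card α) := by
  classical
  set e := prob p fun ω => f ω ≠ d (h ω) with he
  have he0 : 0 ≤ e := prob_nonneg hp.1 _
  have he1 : e ≤ 1 := prob_le_one hp _
  have hcorrect : prob p (fun ω => f ω = d (h ω)) = 1 - e := by
    rw [he, prob_not hp.2, sub_sub_cancel]
  obtain ⟨ω₀⟩ : Nonempty Ω := by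
    by_contra hΩ
    rw [not_nonempty_iff] at hΩ
    simpa using hp.2
  have hcard : (0 : ℝ) < Fintype.card α := by exact_mod_cast Fintype.card_pos_iff.2 ⟨f ω₀⟩
  -- compare with the channel that reports the guess `d c` correctly with probability `1 - e`
  have hgibbs := entropy_pair_le_of_kernel hp f h
    (fun a c => if a = d c then 1 - e else e / Fintype.card α)
    (fun a c => by
      split_ifs
      exacts [sub_nonneg.2 he1, by positivity])
    (fun c => sum_ite_eq_sub_add_div_le_one he0 (d c))
    (fun ω h0 => by
      split_ifs with hω
      · exact hcorrect ▸ h0.trans_le (le_prob hp.1 hω)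
      · exact div_pos (h0.trans_le (le_prob hp.1 hω)) hcard)
  simp only [apply_ite Real.log] at hgibbs
  rw [sum_mul_ite_eq_prob p fun ω => f ω = d (h ω), hcorrect, ← he] at hgibbs
  rw [Real.binEntropy, Real.log_inv, Real.log_inv]
  rcases he0.eq_or_lt with h0 | h0
  · simp only [← h0, sub_zero, Real.log_one, mul_zero, zero_mul, add_zero, neg_zero] at hgibbs ⊢
    linarith
  · rw [Real.log_div h0.ne' hcard.ne'] at hgibbs
    linarith

end Information

section Product

variable {𝒵₁ 𝒵₂ β₁ β₂ : Type*} [Fintype 𝒵₁] [Fintype 𝒵₂]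

lemma mul_mem_stdSimplex {P₁ : 𝒵₁ → ℝ} (hP₁ : P₁ ∈ stdSimplex ℝ 𝒵₁) {P₂ : 𝒵₂ → ℝ}
    (hP₂ : P₂ ∈ stdSimplex ℝ 𝒵₂) :
    (fun z : 𝒵₁ × 𝒵₂ => P₁ z.1 * P₂ z.2) ∈ stdSimplex ℝ (𝒵₁ × 𝒵₂) := by
  refine ⟨fun z => mul_nonneg (hP₁.1 _) (hP₂.1 _), ?_⟩
  rw [Fintype.sum_prod_type]
  simp only [← Finset.mul_sum, hP₂.2, mul_one, hP₁.2]

lemma law_mul_pair (P₁ : 𝒵₁ → ℝ) (P₂ : 𝒵₂ → ℝ) (g₁ : 𝒵₁ → β₁) (g₂ : 𝒵₂ → β₂) (b₁ : β₁)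
    (b₂ : β₂) :
    law (fun z : 𝒵₁ × 𝒵₂ => P₁ z.1 * P₂ z.2) (fun z => (g₁ z.1, g₂ z.2)) (b₁, b₂) =
      law P₁ g₁ b₁ * law P₂ g₂ b₂ := by
  classical
  simp only [law_apply, Fintype.sum_mul_sum, Fintype.sum_prod_type, Prod.mk.injEq,
    ite_zero_mul_ite_zero]

lemma law_mul_fst (P₁ : 𝒵₁ → ℝ) {P₂ : 𝒵₂ → ℝ} (hP₂ : ∑ z, P₂ z = 1) (g : 𝒵₁ → β₁) :
    law (fun z : 𝒵₁ × 𝒵₂ => P₁ z.1 * P₂ z.2) (fun z => g z.1) = law P₁ g := by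
  funext b
  have h := law_mul_pair P₁ P₂ g (fun _ => ()) b ()
  rwa [law_const, hP₂, mul_one, law_congr_of_iff (g := fun z => g z.1) (b := b) _ (by simp)] at h

lemma law_mul_snd {P₁ : 𝒵₁ → ℝ} (hP₁ : ∑ z, P₁ z = 1) (P₂ : 𝒵₂ → ℝ) (g : 𝒵₂ → β₂) :
    law (fun z : 𝒵₁ × 𝒵₂ => P₁ z.1 * P₂ z.2) (fun z => g z.2) = law P₂ g := by
  funext b
  have h := law_mul_pair P₁ P₂ (fun _ => ()) g () b
  rwa [law_const, hP₁, one_mul, law_congr_of_iff (g := fun z => g z.2) (b := b) _ (by simp)] at h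

lemma prob_mul_fst (P₁ : 𝒵₁ → ℝ) {P₂ : 𝒵₂ → ℝ} (hP₂ : ∑ z, P₂ z = 1) (E : 𝒵₁ → Prop) :
    prob (fun z : 𝒵₁ × 𝒵₂ => P₁ z.1 * P₂ z.2) (fun z => E z.1) = prob P₁ E := by
  simpa [law_eq_prob] using congrFun (law_mul_fst P₁ hP₂ E) True

lemma entropy_mul_pair [Fintype β₁] [Fintype β₂] {P₁ : 𝒵₁ → ℝ} (hP₁ : P₁ ∈ stdSimplex ℝ 𝒵₁)
    {P₂ : 𝒵₂ → ℝ} (hP₂ : P₂ ∈ stdSimplex ℝ 𝒵₂) (g₁ : 𝒵₁ → β₁) (g₂ : 𝒵₂ → β₂) :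
    entropy (fun z : 𝒵₁ × 𝒵₂ => P₁ z.1 * P₂ z.2) (fun z => (g₁ z.1, g₂ z.2)) =
      entropy P₁ g₁ + entropy P₂ g₂ := by
  rw [entropy_pair_of_indep (mul_mem_stdSimplex hP₁ hP₂).1]
  · unfold entropy
    rw [law_mul_fst _ hP₂.2, law_mul_snd hP₁.2]
  · intro a b
    rw [law_mul_pair, law_mul_fst _ hP₂.2, law_mul_snd hP₁.2]

end Product

section ProductMass

variable {ζ β : Type*}

/-- Mass function of a family of i.i.d. variables with mass function `P`, indexed by `ι`. It serves
for the source sequence, where `iid P n` is the special case of a triple `(X, X̃, Y)` and of the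
index set `Fin n`, and for the random codebooks and random binnings. -/
def prodMass (P : ζ → ℝ) (ι : Type*) [Fintype ι] (ω : ι → ζ) : ℝ := ∏ i, P (ω i)

lemma prodMass_nonneg {P : ζ → ℝ} (hP : ∀ z, 0 ≤ P z) {ι : Type*} [Fintype ι] (ω : ι → ζ) :
    0 ≤ prodMass P ι ω :=
  Finset.prod_nonneg fun i _ => hP (ω i)

variable [Fintype ζ]

lemma sum_prodMass_mul_prod {ι : Type*} [Fintype ι] [DecidableEq ι] (P : ζ → ℝ) (g : ι → ζ → ℝ) :
    ∑ ω, prodMass P ι ω * ∏ i, g i (ω i) = ∏ i, ∑ a, P a * g i a := by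
  rw [Finset.prod_univ_sum, Fintype.piFinset_univ]
  exact Finset.sum_congr rfl fun ω _ => Finset.prod_mul_distrib.symm

lemma prodMass_mem_stdSimplex {P : ζ → ℝ} (hP : P ∈ stdSimplex ℝ ζ) (ι : Type*) [Fintype ι]
    [DecidableEq ι] : prodMass P ι ∈ stdSimplex ℝ (ι → ζ) := by
  refine ⟨prodMass_nonneg hP.1, ?_⟩
  simpa [hP.2] using sum_prodMass_mul_prod (ι := ι) P (fun _ _ => 1)

lemma law_prodMass (P : ζ → ℝ) (ι : Type*) [Fintype ι] [DecidableEq ι] (f : ζ → β) :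
    law (prodMass P ι) (fun ω i => f (ω i)) = prodMass (law P f) ι := by
  classical
  funext b
  simp only [law_apply, prodMass]
  rw [Finset.prod_univ_sum, Fintype.piFinset_univ]
  refine Finset.sum_congr rfl fun ω _ => ?_
  simp only [funext_iff, Finset.prod_ite_zero, Finset.mem_univ, true_implies]

end ProductMass

section Markov

variable {Ω α α' β γ : Type*} [Fintype Ω]

lemma law_pair_comp_left [Fintype α] [DecidableEq α'] (p : Ω → ℝ) (f : Ω → α) (k : Ω → β)
    (φ : α → α') (a' : α') (b : β) :
    law p (fun ω => (φ (f ω), k ω)) (a', b) =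
      ∑ a, if φ a = a' then law p (fun ω => (f ω, k ω)) (a, b) else 0 := by
  classical
  simp only [law_apply, Prod.mk.injEq, ite_and, ← Finset.sum_filter (fun a => φ a = a')]
  rw [Finset.sum_comm]
  simp [Finset.sum_ite_eq, Finset.mem_filter]

lemma IsMarkovChain.comp_left [Finite α] {p : Ω → ℝ} {f : Ω → α} {g : Ω → β} {h : Ω → γ}
    (H : IsMarkovChain p f g h) (φ : α → α') : IsMarkovChain p (fun ω => φ (f ω)) g h := by
  classical
  have := Fintype.ofFinite α
  intro a b c
  simp only [law_pair_comp_left p f _ φ, Finset.sum_mul, ite_mul, zero_mul, H _ b c]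

lemma isMarkovChain_self (p : Ω → ℝ) (f : Ω → α) (h : Ω → γ) : IsMarkovChain p f f h := by
  classical
  intro a b c
  rcases eq_or_ne a b with rfl | hab
  · simp only [law_apply, Prod.mk.injEq, and_self_left, and_self, mul_comm]
  · have hne (ω : Ω) : ¬(f ω = a ∧ f ω = b) := fun h => hab (h.1.symm.trans h.2)
    simp only [law_apply, Prod.mk.injEq, ← and_assoc, hne, false_and, if_false,
      Finset.sum_const_zero, zero_mul]

lemma IsMarkovChain.prodMass_seq {P : Ω → ℝ} {f : Ω → α} {g : Ω → β} {h : Ω → γ}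
    (H : IsMarkovChain P f g h) (ι : Type*) [Fintype ι] [DecidableEq ι] :
    IsMarkovChain (prodMass P ι) (fun ω i => f (ω i)) (fun ω i => g (ω i))
      (fun ω i => h (ω i)) := by
  intro a b c
  have hfgh : law (prodMass P ι)
      (fun ω => (fun i => f (ω i), fun i => g (ω i), fun i => h (ω i))) (a, b, c) =
        prodMass (law P fun z => (f z, g z, h z)) ι fun i => (a i, b i, c i) := by
    rw [← law_prodMass]
    exact law_congr_of_iff _ fun ω => by simp only [funext_iff, Prod.mk.injEq, forall_and]
  have hfg : law (prodMass P ι) (fun ω => (fun i => f (ω i), fun i => g (ω i))) (a, b) =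
      prodMass (law P fun z => (f z, g z)) ι fun i => (a i, b i) := by
    rw [← law_prodMass]
    exact law_congr_of_iff _ fun ω => by simp only [funext_iff, Prod.mk.injEq, forall_and]
  have hgh : law (prodMass P ι) (fun ω => (fun i => g (ω i), fun i => h (ω i))) (b, c) =
      prodMass (law P fun z => (g z, h z)) ι fun i => (b i, c i) := by
    rw [← law_prodMass]
    exact law_congr_of_iff _ fun ω => by simp only [funext_iff, Prod.mk.injEq, forall_and]
  rw [hfgh, hfg, hgh, law_prodMass]
  simp only [prodMass, ← Finset.prod_mul_distrib]
  exact Finset.prod_congr rfl fun i _ => H (a i) (b i) (c i)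

end Markov

section OneTimePad

variable {Z α : Type*} [Fintype Z] [Fintype α] {s : ℕ} [NeZero s]

lemma uniform_mem_stdSimplex : (fun _ : Fin s => 1 / (s : ℝ)) ∈ stdSimplex ℝ (Fin s) :=
  ⟨fun _ => by positivity, by simp⟩

lemma entropy_uniform : entropy (fun _ : Fin s => 1 / (s : ℝ)) (fun k => k) = Real.log s := by
  rw [entropy_eq_neg_sum]
  simp [law, mul_inv_cancel_left₀ (Nat.cast_ne_zero.2 (NeZero.ne s) : (s : ℝ) ≠ 0)]

lemma entropy_pair_add_uniform {P : Z → ℝ} (hP : P ∈ stdSimplex ℝ Z) (f : Z → α) (g : Z → Fin s) :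
    entropy (fun ω : Z × Fin s => P ω.1 * (1 / (s : ℝ))) (fun ω => (f ω.1, g ω.1 + ω.2)) =
      entropy P f + Real.log s := by
  classical
  rw [← entropy_uniform (s := s), ← entropy_mul_pair hP uniform_mem_stdSimplex f (fun k => k)]
  unfold entropy
  refine Finset.sum_congr rfl fun ⟨a, t⟩ _ => congrArg _ ?_
  rw [law_apply, law_apply, Fintype.sum_prod_type, Fintype.sum_prod_type]
  refine Finset.sum_congr rfl fun z _ => ?_
  exact Equiv.sum_comp (Equiv.addLeft (g z))
    (fun k => if (f z, k) = (a, t) then P z * (1 / (s : ℝ)) else 0)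

end OneTimePad

section Kernel

variable {𝒵 ξ 𝒰 𝒱 β γ : Type*} [Fintype 𝒵]

/-- Joint mass function of `(U, Z)`, where `U` is obtained from `x Z` through the channel `V`;
`auxJoint` is the special case of a source `Z = (X, X̃, Y)` observed through `X̃`. -/
def kernelJoint (P : 𝒵 → ℝ) (x : 𝒵 → ξ) (V : ξ → 𝒰 → ℝ) (ω : 𝒰 × 𝒵) : ℝ :=
  P ω.2 * V (x ω.2) ω.1

variable [Fintype 𝒰]

lemma kernelJoint_mem_stdSimplex {P : 𝒵 → ℝ} (hP : P ∈ stdSimplex ℝ 𝒵) (x : 𝒵 → ξ)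
    {V : ξ → 𝒰 → ℝ} (hV : ∀ a, V a ∈ stdSimplex ℝ 𝒰) :
    kernelJoint P x V ∈ stdSimplex ℝ (𝒰 × 𝒵) := by
  refine ⟨fun ω => mul_nonneg (hP.1 _) ((hV _).1 _), ?_⟩
  simp only [Fintype.sum_prod_type_right, kernelJoint, ← Finset.mul_sum, (hV _).2, mul_one, hP.2]

lemma law_kernelJoint_snd (P : 𝒵 → ℝ) (x : 𝒵 → ξ) {V : ξ → 𝒰 → ℝ}
    (hV : ∀ a, ∑ u, V a u = 1) (f : 𝒵 → β) :
    law (kernelJoint P x V) (fun ω => f ω.2) = law P f := by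
  classical
  funext b
  simp only [law_apply, Fintype.sum_prod_type_right, kernelJoint]
  refine Finset.sum_congr rfl fun z _ => ?_
  split_ifs
  · rw [← Finset.mul_sum, hV, mul_one]
  · exact Finset.sum_const_zero

lemma law_kernelJoint_fst (P : 𝒵 → ℝ) (x : 𝒵 → ξ) (V : ξ → 𝒰 → ℝ) (u : 𝒰) :
    law (kernelJoint P x V) (fun ω => ω.1) u = ∑ z, P z * V (x z) u := by
  classical
  rw [law_apply, Fintype.sum_prod_type_right]
  simp [kernelJoint]

lemma law_kernelJoint_pair (P : 𝒵 → ℝ) (x : 𝒵 → ξ) (V : ξ → 𝒰 → ℝ) (f : 𝒵 → β) (u : 𝒰) (b : β) :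
    law (kernelJoint P x V) (fun ω => (ω.1, f ω.2)) (u, b) =
      law (fun z => P z * V (x z) u) f b := by
  classical
  simp only [law_apply, Fintype.sum_prod_type_right, Prod.mk.injEq, ite_and, kernelJoint,
    Finset.sum_ite_eq', Finset.mem_univ, if_true]

lemma law_kernelJoint_pair_observed (P : 𝒵 → ℝ) (x : 𝒵 → ξ) (V : ξ → 𝒰 → ℝ) (f : 𝒵 → β) (u : 𝒰)
    (a : ξ) (b : β) :
    law (kernelJoint P x V) (fun ω => ((ω.1, x ω.2), f ω.2)) ((u, a), b) =
      V a u * law P (fun z => (x z, f z)) (a, b) := by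
  classical
  rw [law_congr_of_iff (g := fun ω => (ω.1, x ω.2, f ω.2)) (b := (u, a, b)) _ fun ω => by
      simp only [Prod.mk.injEq, and_assoc],
    law_kernelJoint_pair P x V (fun z => (x z, f z)), law_apply, law_apply, Finset.mul_sum]
  refine Finset.sum_congr rfl fun z _ => ?_
  split_ifs with h
  · rw [← (Prod.mk.inj h).1, mul_comm]
  · rw [mul_zero]

lemma IsMarkovChain.kernelJoint {P : 𝒵 → ℝ} {x : 𝒵 → ξ} {y : 𝒵 → β} {g : 𝒵 → γ}
    (H : IsMarkovChain P x y g) {V : ξ → 𝒰 → ℝ} (hV : ∀ a, ∑ u, V a u = 1) :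
    IsMarkovChain (kernelJoint P x V) (fun ω => (ω.1, x ω.2)) (fun ω => y ω.2)
      (fun ω => g ω.2) := by
  rintro ⟨u, a⟩ b c
  rw [law_kernelJoint_pair_observed P x V (fun z => (y z, g z)),
    law_kernelJoint_pair_observed P x V y, law_kernelJoint_snd P x hV y,
    law_kernelJoint_snd P x hV (fun z => (y z, g z)), mul_assoc, mul_assoc, H a b c]

variable [Fintype β] [Fintype γ]

/-- The information `I(U; f(Z))` when `U` is obtained from `x Z` through the channel `V`; it
specializes to `infoUX`, `infoUXt` and `infoUY`. -/
noncomputable def kernelInfo (P : 𝒵 → ℝ) (x : 𝒵 → ξ) (V : ξ → 𝒰 → ℝ) (f : 𝒵 → β) : ℝ :=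
  mutualInfo (kernelJoint P x V) (fun ω => ω.1) (fun ω => f ω.2)

/-- The contribution of a letter `u` with transition weights `v = V(u | ·)` to `kernelInfo`. It is
positively homogeneous in `v`, which makes `kernelInfo` affine in the weights of the letters. -/
noncomputable def columnInfo (P : 𝒵 → ℝ) (x : 𝒵 → ξ) (f : 𝒵 → β) (v : ξ → ℝ) : ℝ :=
  Real.negMulLog (∑ z, P z * v (x z)) -
    ∑ b, Real.negMulLog (law (fun z => P z * v (x z)) f b)

lemma kernelInfo_eq_sum_columnInfo (P : 𝒵 → ℝ) (x : 𝒵 → ξ) {V : ξ → 𝒰 → ℝ}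
    (hV : ∀ a, ∑ u, V a u = 1) (f : 𝒵 → β) :
    kernelInfo P x V f = entropy P f + ∑ u, columnInfo P x f (fun a => V a u) := by
  unfold kernelInfo mutualInfo columnInfo entropy
  rw [law_kernelJoint_snd P x hV, Finset.sum_sub_distrib, Fintype.sum_prod_type]
  simp only [law_kernelJoint_fst, law_kernelJoint_pair]
  ring

lemma columnInfo_smul (P : 𝒵 → ℝ) (x : 𝒵 → ξ) (f : 𝒵 → β) (c : ℝ) (v : ξ → ℝ) :
    columnInfo P x f (fun a => c * v a) = c * columnInfo P x f v := by
  classical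
  have hlaw (b : β) : law (fun z => P z * (c * v (x z))) f b =
      c * law (fun z => P z * v (x z)) f b := by
    simp only [law_apply, Finset.mul_sum, mul_ite, mul_zero, mul_left_comm]
  have hsum : ∑ z, P z * (c * v (x z)) = c * ∑ z, P z * v (x z) := by
    simp only [Finset.mul_sum, mul_left_comm]
  unfold columnInfo
  simp only [hlaw, hsum, Real.negMulLog_mul, Finset.sum_add_distrib]
  rw [← Finset.sum_mul, sum_law, ← Finset.mul_sum]
  ring

lemma columnInfo_zero (P : 𝒵 → ℝ) (x : 𝒵 → ξ) (f : 𝒵 → β) :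
    columnInfo P x f (fun _ => 0) = 0 := by
  simpa using columnInfo_smul P x f 0 (fun _ => 0)

lemma kernelInfo_reindex [Fintype 𝒱] (P : 𝒵 → ℝ) (x : 𝒵 → ξ) {V : ξ → 𝒰 → ℝ}
    (hV : ∀ a, ∑ u, V a u = 1) (f : 𝒵 → β) (e : 𝒱 ≃ 𝒰) :
    kernelInfo P x (fun a u => V a (e u)) f = kernelInfo P x V f := by
  rw [kernelInfo_eq_sum_columnInfo P x hV, kernelInfo_eq_sum_columnInfo P x
    (fun a => (e.sum_comp (V a)).trans (hV a)), e.sum_comp (fun u => columnInfo P x f (V · u))]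

lemma kernelInfo_equiv {𝒵' ξ' β' : Type*} [Fintype 𝒵'] [Fintype β'] (e : 𝒵' ≃ 𝒵) {P : 𝒵 → ℝ}
    {P' : 𝒵' → ℝ} {x : 𝒵 → ξ} {x' : 𝒵' → ξ'} {V : ξ → 𝒰 → ℝ} {V' : ξ' → 𝒰 → ℝ} {f : 𝒵 → β}
    {f' : 𝒵' → β'} (hP : ∀ z, P' z = P (e z)) (hV : ∀ z u, V' (x' z) u = V (x (e z)) u)
    (hf : ∀ z z', f' z = f' z' ↔ f (e z) = f (e z')) :
    kernelInfo P' x' V' f' = kernelInfo P x V f := by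
  classical
  have hlaw : law (kernelJoint P' x' V') (fun ω => (ω.1, e ω.2)) = kernelJoint P x V := by
    funext ⟨u, z⟩
    simp only [law_kernelJoint_pair P' x' V' e, law_apply, ← e.eq_symm_apply, Finset.sum_ite_eq',
      Finset.mem_univ, if_true, kernelJoint, hP, hV, e.apply_symm_apply]
  unfold kernelInfo mutualInfo
  rw [← hlaw]
  simp only [entropy_law]
  rw [entropy_congr _ (f := fun ω : 𝒰 × 𝒵' => f' ω.2) (g := fun ω => f (e ω.2)) fun ω ω' => hf _ _,
    entropy_congr _ (f := fun ω : 𝒰 × 𝒵' => (ω.1, f' ω.2)) (g := fun ω => (ω.1, f (e ω.2)))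
      fun ω ω' => by simp only [Prod.mk.injEq, hf]]

lemma kernelInfo_le_kernelInfo_self [Fintype ξ] {P : 𝒵 → ℝ} (hP : P ∈ stdSimplex ℝ 𝒵) (x : 𝒵 → ξ)
    (y : 𝒵 → β) {V : ξ → 𝒰 → ℝ} (hV : ∀ a, V a ∈ stdSimplex ℝ 𝒰) :
    kernelInfo P x V y ≤ kernelInfo P x V x :=
  (((isMarkovChain_self P x y).kernelJoint fun a => (hV a).2).comp_left Prod.fst).mutualInfo_le
    (kernelJoint_mem_stdSimplex hP _ hV)

end Kernel

section TimeSharing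

variable {𝒵 ξ 𝒰 𝒱 β : Type*} [Fintype 𝒵] [Fintype 𝒰] [Fintype 𝒱] [Fintype β]

/-- Time sharing between the channels `V` and `V'`: the first is used with probability `t`, and the
output alphabet is the disjoint union, so that it is known which one was used. -/
def mixKernel (t : ℝ) (V : ξ → 𝒰 → ℝ) (V' : ξ → 𝒱 → ℝ) (a : ξ) : 𝒰 ⊕ 𝒱 → ℝ :=
  Sum.elim (fun u => t * V a u) (fun u => (1 - t) * V' a u)

lemma mixKernel_mem_stdSimplex {t : ℝ} (ht0 : 0 ≤ t) (ht1 : t ≤ 1) {V : ξ → 𝒰 → ℝ}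
    {V' : ξ → 𝒱 → ℝ} (hV : ∀ a, V a ∈ stdSimplex ℝ 𝒰) (hV' : ∀ a, V' a ∈ stdSimplex ℝ 𝒱)
    (a : ξ) : mixKernel t V V' a ∈ stdSimplex ℝ (𝒰 ⊕ 𝒱) := by
  refine ⟨?_, ?_⟩
  · rintro (u | u)
    · exact mul_nonneg ht0 ((hV a).1 u)
    · exact mul_nonneg (sub_nonneg.2 ht1) ((hV' a).1 u)
  · simp [mixKernel, ← Finset.mul_sum, (hV a).2, (hV' a).2]

lemma kernelInfo_mixKernel (P : 𝒵 → ℝ) (x : 𝒵 → ξ) {t : ℝ} (ht0 : 0 ≤ t) (ht1 : t ≤ 1)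
    {V : ξ → 𝒰 → ℝ} {V' : ξ → 𝒱 → ℝ} (hV : ∀ a, V a ∈ stdSimplex ℝ 𝒰)
    (hV' : ∀ a, V' a ∈ stdSimplex ℝ 𝒱) (f : 𝒵 → β) :
    kernelInfo P x (mixKernel t V V') f =
      t * kernelInfo P x V f + (1 - t) * kernelInfo P x V' f := by
  rw [kernelInfo_eq_sum_columnInfo P x (fun a => (mixKernel_mem_stdSimplex ht0 ht1 hV hV' a).2),
    kernelInfo_eq_sum_columnInfo P x (fun a => (hV a).2),
    kernelInfo_eq_sum_columnInfo P x (fun a => (hV' a).2)]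
  simp only [mixKernel, Fintype.sum_sum_type, Sum.elim_inl, Sum.elim_inr, columnInfo_smul,
    ← Finset.mul_sum]
  ring

lemma natCast_succ_mul_kernelInfo_mixKernel (P : 𝒵 → ℝ) (x : 𝒵 → ξ) (n : ℕ) {V : ξ → 𝒰 → ℝ}
    {V' : ξ → 𝒱 → ℝ} (hV : ∀ a, V a ∈ stdSimplex ℝ 𝒰) (hV' : ∀ a, V' a ∈ stdSimplex ℝ 𝒱)
    (f : 𝒵 → β) :
    ((n + 1 : ℕ) : ℝ) * kernelInfo P x (mixKernel (n / (n + 1 : ℕ)) V V') f =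
      n * kernelInfo P x V f + kernelInfo P x V' f := by
  rw [kernelInfo_mixKernel P x (by positivity) (div_le_one_of_le₀ (by simp) (by positivity)) hV hV']
  push_cast
  field_simp
  ring

end TimeSharing

section Caratheodory

variable {ι ξ : Type*} [Fintype ι] [Fintype ξ]

lemma exists_ne_zero_sum_mul_eq_zero (hcard : Fintype.card ξ + 1 < Fintype.card ι) (M : ξ → ι → ℝ)
    (r s : ι → ℝ) :
    ∃ d : ι → ℝ, d ≠ 0 ∧ (∀ a, ∑ u, d u * M a u = 0) ∧ ∑ u, d u * r u = 0 ∧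
      ∑ u, d u * s u ≤ 0 := by
  let φ : (ι → ℝ) →ₗ[ℝ] (ξ → ℝ) × ℝ :=
    { toFun := fun d => (fun a => ∑ u, d u * M a u, ∑ u, d u * r u)
      map_add' := fun d d' => by ext <;> simp [add_mul, Finset.sum_add_distrib]
      map_smul' := fun t d => by ext <;> simp [mul_assoc, Finset.mul_sum] }
  have hker : LinearMap.ker φ ≠ ⊥ := LinearMap.ker_ne_bot_of_finrank_lt (by simpa using hcard)
  obtain ⟨d, hd, hd0⟩ := (Submodule.ne_bot_iff _).1 hker
  have hφ {d : ι → ℝ} (hd : d ∈ LinearMap.ker φ) :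
      (∀ a, ∑ u, d u * M a u = 0) ∧ ∑ u, d u * r u = 0 :=
    ⟨congrFun (congrArg Prod.fst hd), congrArg Prod.snd hd⟩
  rcases le_total (∑ u, d u * s u) 0 with h | h
  · exact ⟨d, hd0, (hφ hd).1, (hφ hd).2, h⟩
  · exact ⟨-d, neg_ne_zero.2 hd0, (hφ (neg_mem hd)).1, (hφ (neg_mem hd)).2, by simpa using h⟩

/- A nonzero `d` annihilating the rows of `V` has a negative entry; the weights are `1 + t d` for
the largest `t` that keeps them nonnegative. -/
lemma exists_weights_mul_eq_zero (hcard : Fintype.card ξ + 1 < Fintype.card ι) {V : ξ → ι → ℝ}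
    (hV : ∀ a u, 0 ≤ V a u) (r s : ι → ℝ) :
    ∃ (c : ι → ℝ) (u₀ : ι), (∀ u, 0 ≤ c u) ∧ (∀ a, c u₀ * V a u₀ = 0) ∧
      (∀ a, ∑ u, c u * V a u = ∑ u, V a u) ∧ ∑ u, c u * r u = ∑ u, r u ∧
      ∑ u, c u * s u ≤ ∑ u, s u := by
  by_cases hcol : ∃ u, ∀ a, V a u = 0
  · obtain ⟨u, hu⟩ := hcol
    exact ⟨fun _ => 1, u, by simp, by simp [hu], by simp, by simp, by simp⟩
  push Not at hcol
  obtain ⟨d, hd0, hdV, hdr, hds⟩ := exists_ne_zero_sum_mul_eq_zero hcard V r s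
  have : Nonempty ι := Fintype.card_pos_iff.1 (by omega)
  obtain ⟨u₀, hu₀⟩ := Finite.exists_min d
  have hneg : d u₀ < 0 := by
    by_contra! hnonneg
    refine hd0 (funext fun u => ?_)
    obtain ⟨a, ha⟩ := hcol u
    have hterm := (Finset.sum_eq_zero_iff_of_nonneg fun u _ =>
      mul_nonneg (hnonneg.trans (hu₀ u)) (hV a u)).1 (hdV a) u (Finset.mem_univ u)
    exact (mul_eq_zero.1 hterm).resolve_right ha
  set t : ℝ := -1 / d u₀
  have htd : t * d u₀ = -1 := div_mul_cancel₀ _ hneg.ne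
  have ht0 : 0 ≤ t := div_nonneg_of_nonpos (by norm_num) hneg.le
  have hsum (w : ι → ℝ) : ∑ u, (1 + t * d u) * w u = ∑ u, w u + t * ∑ u, d u * w u := by
    simp only [add_mul, one_mul, Finset.sum_add_distrib, Finset.mul_sum, mul_assoc]
  refine ⟨fun u => 1 + t * d u, u₀, fun u => ?_, fun a => ?_, fun a => ?_, ?_, ?_⟩
  · linarith [mul_le_mul_of_nonneg_left (hu₀ u) ht0]
  · simp [htd]
  · rw [hsum, hdV, mul_zero, add_zero]
  · rw [hsum, hdr, mul_zero, add_zero]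
  · rw [hsum]
    linarith [mul_nonpos_of_nonneg_of_nonpos ht0 hds]

end Caratheodory

section AlphabetSize

variable {𝒵 ξ β γ : Type*} [Fintype 𝒵] [Fintype β] [Fintype γ] {k : ℕ}

lemma cons_zero_mem_stdSimplex {v : Fin k → ℝ} (hv : v ∈ stdSimplex ℝ (Fin k)) :
    (Fin.cons 0 v : Fin (k + 1) → ℝ) ∈ stdSimplex ℝ (Fin (k + 1)) :=
  ⟨fun u => Fin.cases le_rfl hv.1 u, by simpa [Fin.sum_univ_succ] using hv.2⟩

lemma kernelInfo_cons_zero (P : 𝒵 → ℝ) (x : 𝒵 → ξ) {V : ξ → Fin k → ℝ}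
    (hV : ∀ a, V a ∈ stdSimplex ℝ (Fin k)) (f : 𝒵 → β) :
    kernelInfo P x (fun a => (Fin.cons 0 (V a) : Fin (k + 1) → ℝ)) f = kernelInfo P x V f := by
  rw [kernelInfo_eq_sum_columnInfo P x fun a => (cons_zero_mem_stdSimplex (hV a)).2,
    kernelInfo_eq_sum_columnInfo P x fun a => (hV a).2, Fin.sum_univ_succ]
  simp [columnInfo_zero]

lemma kernelInfo_succAbove (P : 𝒵 → ℝ) (x : 𝒵 → ξ) {V : ξ → Fin (k + 1) → ℝ}
    (hV : ∀ a, ∑ u, V a u = 1) {u₀ : Fin (k + 1)} (hu₀ : ∀ a, V a u₀ = 0) (f : 𝒵 → β) :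
    kernelInfo P x (fun a j => V a (u₀.succAbove j)) f = kernelInfo P x V f := by
  have hV' (a : ξ) : ∑ j, V a (u₀.succAbove j) = 1 := by
    rw [← hV a, Fin.sum_univ_succAbove _ u₀, hu₀, zero_add]
  rw [kernelInfo_eq_sum_columnInfo P x hV', kernelInfo_eq_sum_columnInfo P x hV,
    Fin.sum_univ_succAbove _ u₀, funext hu₀, columnInfo_zero, zero_add]

lemma exists_kernel_pred [Fintype ξ] (hk : Fintype.card ξ + 1 ≤ k)
    {V : ξ → Fin (k + 1) → ℝ} (hV : ∀ a, V a ∈ stdSimplex ℝ (Fin (k + 1)))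
    (P : 𝒵 → ℝ) (x : 𝒵 → ξ) (f : 𝒵 → β) (g : 𝒵 → γ) :
    ∃ V' : ξ → Fin k → ℝ, (∀ a, V' a ∈ stdSimplex ℝ (Fin k)) ∧
      kernelInfo P x V' f = kernelInfo P x V f ∧ kernelInfo P x V' g ≤ kernelInfo P x V g := by
  obtain ⟨c, u₀, hc0, hu₀, hcV, hcf, hcg⟩ := exists_weights_mul_eq_zero (by simpa using hk)
    (fun a => (hV a).1) (fun u => columnInfo P x f (V · u)) (fun u => columnInfo P x g (V · u))
  have hcV1 (a : ξ) : ∑ u, c u * V a u = 1 := (hcV a).trans (hV a).2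
  refine ⟨fun a j => c (u₀.succAbove j) * V a (u₀.succAbove j), fun a => ⟨fun j =>
    mul_nonneg (hc0 _) ((hV a).1 _), ?_⟩, ?_, ?_⟩
  · rw [← hcV1 a, Fin.sum_univ_succAbove _ u₀, hu₀, zero_add]
  · rw [kernelInfo_succAbove P x (V := fun a u => c u * V a u) hcV1 hu₀,
      kernelInfo_eq_sum_columnInfo P x hcV1, kernelInfo_eq_sum_columnInfo P x fun a => (hV a).2]
    simp only [columnInfo_smul, hcf]
  · rw [kernelInfo_succAbove P x (V := fun a u => c u * V a u) hcV1 hu₀,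
      kernelInfo_eq_sum_columnInfo P x hcV1, kernelInfo_eq_sum_columnInfo P x fun a => (hV a).2]
    simpa only [columnInfo_smul, add_le_add_iff_left] using hcg

end AlphabetSize

section ChainRule

variable {Ω α β₁ β₂ γ : Type*} [Fintype Ω] [Fintype α] [Fintype β₁] [Fintype β₂] [Fintype γ]

lemma mutualInfo_of_subsingleton [Subsingleton β₁] {p : Ω → ℝ} (hp : ∑ ω, p ω = 1) (u : Ω → α)
    (f : Ω → β₁) : mutualInfo p u f = 0 := by
  unfold mutualInfo
  rw [entropy_congr p (f := f) (g := fun _ => ()) fun ω ω' => by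
      simp [Subsingleton.elim (f ω) (f ω')],
    entropy_const hp, entropy_congr p (f := fun ω => (u ω, f ω)) (g := u) fun ω ω' => by
      simp [Subsingleton.elim (f ω) (f ω')], add_zero, sub_self]

lemma mutualInfo_pair_of_indep {p : Ω → ℝ} (hp : ∀ ω, 0 ≤ p ω) (u : Ω → α) {f : Ω → β₁} {g : Ω → β₂}
    (hind : ∀ a b, law p (fun ω => (f ω, g ω)) (a, b) = law p f a * law p g b) :
    mutualInfo p u (fun ω => (f ω, g ω)) =
      mutualInfo p u g + mutualInfo p (fun ω => (u ω, g ω)) f := by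
  unfold mutualInfo
  rw [entropy_pair_of_indep hp hind, entropy_congr p (f := fun ω => (u ω, f ω, g ω))
    (g := fun ω => ((u ω, g ω), f ω)) fun ω ω' => by simp only [Prod.mk.injEq]; tauto]
  ring

lemma mutualInfo_add_mutualInfo_le_of_indep {p : Ω → ℝ} (hp : p ∈ stdSimplex ℝ Ω)
    {u : Ω → α} {f : Ω → β₁} {g : Ω → β₂} {h : Ω → γ}
    (hind : ∀ a b, law p (fun ω => (f ω, g ω)) (a, b) = law p f a * law p g b)
    (hM : IsMarkovChain p (fun ω => (u ω, f ω)) g h) :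
    mutualInfo p u g + mutualInfo p (fun ω => (u ω, h ω)) f ≤
      mutualInfo p u (fun ω => (f ω, g ω)) := by
  have hufgh := hM.entropy_eq hp.1
  have hugh := (hM.comp_left Prod.fst).entropy_eq hp.1
  have hsub := entropy_submodular hp f g (fun ω => (u ω, h ω))
  rw [entropy_congr p (f := fun ω => (f ω, g ω, u ω, h ω)) (g := fun ω => ((u ω, f ω), g ω, h ω))
      fun _ _ => by simp only [Prod.mk.injEq]; tauto,
    entropy_congr p (f := fun ω => (f ω, u ω, h ω)) (g := fun ω => ((u ω, h ω), f ω))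
      fun _ _ => by simp only [Prod.mk.injEq]; tauto,
    entropy_congr p (f := fun ω => (g ω, u ω, h ω)) (g := fun ω => (u ω, g ω, h ω))
      fun _ _ => by simp only [Prod.mk.injEq]; tauto] at hsub
  rw [entropy_congr p (f := fun ω => ((u ω, f ω), g ω)) (g := fun ω => ((u ω, g ω), f ω))
      fun _ _ => by simp only [Prod.mk.injEq]; tauto] at hufgh
  rw [mutualInfo_pair_of_indep hp.1 u hind]
  unfold mutualInfo
  linarith

end ChainRule

section TwoSources

variable {𝒵₁ 𝒵₂ ξ₁ ξ₂ α β₁ β₂ : Type*} [Fintype 𝒵₁] [Fintype 𝒵₂] [Fintype α]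

/-- The channel from the second of two independent sources, the first being averaged out. -/
noncomputable def averageKernel (P₁ : 𝒵₁ → ℝ) (x₁ : 𝒵₁ → ξ₁) (T : ξ₁ × ξ₂ → α → ℝ) (a₂ : ξ₂)
    (a : α) : ℝ := ∑ z₁, P₁ z₁ * T (x₁ z₁, a₂) a

/-- The channel from the first of two independent sources whose output contains in addition the
side information `y₂` on the second source. -/
noncomputable def sideInfoKernel (P₂ : 𝒵₂ → ℝ) (x₂ : 𝒵₂ → ξ₂) (y₂ : 𝒵₂ → β₂) (T : ξ₁ × ξ₂ → α → ℝ)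
    (a₁ : ξ₁) (ab : α × β₂) : ℝ := law (fun z₂ => P₂ z₂ * T (a₁, x₂ z₂) ab.1) y₂ ab.2

lemma averageKernel_mem_stdSimplex {P₁ : 𝒵₁ → ℝ} (hP₁ : P₁ ∈ stdSimplex ℝ 𝒵₁) (x₁ : 𝒵₁ → ξ₁)
    {T : ξ₁ × ξ₂ → α → ℝ} (hT : ∀ a, T a ∈ stdSimplex ℝ α) (a₂ : ξ₂) :
    averageKernel P₁ x₁ T a₂ ∈ stdSimplex ℝ α := by
  refine ⟨fun a => Finset.sum_nonneg fun z _ => mul_nonneg (hP₁.1 z) ((hT _).1 a), ?_⟩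
  unfold averageKernel
  rw [Finset.sum_comm]
  simp only [← Finset.mul_sum, (hT _).2, mul_one, hP₁.2]

lemma sideInfoKernel_mem_stdSimplex [Fintype β₂] {P₂ : 𝒵₂ → ℝ} (hP₂ : P₂ ∈ stdSimplex ℝ 𝒵₂)
    (x₂ : 𝒵₂ → ξ₂) (y₂ : 𝒵₂ → β₂) {T : ξ₁ × ξ₂ → α → ℝ} (hT : ∀ a, T a ∈ stdSimplex ℝ α)
    (a₁ : ξ₁) : sideInfoKernel P₂ x₂ y₂ T a₁ ∈ stdSimplex ℝ (α × β₂) := by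
  refine ⟨fun a => law_nonneg (fun z => mul_nonneg (hP₂.1 z) ((hT _).1 _)) _ _, ?_⟩
  unfold sideInfoKernel
  rw [Fintype.sum_prod_type]
  simp only [sum_law]
  rw [Finset.sum_comm]
  simp only [← Finset.mul_sum, (hT _).2, mul_one, hP₂.2]

lemma law_kernelJoint_mul_snd (P₁ : 𝒵₁ → ℝ) (P₂ : 𝒵₂ → ℝ) (x₁ : 𝒵₁ → ξ₁) (x₂ : 𝒵₂ → ξ₂)
    (T : ξ₁ × ξ₂ → α → ℝ) :
    law (kernelJoint (fun z : 𝒵₁ × 𝒵₂ => P₁ z.1 * P₂ z.2) (fun z => (x₁ z.1, x₂ z.2)) T)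
      (fun ω => (ω.1, ω.2.2)) = kernelJoint P₂ x₂ (averageKernel P₁ x₁ T) := by
  classical
  funext ⟨a, z₂⟩
  rw [law_kernelJoint_pair _ _ T (fun z : 𝒵₁ × 𝒵₂ => z.2), law_apply, Fintype.sum_prod_type]
  simp only [Finset.sum_ite_eq', Finset.mem_univ, if_true, kernelJoint, averageKernel,
    Finset.mul_sum]
  exact Finset.sum_congr rfl fun z _ => by ring

lemma law_kernelJoint_mul_fst (P₁ : 𝒵₁ → ℝ) (P₂ : 𝒵₂ → ℝ) (x₁ : 𝒵₁ → ξ₁) (x₂ : 𝒵₂ → ξ₂)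
    (y₂ : 𝒵₂ → β₂) (T : ξ₁ × ξ₂ → α → ℝ) :
    law (kernelJoint (fun z : 𝒵₁ × 𝒵₂ => P₁ z.1 * P₂ z.2) (fun z => (x₁ z.1, x₂ z.2)) T)
      (fun ω => ((ω.1, y₂ ω.2.2), ω.2.1)) = kernelJoint P₁ x₁ (sideInfoKernel P₂ x₂ y₂ T) := by
  classical
  funext ⟨⟨a, b⟩, z₁⟩
  rw [law_congr_of_iff (g := fun ω => (ω.1, ω.2.1, y₂ ω.2.2)) (b := (a, z₁, b)) _
      (by simp only [Prod.mk.injEq]; tauto),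
    law_kernelJoint_pair _ _ T (fun z : 𝒵₁ × 𝒵₂ => (z.1, y₂ z.2)), law_apply,
    Fintype.sum_prod_type]
  simp only [Prod.mk.injEq, ite_and, Finset.sum_ite_irrel, Finset.sum_const_zero,
    Finset.sum_ite_eq', Finset.mem_univ, if_true, kernelJoint, sideInfoKernel, law_apply,
    Finset.mul_sum, mul_ite, mul_zero, mul_assoc]

lemma law_kernelJoint_mul_pair {P₁ : 𝒵₁ → ℝ} (hP₁ : ∑ z, P₁ z = 1) {P₂ : 𝒵₂ → ℝ}
    (hP₂ : ∑ z, P₂ z = 1) (x₁ : 𝒵₁ → ξ₁) (x₂ : 𝒵₂ → ξ₂) (y₁ : 𝒵₁ → β₁) (y₂ : 𝒵₂ → β₂)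
    {T : ξ₁ × ξ₂ → α → ℝ} (hT : ∀ a, ∑ u, T a u = 1) (b₁ : β₁) (b₂ : β₂) :
    let p := kernelJoint (fun z : 𝒵₁ × 𝒵₂ => P₁ z.1 * P₂ z.2) (fun z => (x₁ z.1, x₂ z.2)) T
    law p (fun ω => (y₁ ω.2.1, y₂ ω.2.2)) (b₁, b₂) =
      law p (fun ω => y₁ ω.2.1) b₁ * law p (fun ω => y₂ ω.2.2) b₂ := by
  intro p
  rw [law_kernelJoint_snd _ _ hT (fun z : 𝒵₁ × 𝒵₂ => (y₁ z.1, y₂ z.2)),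
    law_kernelJoint_snd _ _ hT (fun z : 𝒵₁ × 𝒵₂ => y₁ z.1),
    law_kernelJoint_snd _ _ hT (fun z : 𝒵₁ × 𝒵₂ => y₂ z.2),
    law_mul_pair, law_mul_fst _ hP₂, law_mul_snd hP₁]

lemma isMarkovChain_mul {P₁ : 𝒵₁ → ℝ} (hP₁ : ∑ z, P₁ z = 1) (P₂ : 𝒵₂ → ℝ) (x₁ : 𝒵₁ → ξ₁)
    (x₂ : 𝒵₂ → ξ₂) (y₂ : 𝒵₂ → β₂) :
    IsMarkovChain (fun z : 𝒵₁ × 𝒵₂ => P₁ z.1 * P₂ z.2) (fun z => (x₁ z.1, x₂ z.2))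
      (fun z => x₂ z.2) (fun z => y₂ z.2) := by
  rintro ⟨a₁, a₂⟩ b c
  rw [law_congr_of_iff (g := fun z : 𝒵₁ × 𝒵₂ => (x₁ z.1, x₂ z.2, x₂ z.2, y₂ z.2))
      (b := (a₁, a₂, b, c)) _ fun z => by simp only [Prod.mk.injEq, and_assoc],
    law_congr_of_iff (f := fun z : 𝒵₁ × 𝒵₂ => ((x₁ z.1, x₂ z.2), x₂ z.2))
      (g := fun z : 𝒵₁ × 𝒵₂ => (x₁ z.1, x₂ z.2, x₂ z.2))
      (b := (a₁, a₂, b)) _ fun z => by simp only [Prod.mk.injEq, and_assoc],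
    law_mul_pair P₁ P₂ x₁ (fun z => (x₂ z, x₂ z, y₂ z)),
    law_mul_pair P₁ P₂ x₁ (fun z => (x₂ z, x₂ z)), law_mul_snd hP₁ P₂ x₂,
    law_mul_snd hP₁ P₂ (fun z => (x₂ z, y₂ z)), mul_assoc, mul_assoc,
    isMarkovChain_self P₂ x₂ y₂ a₂ b c]

variable [Fintype β₁] [Fintype β₂]

lemma kernelInfo_mul_eq {P₁ : 𝒵₁ → ℝ} (hP₁ : P₁ ∈ stdSimplex ℝ 𝒵₁) {P₂ : 𝒵₂ → ℝ}
    (hP₂ : P₂ ∈ stdSimplex ℝ 𝒵₂) (x₁ : 𝒵₁ → ξ₁) (x₂ : 𝒵₂ → ξ₂) (y₁ : 𝒵₁ → β₁) (y₂ : 𝒵₂ → β₂)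
    {T : ξ₁ × ξ₂ → α → ℝ} (hT : ∀ a, T a ∈ stdSimplex ℝ α) :
    kernelInfo (fun z : 𝒵₁ × 𝒵₂ => P₁ z.1 * P₂ z.2) (fun z => (x₁ z.1, x₂ z.2)) T
        (fun z => (y₁ z.1, y₂ z.2)) =
      kernelInfo P₂ x₂ (averageKernel P₁ x₁ T) y₂ +
        kernelInfo P₁ x₁ (sideInfoKernel P₂ x₂ y₂ T) y₁ := by
  have hp := kernelJoint_mem_stdSimplex (mul_mem_stdSimplex hP₁ hP₂)
    (fun z => (x₁ z.1, x₂ z.2)) hT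
  simp only [kernelInfo, ← law_kernelJoint_mul_snd, ← law_kernelJoint_mul_fst, mutualInfo_law]
  exact mutualInfo_pair_of_indep hp.1 _
    (law_kernelJoint_mul_pair hP₁.2 hP₂.2 x₁ x₂ y₁ y₂ fun a => (hT a).2)

lemma kernelInfo_add_kernelInfo_le_mul [Fintype ξ₁] [Fintype ξ₂] {P₁ : 𝒵₁ → ℝ}
    (hP₁ : P₁ ∈ stdSimplex ℝ 𝒵₁) {P₂ : 𝒵₂ → ℝ} (hP₂ : P₂ ∈ stdSimplex ℝ 𝒵₂) (x₁ : 𝒵₁ → ξ₁)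
    (x₂ : 𝒵₂ → ξ₂) (y₂ : 𝒵₂ → β₂) {T : ξ₁ × ξ₂ → α → ℝ} (hT : ∀ a, T a ∈ stdSimplex ℝ α) :
    kernelInfo P₂ x₂ (averageKernel P₁ x₁ T) x₂ +
        kernelInfo P₁ x₁ (sideInfoKernel P₂ x₂ y₂ T) x₁ ≤
      kernelInfo (fun z : 𝒵₁ × 𝒵₂ => P₁ z.1 * P₂ z.2) (fun z => (x₁ z.1, x₂ z.2)) T
        (fun z => (x₁ z.1, x₂ z.2)) := by
  have hp := kernelJoint_mem_stdSimplex (mul_mem_stdSimplex hP₁ hP₂)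
    (fun z => (x₁ z.1, x₂ z.2)) hT
  simp only [kernelInfo, ← law_kernelJoint_mul_snd, ← law_kernelJoint_mul_fst, mutualInfo_law]
  exact mutualInfo_add_mutualInfo_le_of_indep hp
    (law_kernelJoint_mul_pair hP₁.2 hP₂.2 x₁ x₂ x₁ x₂ fun a => (hT a).2)
    (((isMarkovChain_mul hP₁.2 P₂ x₁ x₂ y₂).kernelJoint fun a => (hT a).2).comp_left
      fun ua => (ua.1, ua.2.1))

end TwoSources

section SingleLetter

variable {𝒵 ξ α β : Type*} [Fintype 𝒵] [Fintype α] [Fintype β]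

lemma comp_consEquiv {𝒵 κ : Type*} (f : 𝒵 → κ) {n : ℕ} (z : 𝒵 × (Fin n → 𝒵)) :
    (fun i => f (Fin.consEquiv (fun _ => 𝒵) z i)) =
      (Fin.cons (f z.1) (fun i => f (z.2 i)) : Fin (n + 1) → κ) :=
  funext fun i => by cases i using Fin.cases <;> simp [Fin.consEquiv]

lemma kernelInfo_prodMass_succ (P : 𝒵 → ℝ) (x : 𝒵 → ξ) {n : ℕ} (T : (Fin (n + 1) → ξ) → α → ℝ)
    (f : 𝒵 → β) :
    kernelInfo (fun z : 𝒵 × (Fin n → 𝒵) => P z.1 * prodMass P (Fin n) z.2)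
      (fun z => (x z.1, fun i => x (z.2 i))) (fun a => T (Fin.cons a.1 a.2))
      (fun z => (f z.1, fun i => f (z.2 i))) =
    kernelInfo (prodMass P (Fin (n + 1))) (fun z i => x (z i)) T (fun z i => f (z i)) := by
  refine kernelInfo_equiv (Fin.consEquiv (fun _ => 𝒵)) (fun z => ?_) (fun z u => ?_) fun z z' => ?_
  · simp [prodMass, Fin.prod_univ_succ, Fin.consEquiv]
  · rw [comp_consEquiv]
  · rw [comp_consEquiv, comp_consEquiv, Fin.cons_inj, Prod.mk.injEq]

/- Induction on the blocklength: the chain rule splits off one letter, and the two resulting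
channels are combined by time sharing. -/
lemma exists_single_letter_kernel [Fintype ξ] {P : 𝒵 → ℝ} (hP : P ∈ stdSimplex ℝ 𝒵) (x : 𝒵 → ξ)
    (y : 𝒵 → β) (n : ℕ) (T : (Fin n → ξ) → α → ℝ) (hT : ∀ a, T a ∈ stdSimplex ℝ α) :
    ∃ (k : ℕ) (V : ξ → Fin k → ℝ), (∀ a, V a ∈ stdSimplex ℝ (Fin k)) ∧
      n * kernelInfo P x V y =
        kernelInfo (prodMass P (Fin n)) (fun z i => x (z i)) T (fun z i => y (z i)) ∧
      n * kernelInfo P x V x ≤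
        kernelInfo (prodMass P (Fin n)) (fun z i => x (z i)) T (fun z i => x (z i)) := by
  induction n with
  | zero =>
    have hp := kernelJoint_mem_stdSimplex (prodMass_mem_stdSimplex hP (Fin 0))
      (fun z i => x (z i)) hT
    refine ⟨1, fun _ _ => 1, fun a => ⟨by simp, by simp⟩, ?_, ?_⟩
    · simp [kernelInfo, mutualInfo_of_subsingleton hp.2]
    · simp [kernelInfo, mutualInfo_of_subsingleton hp.2]
  | succ n ih =>
    let T' : ξ × (Fin n → ξ) → α → ℝ := fun a => T (Fin.cons a.1 a.2)
    have hT' (a) : T' a ∈ stdSimplex ℝ α := hT _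
    have hPn := prodMass_mem_stdSimplex hP (Fin n)
    obtain ⟨k, V, hV, hVy, hVx⟩ := ih _ (averageKernel_mem_stdSimplex hP x hT')
    set V' := sideInfoKernel (prodMass P (Fin n)) (fun z i => x (z i)) (fun z i => y (z i)) T'
    have hV' := sideInfoKernel_mem_stdSimplex hPn (fun z i => x (z i)) (fun z i => y (z i)) hT'
    have hmix := mixKernel_mem_stdSimplex (t := (n : ℝ) / (n + 1 : ℕ)) (by positivity)
      (div_le_one_of_le₀ (by simp) (by positivity)) hV hV'
    let e := (Fintype.equivFin (Fin k ⊕ (α × (Fin n → β)))).symm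
    refine ⟨_, fun a u => mixKernel (n / (n + 1 : ℕ)) V V' a (e u), fun a =>
      ⟨fun u => (hmix a).1 _, (e.sum_comp _).trans (hmix a).2⟩, ?_, ?_⟩
    · rw [kernelInfo_reindex P x (fun a => (hmix a).2),
        natCast_succ_mul_kernelInfo_mixKernel P x n hV hV', hVy, ← kernelInfo_prodMass_succ]
      exact (kernelInfo_mul_eq hP hPn x _ y _ hT').symm
    · rw [kernelInfo_reindex P x (fun a => (hmix a).2),
        natCast_succ_mul_kernelInfo_mixKernel P x n hV hV', ← kernelInfo_prodMass_succ]
      exact (add_le_add_left hVx _).trans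
        (kernelInfo_add_kernelInfo_le_mul hP hPn x _ (fun z i => y (z i)) hT')

end SingleLetter

section Continuity

variable {Ω Θ α β : Type*} [Fintype Ω] [TopologicalSpace Θ] {q : Θ → Ω → ℝ}

lemma continuous_law (hq : ∀ ω, Continuous fun θ => q θ ω) (f : Ω → α) (a : α) :
    Continuous fun θ => law (q θ) f a := by
  classical
  simp only [law_apply]
  refine continuous_finsetSum _ fun ω _ => ?_
  split_ifs
  · exact hq ω
  · exact continuous_const

lemma continuous_entropy [Fintype α] (hq : ∀ ω, Continuous fun θ => q θ ω) (f : Ω → α) :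
    Continuous fun θ => entropy (q θ) f :=
  continuous_finsetSum _ fun a _ => Real.continuous_negMulLog.comp (continuous_law hq f a)

lemma continuous_mutualInfo [Fintype α] [Fintype β] (hq : ∀ ω, Continuous fun θ => q θ ω)
    (f : Ω → α) (g : Ω → β) : Continuous fun θ => mutualInfo (q θ) f g :=
  ((continuous_entropy hq f).add (continuous_entropy hq g)).sub (continuous_entropy hq _)

end Continuity

section Regions

variable {𝒳 𝒳t 𝒴 : Type*} [Fintype 𝒳] [Fintype 𝒳t] [Fintype 𝒴]

lemma infoUXt_eq (P : 𝒳 × 𝒳t × 𝒴 → ℝ) {k : ℕ} (V : 𝒳t → Fin k → ℝ) :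
    infoUXt P V = kernelInfo P (fun z => z.2.1) V (fun z => z.2.1) := rfl

lemma infoUY_eq (P : 𝒳 × 𝒳t × 𝒴 → ℝ) {k : ℕ} (V : 𝒳t → Fin k → ℝ) :
    infoUY P V = kernelInfo P (fun z => z.2.1) V (fun z => z.2.2) := rfl

lemma auxJoint_mem_stdSimplex {P : 𝒳 × 𝒳t × 𝒴 → ℝ} (hP : P ∈ stdSimplex ℝ (𝒳 × 𝒳t × 𝒴)) {k : ℕ}
    {V : 𝒳t → Fin k → ℝ} (hV : ∀ x, V x ∈ stdSimplex ℝ (Fin k)) :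
    auxJoint P V ∈ stdSimplex ℝ (Fin k × 𝒳 × 𝒳t × 𝒴) :=
  kernelJoint_mem_stdSimplex hP (fun z => z.2.1) hV

lemma infoUX_le_infoUY {P : 𝒳 × 𝒳t × 𝒴 → ℝ} (hP : P ∈ stdSimplex ℝ (𝒳 × 𝒳t × 𝒴))
    (hM : IsMarkovChain P (fun ω => ω.2.1) (fun ω => ω.2.2) (fun ω => ω.1)) {k : ℕ}
    {V : 𝒳t → Fin k → ℝ} (hV : ∀ x, V x ∈ stdSimplex ℝ (Fin k)) :
    infoUX P V ≤ infoUY P V :=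
  ((hM.kernelJoint fun a => (hV a).2).comp_left Prod.fst).mutualInfo_le
    (auxJoint_mem_stdSimplex hP hV)

/-- The tuples with `0 ≤ R_s ≤ I(U; Y)`, `R_ℓ ≥ 0` and `R_w ≥ I(U; X̃) - c I(U; Y)` for a test
channel with `k` letters; `c = 1` gives the generated-secret and `c = 0` the chosen-secret model. -/
def testRegion (P : 𝒳 × 𝒳t × 𝒴 → ℝ) (c : ℝ) (k : ℕ) : Set (ℝ × ℝ × ℝ) :=
  {R | ∃ V : 𝒳t → Fin k → ℝ, (∀ x, V x ∈ stdSimplex ℝ (Fin k)) ∧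
    0 ≤ R.1 ∧ R.1 ≤ infoUY P V ∧ 0 ≤ R.2.1 ∧ infoUXt P V - c * infoUY P V ≤ R.2.2}

lemma regionR2Card_eq_testRegion {P : 𝒳 × 𝒳t × 𝒴 → ℝ} (hP : P ∈ stdSimplex ℝ (𝒳 × 𝒳t × 𝒴))
    (hM : IsMarkovChain P (fun ω => ω.2.1) (fun ω => ω.2.2) (fun ω => ω.1)) (k : ℕ) :
    regionR2Card P k = testRegion P 1 k := by
  ext R
  refine exists_congr fun V => and_congr_right fun hV => ?_
  simp [max_eq_left (sub_nonpos.2 (infoUX_le_infoUY hP hM hV))]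

lemma regionR4Card_eq_testRegion {P : 𝒳 × 𝒳t × 𝒴 → ℝ} (hP : P ∈ stdSimplex ℝ (𝒳 × 𝒳t × 𝒴))
    (hM : IsMarkovChain P (fun ω => ω.2.1) (fun ω => ω.2.2) (fun ω => ω.1)) (k : ℕ) :
    regionR4Card P k = testRegion P 0 k := by
  ext R
  refine exists_congr fun V => and_congr_right fun hV => ?_
  simp [max_eq_left (sub_nonpos.2 (infoUX_le_infoUY hP hM hV))]

lemma monotone_testRegion (P : 𝒳 × 𝒳t × 𝒴 → ℝ) (c : ℝ) : Monotone (testRegion P c) := by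
  refine monotone_nat_of_le_succ fun k => ?_
  rintro R ⟨V, hV, hR⟩
  refine ⟨fun a => Fin.cons 0 (V a), fun a => cons_zero_mem_stdSimplex (hV a), ?_⟩
  rwa [infoUXt_eq, infoUY_eq, kernelInfo_cons_zero _ _ hV, kernelInfo_cons_zero _ _ hV]

lemma testRegion_succ_subset (P : 𝒳 × 𝒳t × 𝒴 → ℝ) (c : ℝ) {k : ℕ}
    (hk : Fintype.card 𝒳t + 1 ≤ k) : testRegion P c (k + 1) ⊆ testRegion P c k := by
  rintro R ⟨V, hV, hkey0, hkey, hleak, hstore⟩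
  obtain ⟨V', hV', hY, hXt⟩ := exists_kernel_pred hk hV P (fun z => z.2.1) (fun z => z.2.2)
    (fun z => z.2.1)
  rw [← infoUY_eq, ← infoUY_eq] at hY
  rw [← infoUXt_eq, ← infoUXt_eq] at hXt
  exact ⟨V', hV', hkey0, by rwa [hY], hleak, by rw [hY]; linarith⟩

lemma testRegion_subset_card_add_one (P : 𝒳 × 𝒳t × 𝒴 → ℝ) (c : ℝ) (k : ℕ) :
    testRegion P c k ⊆ testRegion P c (Fintype.card 𝒳t + 1) := by
  rcases le_total k (Fintype.card 𝒳t + 1) with h | h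
  · exact monotone_testRegion P c h
  · induction k, h using Nat.le_induction with
    | base => exact le_rfl
    | succ k hk ih => exact (testRegion_succ_subset P c hk).trans ih

/- The region is the projection of a closed set along the compact space of test channels. -/
lemma isClosed_testRegion (P : 𝒳 × 𝒳t × 𝒴 → ℝ) (c : ℝ) (k : ℕ) :
    IsClosed (testRegion P c k) := by
  let K : Set (𝒳t → Fin k → ℝ) := Set.univ.pi fun _ => stdSimplex ℝ (Fin k)
  have : CompactSpace K := isCompact_iff_compactSpace.1
    (isCompact_univ_pi fun _ => isCompact_stdSimplex ℝ (Fin k))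
  have hjoint (ω) : Continuous fun q : K × ℝ × ℝ × ℝ => auxJoint P q.1.1 ω :=
    continuous_const.mul ((continuous_apply_apply ω.2.2.1 ω.1).comp
      (continuous_subtype_val.comp continuous_fst))
  have hY : Continuous fun q : K × ℝ × ℝ × ℝ => infoUY P q.1.1 := continuous_mutualInfo hjoint _ _
  have hXt : Continuous fun q : K × ℝ × ℝ × ℝ => infoUXt P q.1.1 := continuous_mutualInfo hjoint _ _
  let C : Set (K × ℝ × ℝ × ℝ) := {q | 0 ≤ q.2.1 ∧ q.2.1 ≤ infoUY P q.1.1 ∧ 0 ≤ q.2.2.1 ∧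
    infoUXt P q.1.1 - c * infoUY P q.1.1 ≤ q.2.2.2}
  have hC : IsClosed C := by
    have hkey : Continuous fun q : K × ℝ × ℝ × ℝ => q.2.1 := by fun_prop
    have hleak : Continuous fun q : K × ℝ × ℝ × ℝ => q.2.2.1 := by fun_prop
    have hstore : Continuous fun q : K × ℝ × ℝ × ℝ => q.2.2.2 := by fun_prop
    exact (isClosed_le continuous_const hkey).inter ((isClosed_le hkey hY).inter
      ((isClosed_le continuous_const hleak).inter
        (isClosed_le (hXt.sub (continuous_const.mul hY)) hstore)))
  have hproj : testRegion P c k = Prod.snd '' C := by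
    ext R
    constructor
    · rintro ⟨V, hV, h⟩
      exact ⟨(⟨V, fun x _ => hV x⟩, R), h, rfl⟩
    · rintro ⟨⟨V, R'⟩, h, rfl⟩
      exact ⟨V.1, fun x => V.2 x (Set.mem_univ x), h⟩
  rw [hproj]
  exact isClosedMap_snd_of_compactSpace C hC

end Regions

/-- The loss in the converse bounds at tolerance `δ` and key rate `r`. -/
noncomputable def converseLoss (r δ : ℝ) : ℝ := 2 * δ + Real.binEntropy δ + δ * r

lemma continuous_converseLoss (r : ℝ) : Continuous (converseLoss r) := by
  have := Real.binEntropy_continuous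
  unfold converseLoss
  fun_prop

lemma converseLoss_zero (r : ℝ) : converseLoss r 0 = 0 := by simp [converseLoss]

section ConstraintBounds

variable {Ω 𝒳 γ : Type*} [Fintype Ω] [Fintype 𝒳] [Fintype γ] {p : Ω → ℝ} {n s w : ℕ}
  {S Shat : Ω → Fin s} {W : Ω → Fin w} {Xn : Ω → Fin n → 𝒳} {Y : Ω → γ} {dec : Fin w × γ → Fin s}
  {R : ℝ × ℝ × ℝ} {δ : ℝ}

lemma MeetsConstraints.key_rate_nonneg (H : MeetsConstraints p S Shat W Xn R δ) : 0 ≤ R.1 :=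
  H.key_rate ▸ div_nonneg (Real.log_natCast_nonneg s) n.cast_nonneg

lemma MeetsConstraints.entropy_key_sub_le (hp : p ∈ stdSimplex ℝ Ω) (hn : 1 ≤ n) (hδ : 0 ≤ δ)
    (hδ' : δ ≤ 1 / 2) (H : MeetsConstraints p S (fun ω => dec (W ω, Y ω)) W Xn R δ) :
    entropy p (fun ω => (S ω, W ω, Y ω)) - entropy p (fun ω => (W ω, Y ω)) ≤
      n * (Real.binEntropy δ + δ * R.1) := by
  have hn' : (1 : ℝ) ≤ n := by exact_mod_cast hn
  have hlog : Real.log s = n * R.1 := by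
    rw [H.key_rate]
    field_simp
  have hR0 := H.key_rate_nonneg
  set e := prob p fun ω => S ω ≠ dec (W ω, Y ω)
  have he : e ≤ δ := H.reliability
  have hfano := fano_inequality hp S (fun ω => (W ω, Y ω)) dec
  rw [Fintype.card_fin, hlog] at hfano
  have hentropy : Real.binEntropy e ≤ Real.binEntropy δ :=
    Real.binEntropy_strictMonoOn.monotoneOn ⟨prob_nonneg hp.1 _, by norm_num; linarith⟩
      ⟨hδ, by norm_num; linarith⟩ he
  calc entropy p (fun ω => (S ω, W ω, Y ω)) - entropy p (fun ω => (W ω, Y ω))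
      ≤ Real.binEntropy e + e * (n * R.1) := hfano
    _ ≤ Real.binEntropy δ + δ * (n * R.1) := by gcongr
    _ ≤ n * Real.binEntropy δ + δ * (n * R.1) := by
        gcongr
        exact le_mul_of_one_le_left (Real.binEntropy_nonneg hδ (by linarith)) hn'
    _ = n * (Real.binEntropy δ + δ * R.1) := by ring

lemma MeetsConstraints.mul_key_rate_le (hp : p ∈ stdSimplex ℝ Ω) (hn : 1 ≤ n) (hδ : 0 ≤ δ)
    (hδ' : δ ≤ 1 / 2) (H : MeetsConstraints p S (fun ω => dec (W ω, Y ω)) W Xn R δ) :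
    n * R.1 ≤ mutualInfo p (fun ω => (S ω, W ω)) Y + n * converseLoss R.1 δ := by
  have hn' : (1 : ℝ) ≤ n := by exact_mod_cast hn
  have hfano := H.entropy_key_sub_le hp hn hδ hδ'
  have huniform := H.uniformity
  rw [ge_iff_le, one_div, ← div_eq_inv_mul, le_div_iff₀ (by linarith)] at huniform
  have hsecrecy := H.secrecy
  have hWY := mutualInfo_nonneg hp W Y
  have hassoc : entropy p (fun ω => ((S ω, W ω), Y ω)) = entropy p (fun ω => (S ω, W ω, Y ω)) :=
    entropy_congr p fun _ _ => by simp only [Prod.mk.injEq, and_assoc]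
  unfold mutualInfo converseLoss at *
  nlinarith

lemma MeetsConstraints.entropy_helper_le (hp : p ∈ stdSimplex ℝ Ω) (hn : 1 ≤ n)
    (H : MeetsConstraints p S Shat W Xn R δ) : entropy p W ≤ n * (R.2.2 + δ) := by
  have hn0 : (0 : ℝ) < n := by exact_mod_cast hn
  have hΩ : Nonempty Ω := by
    by_contra hempty
    rw [not_nonempty_iff] at hempty
    simpa using hp.2
  have hw : Nonempty (Fin w) := hΩ.map W
  have hstorage := H.storage
  rw [one_div, ← div_eq_inv_mul, div_le_iff₀' hn0] at hstorage
  simpa using (entropy_le_log_card hp W).trans (by simpa using hstorage)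

end ConstraintBounds

lemma kernelInfo_eq_mutualInfo_of_law_eq {Ω 𝒵 𝒰 ξ β : Type*} [Fintype Ω] [Fintype 𝒵] [Fintype 𝒰]
    [Fintype β] {p : Ω → ℝ} {u : Ω → 𝒰} {Z : Ω → 𝒵} {Q : 𝒵 → ℝ} {x : 𝒵 → ξ} {T : ξ → 𝒰 → ℝ}
    (h : law p (fun ω => (u ω, Z ω)) = kernelJoint Q x T) (f : 𝒵 → β) :
    kernelInfo Q x T f = mutualInfo p u (fun ω => f (Z ω)) := by
  rw [kernelInfo, ← h, mutualInfo_law]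

section Converse

variable {𝒳 𝒳t 𝒴 : Type*} [Fintype 𝒳] [Fintype 𝒳t] [Fintype 𝒴]

lemma iid_mem_stdSimplex {P : 𝒳 × 𝒳t × 𝒴 → ℝ} (hP : P ∈ stdSimplex ℝ (𝒳 × 𝒳t × 𝒴)) (n : ℕ) :
    iid P n ∈ stdSimplex ℝ (Fin n → 𝒳 × 𝒳t × 𝒴) :=
  prodMass_mem_stdSimplex hP (Fin n)

/- Both models are covered: `(S, W)` is the output of a channel from `X̃ⁿ`, and `hstore` is all that
the storage bound needs to know about the encoder. -/
lemma MeetsConstraints.mem_testRegion {P : 𝒳 × 𝒳t × 𝒴 → ℝ}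
    (hP : P ∈ stdSimplex ℝ (𝒳 × 𝒳t × 𝒴)) {Ω : Type*} [Fintype Ω] {p : Ω → ℝ}
    (hp : p ∈ stdSimplex ℝ Ω) {n s w : ℕ} (hn : 1 ≤ n) {S : Ω → Fin s} {W : Ω → Fin w}
    {Z : Ω → Fin n → 𝒳 × 𝒳t × 𝒴} {T : (Fin n → 𝒳t) → Fin s × Fin w → ℝ}
    (hT : ∀ a, T a ∈ stdSimplex ℝ (Fin s × Fin w))
    (hlaw : law p (fun ω => ((S ω, W ω), Z ω)) = kernelJoint (iid P n) seqXt T)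
    {dec : Fin w × (Fin n → 𝒴) → Fin s} {R : ℝ × ℝ × ℝ} {δ : ℝ} (hδ : 0 ≤ δ) (hδ' : δ ≤ 1 / 2)
    (H : MeetsConstraints p S (fun ω => dec (W ω, seqY (Z ω))) W (fun ω => seqX (Z ω)) R δ)
    {c : ℝ} (hc0 : 0 ≤ c) (hc1 : c ≤ 1)
    (hstore : mutualInfo p (fun ω => (S ω, W ω)) (fun ω => seqXt (Z ω)) -
        c * mutualInfo p (fun ω => (S ω, W ω)) (fun ω => seqY (Z ω)) ≤
      entropy p W + c * (entropy p (fun ω => (S ω, W ω, seqY (Z ω))) -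
        entropy p (fun ω => (W ω, seqY (Z ω))))) :
    (max 0 (R.1 - converseLoss R.1 δ), R.2.1 + δ, R.2.2 + converseLoss R.1 δ) ∈
      testRegion P c (Fintype.card 𝒳t + 1) := by
  obtain ⟨k, V, hV, hVY, hVXt⟩ := exists_single_letter_kernel hP (fun z => z.2.1)
    (fun z => z.2.2) n T hT
  have hIY : n * infoUY P V = mutualInfo p (fun ω => (S ω, W ω)) (fun ω => seqY (Z ω)) :=
    hVY.trans (kernelInfo_eq_mutualInfo_of_law_eq hlaw seqY)
  have hIXt : n * infoUXt P V ≤ mutualInfo p (fun ω => (S ω, W ω)) (fun ω => seqXt (Z ω)) :=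
    hVXt.trans_eq (kernelInfo_eq_mutualInfo_of_law_eq hlaw seqXt)
  have hn0 : (0 : ℝ) < n := by exact_mod_cast hn
  have hloss : 0 ≤ Real.binEntropy δ + δ * R.1 :=
    add_nonneg (Real.binEntropy_nonneg hδ (by linarith)) (mul_nonneg hδ H.key_rate_nonneg)
  have hkey : R.1 ≤ infoUY P V + converseLoss R.1 δ := by
    refine le_of_mul_le_mul_left ?_ hn0
    rw [mul_add, hIY]
    exact H.mul_key_rate_le (Y := fun ω => seqY (Z ω)) hp hn hδ hδ'
  have hstorage : infoUXt P V - c * infoUY P V ≤ R.2.2 + converseLoss R.1 δ := by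
    refine le_of_mul_le_mul_left ?_ hn0
    calc n * (infoUXt P V - c * infoUY P V) = n * infoUXt P V - c * (n * infoUY P V) := by ring
      _ ≤ n * (R.2.2 + δ) + c * (n * (Real.binEntropy δ + δ * R.1)) := by
          rw [hIY]
          refine (sub_le_sub_right hIXt _).trans (hstore.trans (add_le_add
            (H.entropy_helper_le hp hn) (mul_le_mul_of_nonneg_left ?_ hc0)))
          exact H.entropy_key_sub_le (Y := fun ω => seqY (Z ω)) hp hn hδ hδ'
      _ ≤ n * (R.2.2 + δ) + n * (Real.binEntropy δ + δ * R.1) := by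
          exact add_le_add_right (mul_le_of_le_one_left (mul_nonneg hn0.le hloss) hc1) _
      _ ≤ n * (R.2.2 + converseLoss R.1 δ) := by
          rw [← mul_add, converseLoss]
          exact mul_le_mul_of_nonneg_left (by linarith) hn0.le
  have hleak : 0 ≤ R.2.1 + δ :=
    (mul_nonneg (by positivity) (mutualInfo_nonneg hp _ W)).trans H.privacy
  exact testRegion_subset_card_add_one P c k ⟨V, hV, le_max_left _ _,
    max_le (mutualInfo_nonneg (auxJoint_mem_stdSimplex hP hV) _ _) (by linarith), hleak, hstorage⟩

lemma mem_testRegion_of_forall_loss {P : 𝒳 × 𝒳t × 𝒴 → ℝ} {c : ℝ} {k : ℕ} {R : ℝ × ℝ × ℝ}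
    (hR : 0 ≤ R.1) (h : ∀ δ : ℝ, 0 < δ → δ ≤ 1 / 2 →
      (max 0 (R.1 - converseLoss R.1 δ), R.2.1 + δ, R.2.2 + converseLoss R.1 δ) ∈
        testRegion P c k) : R ∈ testRegion P c k := by
  have := continuous_converseLoss R.1
  have hcont : Continuous fun δ : ℝ =>
      (max 0 (R.1 - converseLoss R.1 δ), R.2.1 + δ, R.2.2 + converseLoss R.1 δ) := by
    fun_prop
  have hlim := (hcont.tendsto 0).mono_left (nhdsWithin_le_nhds (s := Set.Ioi 0))
  simp only [converseLoss_zero, sub_zero, add_zero, max_eq_right hR] at hlim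
  refine (isClosed_testRegion P c k).mem_of_tendsto hlim ?_
  filter_upwards [Ioc_mem_nhdsGT (show (0 : ℝ) < 1 / 2 by norm_num)] with δ hδ
    using h δ hδ.1 hδ.2

lemma GSFeasible.mem_testRegion {P : 𝒳 × 𝒳t × 𝒴 → ℝ} (hP : P ∈ stdSimplex ℝ (𝒳 × 𝒳t × 𝒴))
    {n s w : ℕ} (hn : 1 ≤ n) {enc : (Fin n → 𝒳t) → Fin w × Fin s}
    {dec : Fin w × (Fin n → 𝒴) → Fin s} {R : ℝ × ℝ × ℝ} {δ : ℝ} (hδ : 0 ≤ δ) (hδ' : δ ≤ 1 / 2)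
    (H : GSFeasible P enc dec R δ) :
    (max 0 (R.1 - converseLoss R.1 δ), R.2.1 + δ, R.2.2 + converseLoss R.1 δ) ∈
      testRegion P 1 (Fintype.card 𝒳t + 1) := by
  classical
  have hp := iid_mem_stdSimplex hP n
  refine MeetsConstraints.mem_testRegion (Z := fun ω => ω) hP hp hn
    (T := fun a b => if ((enc a).2, (enc a).1) = b then 1 else 0) ?_ ?_ hδ hδ' H zero_le_one
    le_rfl ?_
  · exact fun a => ⟨fun b => by dsimp only; split_ifs <;> simp, by simp⟩
  · funext ⟨b, z⟩
    rw [law_apply, Finset.sum_eq_single z (by intro z' _ hz'; simp [hz']) (by simp)]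
    simp [kernelJoint]
  · have hWY := mutualInfo_nonneg hp (fun ω => (enc (seqXt ω)).1) seqY
    have hXt : entropy (iid P n) seqXt ≤ entropy (iid P n) (fun ω =>
        (((enc (seqXt ω)).2, (enc (seqXt ω)).1), seqXt ω)) :=
      entropy_mono hp.1 fun _ _ h => (Prod.mk.inj h).2
    have hassoc : entropy (iid P n) (fun ω =>
        (((enc (seqXt ω)).2, (enc (seqXt ω)).1), seqY ω)) =
      entropy (iid P n) (fun ω => ((enc (seqXt ω)).2, (enc (seqXt ω)).1, seqY ω)) :=
      entropy_congr _ fun _ _ => by simp only [Prod.mk.injEq, and_assoc]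
    unfold mutualInfo at *
    linarith

lemma CSFeasible.mem_testRegion {P : 𝒳 × 𝒳t × 𝒴 → ℝ} (hP : P ∈ stdSimplex ℝ (𝒳 × 𝒳t × 𝒴))
    {n s w : ℕ} (hn : 1 ≤ n) {PS : Fin s → ℝ} (hPS : PS ∈ stdSimplex ℝ (Fin s))
    {enc : (Fin n → 𝒳t) × Fin s → Fin w} {dec : Fin w × (Fin n → 𝒴) → Fin s} {R : ℝ × ℝ × ℝ}
    {δ : ℝ} (hδ : 0 ≤ δ) (hδ' : δ ≤ 1 / 2) (H : CSFeasible P PS enc dec R δ) :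
    (max 0 (R.1 - converseLoss R.1 δ), R.2.1 + δ, R.2.2 + converseLoss R.1 δ) ∈
      testRegion P 0 (Fintype.card 𝒳t + 1) := by
  classical
  have hiid := iid_mem_stdSimplex hP n
  have hp := mul_mem_stdSimplex hiid hPS
  refine MeetsConstraints.mem_testRegion (Z := fun ω => ω.1) hP hp hn
    (T := fun a => law PS (fun k => (k, enc (a, k)))) (fun a => law_mem_stdSimplex hPS _) ?_
    hδ hδ' H le_rfl zero_le_one ?_
  · funext ⟨b, z⟩
    rw [law_apply, Fintype.sum_prod_type,
      Finset.sum_eq_single z (by intro z' _ hz'; simp [hz']) (by simp)]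
    simp only [kernelJoint, law_apply, Finset.mul_sum, Prod.mk.injEq, and_true, mul_ite, mul_zero]
  · have hSW := mutualInfo_nonneg hp (fun ω => ω.2) (fun ω => enc (seqXt ω.1, ω.2))
    have hmono := entropy_mono hp.1 (f := fun ω => ((ω.2, enc (seqXt ω.1, ω.2)), seqXt ω.1))
      (g := fun ω => (seqXt ω.1, ω.2)) fun _ _ h => by
        simp only [Prod.mk.injEq] at h ⊢
        exact ⟨h.2, h.1.1⟩
    have hindep := entropy_mul_pair hiid hPS seqXt (fun k => k)
    have hXt : entropy (fun ω : (Fin n → 𝒳 × 𝒳t × 𝒴) × Fin s => iid P n ω.1 * PS ω.2)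
        (fun ω => seqXt ω.1) = entropy (iid P n) seqXt := by
      rw [entropy, law_mul_fst _ hPS.2, entropy]
    have hS : entropy (fun ω : (Fin n → 𝒳 × 𝒳t × 𝒴) × Fin s => iid P n ω.1 * PS ω.2)
        (fun ω => ω.2) = entropy PS (fun k => k) := by
      rw [entropy, law_mul_snd hiid.2 PS (fun k => k), entropy]
    unfold mutualInfo at *
    linarith

lemma GSAchievable.mem_testRegion {P : 𝒳 × 𝒳t × 𝒴 → ℝ} (hP : P ∈ stdSimplex ℝ (𝒳 × 𝒳t × 𝒴))
    {R : ℝ × ℝ × ℝ} (H : GSAchievable P R) : R ∈ testRegion P 1 (Fintype.card 𝒳t + 1) := by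
  obtain ⟨_, _, _, _, _, _, hcode⟩ := H 1 one_pos
  refine mem_testRegion_of_forall_loss hcode.key_rate_nonneg fun δ hδ hδ' => ?_
  obtain ⟨n, s, w, hn, enc, dec, h⟩ := H δ hδ
  exact h.mem_testRegion hP hn hδ.le hδ'

lemma CSAchievable.mem_testRegion {P : 𝒳 × 𝒳t × 𝒴 → ℝ} (hP : P ∈ stdSimplex ℝ (𝒳 × 𝒳t × 𝒴))
    {R : ℝ × ℝ × ℝ} (H : CSAchievable P R) : R ∈ testRegion P 0 (Fintype.card 𝒳t + 1) := by
  obtain ⟨_, _, _, _, _, _, _, _, hcode⟩ := H 1 one_pos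
  refine mem_testRegion_of_forall_loss hcode.key_rate_nonneg fun δ hδ hδ' => ?_
  obtain ⟨n, s, w, hn, PS, hPS, enc, dec, h⟩ := H δ hδ
  exact h.mem_testRegion hP hn hPS hδ.le hδ'

end Converse

section RandomSelection

variable {κ : Type*} [Fintype κ] {μ : κ → ℝ}

lemma exists_le_of_average_le {F : κ → ℝ} (hμ : μ ∈ stdSimplex ℝ κ) {B : ℝ}
    (h : ∑ c, μ c * F c ≤ B) : ∃ c, F c ≤ B := by
  by_contra! hlt
  obtain ⟨c, -, hc⟩ := Finset.exists_lt_of_sum_lt (s := .univ) (f := fun _ => 0) (g := μ)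
    (by simp [hμ.2])
  have : ∑ c, μ c * B < ∑ c, μ c * F c :=
    Finset.sum_lt_sum (fun c _ => mul_le_mul_of_nonneg_left (hlt c).le (hμ.1 c))
      ⟨c, Finset.mem_univ c, mul_lt_mul_of_pos_left (hlt c) hc⟩
  rw [← Finset.sum_mul, hμ.2, one_mul] at this
  exact absurd h this.not_ge

lemma exists_le_three_of_average_le {F₁ F₂ F₃ : κ → ℝ} (hμ : μ ∈ stdSimplex ℝ κ) {A B C : ℝ}
    (hA0 : 0 < A) (hB0 : 0 < B) (hC0 : 0 < C) (hF₁ : ∀ c, 0 ≤ F₁ c) (hF₂ : ∀ c, 0 ≤ F₂ c)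
    (hF₃ : ∀ c, 0 ≤ F₃ c) (hA : ∑ c, μ c * F₁ c ≤ A) (hB : ∑ c, μ c * F₂ c ≤ B)
    (hC : ∑ c, μ c * F₃ c ≤ C) : ∃ c, F₁ c ≤ 3 * A ∧ F₂ c ≤ 3 * B ∧ F₃ c ≤ 3 * C := by
  have h : ∑ c, μ c * (F₁ c / A + F₂ c / B + F₃ c / C) ≤ 3 := by
    simp only [mul_add, Finset.sum_add_distrib, ← mul_div_assoc, ← Finset.sum_div]
    linarith [(div_le_one hA0).2 hA, (div_le_one hB0).2 hB, (div_le_one hC0).2 hC]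
  obtain ⟨c, hc⟩ := exists_le_of_average_le hμ h
  have h₁ := div_nonneg (hF₁ c) hA0.le
  have h₂ := div_nonneg (hF₂ c) hB0.le
  have h₃ := div_nonneg (hF₃ c) hC0.le
  refine ⟨c, ?_, ?_, ?_⟩
  · rw [← div_le_iff₀ hA0]; linarith
  · rw [← div_le_iff₀ hB0]; linarith
  · rw [← div_le_iff₀ hC0]; linarith

lemma sum_mul_prob_comm {Ω : Type*} [Fintype Ω] (μ : κ → ℝ) (p : Ω → ℝ) (E : κ → Ω → Prop) :
    ∑ c, μ c * prob p (E c) = ∑ ω, p ω * prob μ (fun c => E c ω) := by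
  classical
  simp only [prob_eq_sum_mul, Finset.mul_sum]
  rw [Finset.sum_comm]
  exact Finset.sum_congr rfl fun ω _ => Finset.sum_congr rfl fun c _ => mul_left_comm _ _ _

variable {ι : Type*} [Fintype ι] [DecidableEq ι] {q : κ → ℝ}

lemma sum_prodMass_mul_eval (hq : ∑ u, q u = 1) (m : ι) (F : κ → ℝ) :
    ∑ c, prodMass q ι c * F (c m) = ∑ u, q u * F u := by
  have h := sum_prodMass_mul_prod q (fun i u => if i = m then F u else 1)
  simp only [Finset.prod_ite_eq', Finset.mem_univ, if_true] at h
  rw [h, Finset.prod_eq_single m]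
  · simp
  · intro i _ hi
    simp [hi, hq]
  · simp

lemma law_prodMass_eval_pair (hq : ∑ u, q u = 1) {m m' : ι} (hm : m ≠ m') (u u' : κ) :
    law (prodMass q ι) (fun c => (c m, c m')) (u, u') = q u * q u' := by
  classical
  have h := sum_prodMass_mul_prod q
    (fun i v => (if i = m then if v = u then 1 else 0 else 1) *
      (if i = m' then if v = u' then 1 else 0 else 1))
  simp only [Finset.prod_mul_distrib, Finset.prod_ite_eq', Finset.mem_univ, if_true] at h
  simp only [ite_zero_mul_ite_zero, one_mul] at h
  rw [law_eq_prob, prob_eq_sum_mul]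
  simp only [Prod.mk.injEq]
  rw [h, ← Finset.prod_subset (Finset.subset_univ {m, m'}), Finset.prod_pair hm]
  · simp [hm, hm.symm]
  · intro i _ hi
    simp only [Finset.mem_insert, Finset.mem_singleton, not_or] at hi
    simp [hi.1, hi.2, hq]

lemma prob_prodMass_collision {κ' : Type*} (hq : ∑ u, q u = 1) {h : κ → κ'} {r : ℝ}
    (hr : ∀ k, law q h k = r) {m m' : ι} (hm : m ≠ m') :
    prob (prodMass q ι) (fun c => h (c m) = h (c m')) = r := by
  classical
  rw [← prob_law (prodMass q ι) (fun c => (c m, c m')) (fun v => h v.1 = h v.2),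
    prob_eq_sum_mul, Fintype.sum_prod_type_right]
  calc ∑ u', ∑ u, law (prodMass q ι) (fun c => (c m, c m')) (u, u') * (if h u = h u' then 1 else 0)
      = ∑ u', q u' * law q h (h u') := by
        refine Finset.sum_congr rfl fun u' _ => ?_
        rw [law_eq_prob, prob_eq_sum_mul, Finset.mul_sum]
        refine Finset.sum_congr rfl fun u _ => ?_
        rw [law_prodMass_eval_pair hq hm]
        ring
    _ = r := by simp only [hr, ← Finset.sum_mul, hq, one_mul]

lemma prob_prodMass_forall (q : κ → ℝ) (E : κ → Prop) :
    prob (prodMass q ι) (fun c => ∀ m, E (c m)) = prob q E ^ Fintype.card ι := by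
  classical
  have h := sum_prodMass_mul_prod (ι := ι) q (fun _ u => if E u then 1 else 0)
  rw [Finset.prod_const, Finset.card_univ] at h
  rw [prob_eq_sum_mul, prob_eq_sum_mul, ← h]
  simp only [Finset.prod_ite_zero, Finset.prod_const_one, Finset.mem_univ, true_implies]

end RandomSelection

section Codebook

variable {Ω α β : Type*} [Fintype Ω] [Fintype α]

lemma sum_prob_fiber (p : Ω → ℝ) (f : Ω → α) (E : α → Ω → Prop) :
    ∑ a, prob p (fun ω => f ω = a ∧ E a ω) = prob p (fun ω => E (f ω) ω) := by
  classical
  simp only [prob_eq_sum_mul, ite_and]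
  rw [Finset.sum_comm]
  simp only [← Finset.mul_sum, Finset.sum_ite_eq, Finset.mem_univ, if_true]

lemma sum_law_mul_prob_div_law {p : Ω → ℝ} (hp : ∀ ω, 0 ≤ p ω) (f : Ω → α) (E : α → Ω → Prop) :
    ∑ a, law p f a * (prob p (fun ω => f ω = a ∧ E a ω) / law p f a) =
      prob p (fun ω => E (f ω) ω) := by
  rw [← sum_prob_fiber]
  refine Finset.sum_congr rfl fun a _ => mul_div_cancel_of_imp' fun h => ?_
  exact le_antisymm ((prob_mono hp fun ω hω => hω.1).trans_eq h) (prob_nonneg hp _)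

lemma sum_law_mul_prob_le [Finite β] {p : Ω → ℝ} (hp : p ∈ stdSimplex ℝ Ω) (f : Ω → α) (g : Ω → β)
    {G : α → β → Prop} {b : ℝ} (hb : 0 ≤ b)
    (hG : ∀ a c, G a c → law p f a * law p g c ≤ b * law p (fun ω => (f ω, g ω)) (a, c)) :
    ∑ a, law p f a * prob p (fun ω => G a (g ω)) ≤ b := by
  classical
  have := Fintype.ofFinite β
  have hle (a : α) : law p f a * prob p (fun ω => G a (g ω)) ≤ b * law p f a := by
    rw [← prob_law p g (G a), prob_eq_sum_mul, Finset.mul_sum,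
      show b * law p f a = ∑ c, b * law p (fun ω => (f ω, g ω)) (a, c) by
        rw [← Finset.mul_sum, sum_law_pair]]
    refine Finset.sum_le_sum fun c _ => ?_
    split_ifs with h
    · simpa only [mul_one] using hG a c h
    · simpa only [mul_zero] using mul_nonneg hb (law_nonneg hp.1 _ _)
  refine (Finset.sum_le_sum fun a _ => hle a).trans_eq ?_
  rw [← Finset.mul_sum, sum_law, hp.2, mul_one]

variable {Z X Y 𝒰 : Type*} [Fintype Z] [Fintype 𝒰]

/-- Mass function of the output `U` of the channel `V` with input `x Z`; it is the law of the
letters of a random codebook. -/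
noncomputable def outputMass (p : Z → ℝ) (x : Z → X) (V : X → 𝒰 → ℝ) : 𝒰 → ℝ :=
  law (kernelJoint p x V) (fun ω => ω.1)

lemma outputMass_mem_stdSimplex {p : Z → ℝ} (hp : p ∈ stdSimplex ℝ Z) (x : Z → X)
    {V : X → 𝒰 → ℝ} (hV : ∀ a, V a ∈ stdSimplex ℝ 𝒰) : outputMass p x V ∈ stdSimplex ℝ 𝒰 :=
  law_mem_stdSimplex (kernelJoint_mem_stdSimplex hp x hV) _

lemma prob_kernelJoint (p : Z → ℝ) (x : Z → X) (V : X → 𝒰 → ℝ) (E : 𝒰 → Z → Prop) :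
    prob (kernelJoint p x V) (fun ω => E ω.1 ω.2) =
      ∑ z, p z * prob (V (x z)) (fun u => E u z) := by
  classical
  simp only [prob_eq_sum_mul, Fintype.sum_prod_type_right, Finset.mul_sum, kernelJoint, mul_assoc]

lemma one_sub_pow_le_of_le {t v a : ℝ} (ht1 : t ≤ 1) (hv0 : 0 ≤ v) (hv1 : v ≤ 1) (ha : 0 < a)
    (h : v ≤ a * t) (M : ℕ) : (1 - t) ^ M ≤ 1 - v + Real.exp (-(M / a)) := by
  have hbase : 1 - t ≤ Real.exp (-(v / a)) := by
    have : v / a ≤ t := by rwa [div_le_iff₀' ha]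
    linarith [Real.add_one_le_exp (-(v / a))]
  have hpow : (1 - t) ^ M ≤ Real.exp (v * -(M / a)) :=
    calc (1 - t) ^ M ≤ Real.exp (-(v / a)) ^ M := pow_le_pow_left₀ (by linarith) hbase M
      _ = Real.exp (v * -(M / a)) := by rw [← Real.exp_nat_mul]; congr 1; ring
  have hconvex := convexOn_exp.2 (Set.mem_univ 0) (Set.mem_univ (-(M / a)))
    (sub_nonneg.2 hv1) hv0 (by ring)
  simp only [smul_eq_mul, mul_zero, zero_add, Real.exp_zero, mul_one] at hconvex
  linarith [mul_le_of_le_one_left (Real.exp_pos (-(M / a))).le hv1]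

lemma prob_le_mul_prob {q r : 𝒰 → ℝ} {E : 𝒰 → Prop} {a : ℝ} (h : ∀ u, E u → r u ≤ a * q u) :
    prob r E ≤ a * prob q E := by
  classical
  rw [prob_eq_sum_mul, prob_eq_sum_mul, Finset.mul_sum]
  refine Finset.sum_le_sum fun u _ => ?_
  split_ifs with hu
  · simpa only [mul_one] using h u hu
  · simp only [mul_zero, le_refl]

lemma expected_prob_uncovered_le {p : Z → ℝ} (hp : p ∈ stdSimplex ℝ Z) (x : Z → X)
    {V : X → 𝒰 → ℝ} (hV : ∀ a, V a ∈ stdSimplex ℝ 𝒰) {T : 𝒰 → X → Prop} {a : ℝ} (ha : 0 < a)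
    (hT : ∀ u ξ, T u ξ → V ξ u ≤ a * outputMass p x V u) (M : ℕ) :
    ∑ c, prodMass (outputMass p x V) (Fin M) c * prob p (fun z => ∀ m, ¬ T (c m) (x z)) ≤
      prob (kernelJoint p x V) (fun ω => ¬ T ω.1 (x ω.2)) + Real.exp (-(M / a)) := by
  have hq := outputMass_mem_stdSimplex hp x hV
  have hexp : Real.exp (-(M / a)) = ∑ z, p z * Real.exp (-(M / a)) := by
    rw [← Finset.sum_mul, hp.2, one_mul]
  rw [sum_mul_prob_comm, prob_kernelJoint p x V (fun u z => ¬ T u (x z)), hexp,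
    ← Finset.sum_add_distrib]
  refine Finset.sum_le_sum fun z _ => ?_
  rw [← mul_add]
  refine mul_le_mul_of_nonneg_left ?_ (hp.1 z)
  rw [prob_prodMass_forall (outputMass p x V) (fun u => ¬ T u (x z)), Fintype.card_fin,
    prob_not hq.2, prob_not (hV (x z)).2]
  exact one_sub_pow_le_of_le (prob_le_one hq _) (prob_nonneg (hV (x z)).1 _)
    (prob_le_one (hV (x z)) _) ha (prob_le_mul_prob fun u => hT u (x z)) M

lemma exists_codebook [Finite Y] {p : Z → ℝ} (hp : p ∈ stdSimplex ℝ Z) (x : Z → X) (y : Z → Y)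
    {V : X → 𝒰 → ℝ} (hV : ∀ a, V a ∈ stdSimplex ℝ 𝒰) (T : 𝒰 → X → Prop) (G : 𝒰 → Y → Prop)
    {a a' b : ℝ} (ha : 0 ≤ a) (ha' : 0 < a') (hb : 0 ≤ b)
    (hT : ∀ u ξ, T u ξ → V ξ u ≤ a' * outputMass p x V u)
    (hG : ∀ u υ, G u υ → outputMass p x V u * law p y υ ≤
      b * law (kernelJoint p x V) (fun ω => (ω.1, y ω.2)) (u, υ))
    (M : ℕ) {A B C : ℝ} (hA0 : 0 < A) (hB0 : 0 < B) (hC0 : 0 < C)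
    (hA : prob (kernelJoint p x V) (fun ω => ¬ T ω.1 (x ω.2)) + Real.exp (-(M / a')) ≤ A)
    (hB : M * b ≤ B)
    (hC : M * (a * prob (kernelJoint p x V) (fun ω => ¬ G ω.1 (y ω.2))) ≤ C) :
    ∃ c : Fin M → 𝒰, prob p (fun z => ∀ m, ¬ T (c m) (x z)) ≤ 3 * A ∧
      ∑ m, prob p (fun z => G (c m) (y z)) ≤ 3 * B ∧
      ∑ m, a * (prob (kernelJoint p x V) (fun ω => ω.1 = c m ∧ ¬ G (c m) (y ω.2)) /
        outputMass p x V (c m)) ≤ 3 * C := by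
  have := Fintype.ofFinite Y
  have hJ := kernelJoint_mem_stdSimplex hp x hV
  have hq := outputMass_mem_stdSimplex hp x hV
  have hsum (F : 𝒰 → ℝ) : ∑ c, prodMass (outputMass p x V) (Fin M) c * ∑ m, F (c m) =
      M * ∑ u, outputMass p x V u * F u := by
    simp only [Finset.mul_sum]
    rw [Finset.sum_comm]
    simp only [sum_prodMass_mul_eval hq.2, Finset.sum_const, Finset.card_univ, Fintype.card_fin,
      nsmul_eq_mul, Finset.mul_sum]
  have hprobY (u : 𝒰) :
      prob p (fun z => G u (y z)) = prob (kernelJoint p x V) (fun ω => G u (y ω.2)) := by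
    rw [← prob_law p y (G u), ← law_kernelJoint_snd p x (fun a => (hV a).2) y, prob_law]
  refine exists_le_three_of_average_le (prodMass_mem_stdSimplex hq (Fin M)) hA0 hB0 hC0
    (fun c => prob_nonneg hp.1 _) (fun c => Finset.sum_nonneg fun m _ => prob_nonneg hp.1 _)
    (fun c => Finset.sum_nonneg fun m _ => mul_nonneg ha (div_nonneg (prob_nonneg hJ.1 _)
      (hq.1 _))) ((expected_prob_uncovered_le hp x hV ha' hT M).trans hA) ?_ ?_
  · rw [hsum fun u => prob p (fun z => G u (y z))]
    simp only [hprobY]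
    refine le_trans (mul_le_mul_of_nonneg_left ?_ M.cast_nonneg) hB
    refine sum_law_mul_prob_le hJ (fun ω => ω.1) (fun ω => y ω.2) hb ?_
    rwa [law_kernelJoint_snd p x (fun a => (hV a).2) y]
  · rw [hsum fun u => a * (prob (kernelJoint p x V) (fun ω => ω.1 = u ∧ ¬ G u (y ω.2)) /
      outputMass p x V u)]
    simp only [mul_left_comm _ a, ← Finset.mul_sum]
    rw [outputMass, sum_law_mul_prob_div_law hJ.1 (fun ω => ω.1) fun u ω => ¬ G u (y ω.2)]
    linarith

end Codebook

section Binning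

variable {Z ι κ : Type*} [Fintype Z]

lemma log_sub_entropy_le [Fintype κ] {p : Z → ℝ} (hp : p ∈ stdSimplex ℝ Z) (f : Z → κ) {K : ℝ}
    (hK : 0 < K) (E : Z → Prop) [DecidablePred E] :
    Real.log K - entropy p f ≤
      K * (∑ z, p z * (if E z then law p f (f z) else 0)) - prob p E +
        prob p (fun z => ¬ E z) * Real.log K := by
  have hdeficit : Real.log K - entropy p f =
      ∑ z, p z * (Real.log K + Real.log (law p f (f z))) := by
    simp only [mul_add, Finset.sum_add_distrib]
    rw [← Finset.sum_mul, hp.2, entropy_eq_neg_sum]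
    ring
  have hsplit : prob p E * (-1) + prob p (fun z => ¬ E z) * Real.log K =
      ∑ z, p z * (if E z then -1 else Real.log K) := (sum_mul_ite_eq_prob p E _ _).symm
  suffices h : ∑ z, p z * (Real.log K + Real.log (law p f (f z))) ≤
      ∑ z, p z * (K * (if E z then law p f (f z) else 0) + (if E z then -1 else Real.log K)) by
    simp only [mul_add, mul_left_comm _ K, Finset.sum_add_distrib, ← Finset.mul_sum] at h hdeficit
    linarith
  refine Finset.sum_le_sum fun z _ => ?_
  rcases (hp.1 z).eq_or_lt with hz | hz
  · simp only [← hz, zero_mul, le_refl]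
  refine mul_le_mul_of_nonneg_left ?_ hz.le
  have hpos := law_pos hp.1 f hz
  split_ifs
  · rw [← Real.log_mul hK.ne' hpos.ne']
    exact Real.log_le_sub_one_of_pos (mul_pos hK hpos)
  · linarith [Real.log_nonpos hpos.le (prob_le_one hp fun ω => f ω = f z)]

variable [Fintype κ] [Fintype ι] {q : κ → ℝ} {r : ℝ}

lemma expected_law_bin_le [DecidableEq ι] (hq : q ∈ stdSimplex ℝ κ) (hr0 : 0 ≤ r)
    (hr : ∀ k, q k = r) {p : Z → ℝ} (hp : p ∈ stdSimplex ℝ Z) (I : Z → ι) (z : Z) :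
    ∑ c, prodMass q ι c * law p (fun z' => c (I z')) (c (I z)) ≤ law p I (I z) + r := by
  classical
  simp only [law_eq_prob]
  rw [sum_mul_prob_comm, prob_eq_sum_mul, show r = ∑ z', p z' * r by
    rw [← Finset.sum_mul, hp.2, one_mul], ← Finset.sum_add_distrib]
  refine Finset.sum_le_sum fun z' _ => ?_
  rw [← mul_add]
  refine mul_le_mul_of_nonneg_left ?_ (hp.1 z')
  split_ifs with h
  · linarith [prob_le_one (prodMass_mem_stdSimplex hq ι) fun c => c (I z') = c (I z)]
  · rw [zero_add]
    refine (prob_prodMass_collision (h := id) hq.2 (fun k => ?_) h).le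
    simp [law_apply, hr]

lemma expected_log_sub_entropy_bin_le [DecidableEq ι] (hq : q ∈ stdSimplex ℝ κ) {K : ℝ}
    (hK : 0 < K) (hqK : ∀ k, q k = 1 / K) {p : Z → ℝ} (hp : p ∈ stdSimplex ℝ Z) (I : Z → ι)
    {good : ι → Prop} {a : ℝ} (ha0 : 0 ≤ a) (ha : ∀ i, good i → law p I i ≤ a) :
    ∑ c, prodMass q ι c * (Real.log K - entropy p (fun z => c (I z))) ≤
      K * a + prob p (fun z => ¬ good (I z)) * Real.log K := by
  classical
  have hμ := prodMass_mem_stdSimplex hq ι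
  have hgood : prob p (fun z => good (I z)) ≤ 1 := prob_le_one hp _
  have hcollision : ∑ c, prodMass q ι c * (∑ z, p z * (if good (I z) then
      law p (fun z' => c (I z')) (c (I z)) else 0)) ≤
        prob p (fun z => good (I z)) * (a + 1 / K) := by
    rw [prob_eq_sum_mul, Finset.sum_mul]
    simp only [Finset.mul_sum, mul_left_comm _ (p _)]
    rw [Finset.sum_comm]
    simp only [← Finset.mul_sum, mul_assoc]
    refine Finset.sum_le_sum fun z _ => mul_le_mul_of_nonneg_left ?_ (hp.1 z)
    split_ifs with hz
    · rw [one_mul]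
      exact (expected_law_bin_le hq (by positivity) hqK hp I z).trans
        (add_le_add_left (ha _ hz) _)
    · simp only [mul_zero, zero_mul, Finset.sum_const_zero, le_refl]
  have hdeficit := Finset.sum_le_sum fun (c : ι → κ) (_ : c ∈ Finset.univ) =>
    mul_le_mul_of_nonneg_left
      (log_sub_entropy_le hp (fun z => c (I z)) hK fun z => good (I z)) (hμ.1 c)
  simp only [mul_add, mul_sub, Finset.sum_add_distrib, Finset.sum_sub_distrib, ← Finset.sum_mul,
    hμ.2, one_mul, mul_left_comm _ K, ← Finset.mul_sum] at hdeficit ⊢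
  have hK1 : K * (prob p (fun z => good (I z)) * (a + 1 / K)) =
      K * a * prob p (fun z => good (I z)) + prob p (fun z => good (I z)) := by
    field_simp
  have := mul_le_of_le_one_right (mul_nonneg hK.le ha0) hgood
  have := mul_le_mul_of_nonneg_left hcollision hK.le
  linarith

lemma expected_prob_confusion_le [DecidableEq ι] {κ' : Type*} (hq : q ∈ stdSimplex ℝ κ) {h : κ → κ'}
    (hr0 : 0 ≤ r) (hr : ∀ k, law q h k = r) {p : Z → ℝ} (hp : ∀ z, 0 ≤ p z) (I : Z → ι)
    (L : ι → Z → Prop) :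
    ∑ c, prodMass q ι c * prob p (fun z => ∃ i, i ≠ I z ∧ h (c i) = h (c (I z)) ∧ L i z) ≤
      (∑ i, prob p (L i)) * r := by
  classical
  have hμ := prodMass_mem_stdSimplex hq ι
  have hbin (z : Z) (i : ι) : prob (prodMass q ι)
      (fun c => i ≠ I z ∧ h (c i) = h (c (I z)) ∧ L i z) ≤ (if L i z then 1 else 0) * r := by
    by_cases hiL : i ≠ I z ∧ L i z
    · rw [if_pos hiL.2, one_mul, ← prob_prodMass_collision hq.2 hr hiL.1]
      exact prob_mono hμ.1 fun c hc => hc.2.1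
    · rw [prob_congr (F := fun _ => False) _ fun c =>
      iff_of_false (fun hc => hiL ⟨hc.1, hc.2.2⟩) id]
      have : (0 : ℝ) ≤ if L i z then 1 else 0 := by split_ifs <;> norm_num
      simpa [prob] using mul_nonneg this hr0
  rw [sum_mul_prob_comm]
  calc ∑ z, p z * prob (prodMass q ι) (fun c => ∃ i, i ≠ I z ∧ h (c i) = h (c (I z)) ∧ L i z)
      ≤ ∑ z, p z * ∑ i, (if L i z then 1 else 0) * r :=
        Finset.sum_le_sum fun z _ => mul_le_mul_of_nonneg_left
          ((prob_exists_le hμ.1 _).trans (Finset.sum_le_sum fun i _ => hbin z i)) (hp z)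
    _ = (∑ i, prob p (L i)) * r := by
        simp only [prob_eq_sum_mul, Finset.mul_sum, Finset.sum_mul, mul_assoc]
        exact Finset.sum_comm

lemma exists_binning {Y : Type*} {p : Z → ℝ} (hp : p ∈ stdSimplex ℝ Z) (I : Z → ι) (y : Z → Y)
    (good : ι → Prop) (L : ι → Y → Prop) {a : ℝ} (ha : ∀ i, good i → law p I i ≤ a)
    {w s : ℕ} [NeZero w] [NeZero s] {D B : ℝ} (hD0 : 0 < D) (hB0 : 0 < B) (ha0 : 0 ≤ a)
    (hD : (w * s : ℝ) * a + prob p (fun z => ¬ good (I z)) * Real.log (w * s) ≤ D)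
    (hB : (∑ i, prob p (fun z => L i (y z))) / w ≤ B) :
    ∃ bin : ι → Fin w × Fin s,
      Real.log (w * s) - entropy p (fun z => bin (I z)) ≤ 3 * D ∧
      prob p (fun z => ∃ i, i ≠ I z ∧ (bin i).1 = (bin (I z)).1 ∧ L i (y z)) ≤ 3 * B := by
  classical
  have hw : (0 : ℝ) < w := Nat.cast_pos.2 (NeZero.pos w)
  have hs : (0 : ℝ) < s := Nat.cast_pos.2 (NeZero.pos s)
  have hws : (0 : ℝ) < w * s := mul_pos hw hs
  have hq : (fun _ => 1 / (w * s) : Fin w × Fin s → ℝ) ∈ stdSimplex ℝ (Fin w × Fin s) := by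
    refine ⟨fun _ => by positivity, ?_⟩
    rw [Finset.sum_const, Finset.card_univ, Fintype.card_prod, Fintype.card_fin, Fintype.card_fin,
      nsmul_eq_mul, Nat.cast_mul]
    field_simp
  have hfst (k : Fin w) :
      law (fun _ => 1 / (w * s) : Fin w × Fin s → ℝ) Prod.fst k = 1 / (w : ℝ) := by
    simp only [law_apply, Fintype.sum_prod_type_right, Finset.sum_ite_eq', Finset.mem_univ, if_true,
      Finset.sum_const, Finset.card_univ, Fintype.card_fin, nsmul_eq_mul]
    field_simp
  have hdeficit (c : ι → Fin w × Fin s) :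
      0 ≤ Real.log (w * s) - entropy p (fun z => c (I z)) := by
    have := entropy_le_log_card hp (fun z => c (I z))
    rw [Fintype.card_prod, Fintype.card_fin, Fintype.card_fin, Nat.cast_mul] at this
    linarith
  obtain ⟨bin, hbin, hconfusion, -⟩ := exists_le_three_of_average_le
    (prodMass_mem_stdSimplex hq ι) hD0 hB0 one_pos (F₃ := fun _ => 0) hdeficit
    (fun c => prob_nonneg hp.1 _) (fun _ => le_rfl)
    ((expected_log_sub_entropy_bin_le hq hws (fun _ => rfl) hp I ha0 ha).trans hD)
    ((expected_prob_confusion_le hq (by positivity) hfst hp.1 I fun i z => L i (y z)).trans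
      (by rwa [mul_one_div])) (by simp)
  exact ⟨bin, hbin, hconfusion⟩

end Binning

section OneShot

lemma exists_option_choice {α ι : Type*} (R : α → ι → Prop) :
    ∃ e : α → Option ι, (∀ a i, e a = some i → R a i) ∧ ∀ a, e a = none → ∀ i, ¬ R a i := by
  have h (a : α) : ∃ o : Option ι, (∀ i, o = some i → R a i) ∧ (o = none → ∀ i, ¬ R a i) := by
    by_cases hR : ∃ i, R a i
    · obtain ⟨i, hi⟩ := hR
      exact ⟨some i, fun j hj => Option.some.inj hj ▸ hi, fun h => (Option.some_ne_none _ h).elim⟩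
    · exact ⟨none, fun _ h => (Option.some_ne_none _ h.symm).elim, fun _ => not_exists.1 hR⟩
  choose e he using h
  exact ⟨e, fun a => (he a).1, fun a => (he a).2⟩

lemma exists_list_decoder {Z Y ι κ : Type*} (I : Z → Option ι) (y : Z → Y) (L : ι → Y → Prop)
    (k : Option ι → κ) :
    ∃ d : κ × Y → Option ι, ∀ z, I z ≠ d (k (I z), y z) →
      (I z = none ∨ ∃ m, I z = some m ∧ ¬ L m (y z)) ∨
        ∃ i, i ≠ I z ∧ k i = k (I z) ∧ ∃ m, i = some m ∧ L m (y z) := by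
  obtain ⟨d, hd, hd_none⟩ := exists_option_choice
    fun (v : κ × Y) m => k (some m) = v.1 ∧ L m v.2
  refine ⟨d, fun z hz => ?_⟩
  by_contra! hcon
  obtain ⟨⟨hI, hL⟩, hunique⟩ := hcon
  obtain ⟨m, hm⟩ := Option.ne_none_iff_exists'.1 hI
  rcases hdz : d (k (I z), y z) with - | m'
  · exact hd_none _ hdz m ⟨hm ▸ rfl, hL m hm⟩
  · obtain ⟨hk, hm'⟩ := hd _ _ hdz
    exact hunique (some m') (hdz ▸ hz.symm) hk m' rfl hm'

variable {Z X Y 𝒰 ι : Type*} [Fintype Z] {p : Z → ℝ}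

section Index

variable [Fintype 𝒰] {x : Z → X} {V : X → 𝒰 → ℝ} {I : Z → ι} {i : ι} {u : 𝒰} {a : ℝ}

/- The reverse channel has probability `V (x z) u / outputMass p x V u ≥ 1 / a` wherever the index
`i` is chosen, so that conditioning on the codeword dominates conditioning on the index. -/
lemma prob_index_and_le (hp : p ∈ stdSimplex ℝ Z) (hV : ∀ a, V a ∈ stdSimplex ℝ 𝒰) (ha : 0 ≤ a)
    (h : ∀ z, I z = i → 0 < outputMass p x V u ∧ outputMass p x V u ≤ a * V (x z) u)
    (E : Z → Prop) :
    prob p (fun z => I z = i ∧ E z) ≤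
      a * (prob (kernelJoint p x V) (fun ω => ω.1 = u ∧ E ω.2) / outputMass p x V u) := by
  classical
  have hjoint : prob (kernelJoint p x V) (fun ω => ω.1 = u ∧ E ω.2) =
      ∑ z, p z * (V (x z) u * if E z then 1 else 0) := by
    rw [prob_kernelJoint p x V (fun v z => v = u ∧ E z)]
    refine Finset.sum_congr rfl fun z _ => congrArg (p z * ·) ?_
    by_cases hz : E z <;> simp [prob, hz]
  rw [prob_eq_sum_mul, hjoint, Finset.sum_div, Finset.mul_sum]
  refine Finset.sum_le_sum fun z _ => ?_
  by_cases hz : I z = i ∧ E z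
  · obtain ⟨hpos, hle⟩ := h z hz.1
    rw [if_pos hz, if_pos hz.2, mul_one, mul_one, ← mul_div_assoc, le_div_iff₀ hpos]
    linarith [mul_le_mul_of_nonneg_left hle (hp.1 z)]
  · rw [if_neg hz, mul_zero]
    have := (hV (x z)).1 u
    have := hp.1 z
    have := (outputMass_mem_stdSimplex hp x hV).1 u
    have : (0 : ℝ) ≤ if E z then 1 else 0 := by split_ifs <;> norm_num
    positivity

lemma law_index_le (hp : p ∈ stdSimplex ℝ Z) (hV : ∀ a, V a ∈ stdSimplex ℝ 𝒰) (ha : 0 ≤ a)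
    (h : ∀ z, I z = i → 0 < outputMass p x V u ∧ outputMass p x V u ≤ a * V (x z) u) :
    law p I i ≤ a := by
  have hle := prob_index_and_le hp hV ha h fun _ => True
  simp only [and_true] at hle
  exact hle.trans (mul_le_of_le_one_right ha (div_self_le_one _))

lemma law_index_pair_le (hp : p ∈ stdSimplex ℝ Z) (hV : ∀ a, V a ∈ stdSimplex ℝ 𝒰) (ha : 0 ≤ a)
    (h : ∀ z, I z = i → 0 < outputMass p x V u ∧ outputMass p x V u ≤ a * V (x z) u)
    {y : Z → Y} {υ : Y} {b : ℝ} (hb : 0 ≤ b)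
    (hυ : law (kernelJoint p x V) (fun ω => (ω.1, y ω.2)) (u, υ) ≤
      b * (outputMass p x V u * law p y υ)) :
    law p (fun z => (I z, y z)) (i, υ) ≤ a * b * law p y υ := by
  have hle := prob_index_and_le hp hV ha h fun z => y z = υ
  simp only [← Prod.mk.injEq] at hle
  refine hle.trans ?_
  rw [mul_assoc]
  refine mul_le_mul_of_nonneg_left ?_ ha
  refine div_le_of_le_mul₀ ((outputMass_mem_stdSimplex hp x hV).1 u)
    (mul_nonneg hb (law_nonneg hp.1 y υ)) (hυ.trans_eq (by ring))

end Index

lemma entropy_sub_entropy_pair_le {α β : Type*} [Fintype α] [Fintype β] (hp : ∀ z, 0 ≤ p z)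
    (f : Z → α) (g : Z → β) {ℓ : Z → ℝ}
    (h : ∀ z, law p (fun z => (f z, g z)) (f z, g z) ≤ Real.exp (ℓ z) * law p g (g z)) :
    entropy p g - entropy p (fun z => (f z, g z)) ≤ ∑ z, p z * ℓ z := by
  rw [entropy_eq_neg_sum, entropy_eq_neg_sum, neg_sub_neg, ← Finset.sum_sub_distrib]
  refine Finset.sum_le_sum fun z _ => ?_
  rcases (hp z).eq_or_lt with hz | hz
  · simp only [← hz, zero_mul, sub_zero, le_refl]
  rw [← mul_sub]
  refine mul_le_mul_of_nonneg_left ?_ hz.le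
  have hlog := Real.log_le_log (law_pos hp _ hz) (h z)
  rw [Real.log_mul (Real.exp_ne_zero _) (law_pos hp g hz).ne', Real.log_exp] at hlog
  linarith

/- `I(Y; W) ≤ H(W) + H(Y) - H(I, Y) + H(I | W, Y)` for a function `W` of `I`, and Fano's inequality
bounds the last term. -/
lemma mutualInfo_comp_le {α β κ : Type*} [Fintype α] [Fintype β] [Fintype κ]
    (hp : p ∈ stdSimplex ℝ Z) (I : Z → α) (y : Z → β) (k : α → κ) (d : κ × β → α) {η : ℝ}
    (hη : prob p (fun z => I z ≠ d (k (I z), y z)) ≤ η) :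
    mutualInfo p y (fun z => k (I z)) ≤ Real.log (Fintype.card κ) +
      (entropy p y - entropy p (fun z => (I z, y z))) + Real.log 2 +
        η * Real.log (Fintype.card α) := by
  have hfano := fano_inequality hp I (fun z => (k (I z), y z)) d
  have hbin : Real.binEntropy (prob p fun z => I z ≠ d (k (I z), y z)) ≤ Real.log 2 :=
    Real.binEntropy_le_log_two
  have hη := mul_le_mul_of_nonneg_right hη (Real.log_natCast_nonneg (Fintype.card α))
  have hmono : entropy p (fun z => (I z, y z)) ≤ entropy p (fun z => (I z, k (I z), y z)) :=
    entropy_mono hp.1 fun z z' h => by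
      simp only [Prod.mk.injEq] at h ⊢
      exact ⟨h.1, h.2.2⟩
  have hswap : entropy p (fun z => (y z, k (I z))) = entropy p (fun z => (k (I z), y z)) :=
    entropy_congr p fun z z' => by simp only [Prod.mk.injEq, and_comm]
  have hcard : entropy p (fun z => k (I z)) ≤ Real.log (Fintype.card κ) := by
    obtain ⟨z, -⟩ := Finset.nonempty_of_sum_ne_zero (hp.2.trans_ne one_ne_zero)
    have : Nonempty κ := ⟨k (I z)⟩
    exact entropy_le_log_card hp _
  rw [mutualInfo, hswap]
  linarith

/-- A covering code, the part of the construction that precedes binning: the index `e ξ` of the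
source string `ξ` is undefined with probability at most `ε`; with probability at most `η` it is
missing from the list `{m | L m υ}` of the indices compatible with the side information `υ`; the
expected length of this list is at most `B`; and `a`, `b`, `Γ` bound the probability of an index,
alone and given the side information. -/
structure IsCoveringCode [Fintype ι] (p : Z → ℝ) (x : Z → X) (y : Z → Y) (e : X → Option ι)
    (L : ι → Y → Prop) (ε η B a b Γ : ℝ) : Prop where
  prob_none_le : prob p (fun z => e (x z) = none) ≤ ε
  prob_miss_le : prob p (fun z => ∃ m, e (x z) = some m ∧ ¬ L m (y z)) ≤ η
  sum_prob_list_le : ∑ m, prob p (fun z => L m (y z)) ≤ B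
  law_le m : law p (fun z => e (x z)) (some m) ≤ a
  law_pair_le m υ : law p (fun z => (e (x z), y z)) (some m, υ) ≤ a * Γ * law p y υ
  law_pair_le_of_list m υ : L m υ →
    law p (fun z => (e (x z), y z)) (some m, υ) ≤ a * b * law p y υ

lemma exists_isCoveringCode [Fintype 𝒰] [Finite Y] (hp : p ∈ stdSimplex ℝ Z) (x : Z → X)
    (y : Z → Y) {V : X → 𝒰 → ℝ} (hV : ∀ a, V a ∈ stdSimplex ℝ 𝒰) (T : 𝒰 → X → Prop)
    (G : 𝒰 → Y → Prop) {a a' b b' Γ : ℝ} (ha : 0 ≤ a) (ha' : 0 < a') (hb : 0 ≤ b) (hb' : 0 ≤ b')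
    (hΓ : 0 ≤ Γ)
    (hT : ∀ u ξ, T u ξ → 0 < outputMass p x V u ∧ outputMass p x V u ≤ a * V ξ u ∧
      V ξ u ≤ a' * outputMass p x V u)
    (hG : ∀ u υ, G u υ → outputMass p x V u * law p y υ ≤
        b' * law (kernelJoint p x V) (fun ω => (ω.1, y ω.2)) (u, υ) ∧
      law (kernelJoint p x V) (fun ω => (ω.1, y ω.2)) (u, υ) ≤
        b * (outputMass p x V u * law p y υ))
    (hratio : ∀ u υ, law (kernelJoint p x V) (fun ω => (ω.1, y ω.2)) (u, υ) ≤
      Γ * (outputMass p x V u * law p y υ))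
    (M : ℕ) {A B C : ℝ} (hA0 : 0 < A) (hB0 : 0 < B) (hC0 : 0 < C)
    (hA : prob (kernelJoint p x V) (fun ω => ¬ T ω.1 (x ω.2)) + Real.exp (-(M / a')) ≤ A)
    (hB : M * b' ≤ B)
    (hC : M * (a * prob (kernelJoint p x V) (fun ω => ¬ G ω.1 (y ω.2))) ≤ C) :
    ∃ (e : X → Option (Fin M)) (L : Fin M → Y → Prop),
      IsCoveringCode p x y e L (3 * A) (3 * C) (3 * B) a b Γ := by
  obtain ⟨c, hcover, hlist, hmiss⟩ := exists_codebook hp x y hV T G ha ha' hb'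
    (fun u ξ h => (hT u ξ h).2.2) (fun u υ h => (hG u υ h).1) M hA0 hB0 hC0 hA hB hC
  obtain ⟨e, he, he_none⟩ := exists_option_choice fun ξ m => T (c m) ξ
  have hindex (m : Fin M) (z : Z) (hz : e (x z) = some m) :
      0 < outputMass p x V (c m) ∧ outputMass p x V (c m) ≤ a * V (x z) (c m) :=
    ⟨(hT _ _ (he _ _ hz)).1, (hT _ _ (he _ _ hz)).2.1⟩
  refine ⟨e, fun m υ => G (c m) υ, (prob_mono hp.1 fun z hz => he_none _ hz).trans hcover, ?_,
    hlist, fun m => law_index_le hp hV ha (hindex m),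
    fun m υ => law_index_pair_le hp hV ha (hindex m) hΓ (hratio _ _),
    fun m υ h => law_index_pair_le hp hV ha (hindex m) hb (hG _ _ h).2⟩
  refine (prob_exists_le hp.1 _).trans ((Finset.sum_le_sum fun m _ => ?_).trans hmiss)
  exact prob_index_and_le hp hV ha (hindex m) fun z => ¬ G (c m) (y z)

variable [Fintype ι] {x : Z → X} {y : Z → Y} {e : X → Option ι} {L : ι → Y → Prop}
  {ε η B a b Γ : ℝ}

lemma IsCoveringCode.exists_binning (h : IsCoveringCode p x y e L ε η B a b Γ)
    (hp : p ∈ stdSimplex ℝ Z) (ha : 0 ≤ a) (hB : 0 < B) {w s : ℕ} [NeZero w] [NeZero s] {D : ℝ}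
    (hD0 : 0 < D) (hD : (w * s : ℝ) * a + ε * Real.log (w * s) ≤ D) :
    ∃ bin : Option ι → Fin w × Fin s,
      Real.log (w * s) - entropy p (fun z => bin (e (x z))) ≤ 3 * D ∧
      prob p (fun z => ∃ i, i ≠ e (x z) ∧ (bin i).1 = (bin (e (x z))).1 ∧
        ∃ m, i = some m ∧ L m (y z)) ≤ 3 * (B / w) := by
  have hlogK : 0 ≤ Real.log ((w : ℝ) * s) := by
    exact_mod_cast Real.log_natCast_nonneg (w * s)
  have hw : (0 : ℝ) < w := Nat.cast_pos.2 (NeZero.pos w)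
  refine KeyAgreement.exists_binning hp (fun z => e (x z)) y (· ≠ none)
    (fun i υ => ∃ m, i = some m ∧ L m υ) (by simpa [Option.forall] using h.law_le) hD0
    (div_pos hB hw) ha ?_ ?_
  · simp only [not_ne_iff]
    refine le_trans ?_ hD
    gcongr
    exact h.prob_none_le
  · have hnone : prob p (fun z => ∃ m, (none : Option ι) = some m ∧ L m (y z)) = 0 := by
      simp [prob]
    gcongr
    rw [Fintype.sum_option, hnone, zero_add]
    simpa using h.sum_prob_list_le

variable [Fintype Y]

lemma IsCoveringCode.entropy_sub_entropy_pair_le (h : IsCoveringCode p x y e L ε η B a b Γ)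
    (hp : p ∈ stdSimplex ℝ Z) (ha : 0 < a) (ha1 : a ≤ 1) (hb : 1 ≤ b) (hΓ : 1 ≤ Γ) :
    entropy p y - entropy p (fun z => (e (x z), y z)) ≤
      (1 - ε) * Real.log a + Real.log b + η * Real.log Γ := by
  classical
  have hΓ0 : 0 < Γ := one_pos.trans_le hΓ
  have hb0 : 0 < b := one_pos.trans_le hb
  have hle := KeyAgreement.entropy_sub_entropy_pair_le hp.1 (fun z => e (x z)) y (ℓ := fun z =>
    (if e (x z) = none then 0 else Real.log a) + Real.log b +
      if ∃ i, e (x z) = some i ∧ ¬ L i (y z) then Real.log Γ else 0) fun z => by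
    have hy := law_nonneg hp.1 y (y z)
    rcases e (x z) with - | i
    · have hmarg : law p (fun z => (e (x z), y z)) (none, y z) ≤ law p y (y z) :=
        law_le_of_imp hp.1 fun ω hω => (Prod.mk.inj hω).2
      simpa [Real.exp_log hb0] using hmarg.trans (le_mul_of_one_le_left hy hb)
    by_cases hL : L i (y z)
    · simpa [hL, Real.exp_add, Real.exp_log ha, Real.exp_log hb0] using
        h.law_pair_le_of_list i (y z) hL
    · have hΓb : a * Γ * law p y (y z) ≤ a * b * Γ * law p y (y z) := by
        gcongr
        exact le_mul_of_one_le_right ha.le hb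
      simpa [hL, Real.exp_add, Real.exp_log ha, Real.exp_log hb0, Real.exp_log hΓ0] using
        (h.law_pair_le i (y z)).trans hΓb
  simp only [mul_add, Finset.sum_add_distrib] at hle
  rw [sum_mul_ite_eq_prob, sum_mul_ite_eq_prob, ← Finset.sum_mul, hp.2, prob_not hp.2] at hle
  have := mul_le_mul_of_nonneg_right h.prob_miss_le (Real.log_nonneg hΓ)
  have := mul_le_mul_of_nonpos_right (sub_le_sub_left h.prob_none_le 1) (Real.log_nonpos ha.le ha1)
  linarith

/- The bin number is stored and the position in the bin is the key. -/
lemma IsCoveringCode.exists_code (h : IsCoveringCode p x y e L ε η B a b Γ)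
    (hp : p ∈ stdSimplex ℝ Z) (ha : 0 < a) (ha1 : a ≤ 1) (hb : 1 ≤ b) (hΓ : 1 ≤ Γ) (hB : 0 < B)
    {w s : ℕ} [NeZero w] [NeZero s] {D : ℝ} (hD0 : 0 < D)
    (hD : (w * s : ℝ) * a + ε * Real.log (w * s) ≤ D) :
    ∃ (enc : X → Fin w × Fin s) (dec : Fin w × Y → Fin s),
      Real.log (w * s) - entropy p (fun z => enc (x z)) ≤ 3 * D ∧
      prob p (fun z => (enc (x z)).2 ≠ dec ((enc (x z)).1, y z)) ≤ ε + η + 3 * (B / w) ∧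
      mutualInfo p y (fun z => (enc (x z)).1) ≤ Real.log w +
        ((1 - ε) * Real.log a + Real.log b + η * Real.log Γ) + Real.log 2 +
        (ε + η + 3 * (B / w)) * Real.log (Fintype.card ι + 1) := by
  obtain ⟨bin, huniform, hconfusion⟩ := h.exists_binning hp ha.le hB hD0 hD
  obtain ⟨d, hd⟩ := exists_list_decoder (fun z => e (x z)) y L fun i => (bin i).1
  have herror : prob p (fun z => e (x z) ≠ d ((bin (e (x z))).1, y z)) ≤
      ε + η + 3 * (B / w) := by
    refine (prob_mono hp.1 hd).trans ((prob_or_le hp.1 _ _).trans (add_le_add ?_ hconfusion))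
    exact (prob_or_le hp.1 _ _).trans (add_le_add h.prob_none_le h.prob_miss_le)
  refine ⟨fun ξ => bin (e ξ), fun v => (bin (d v)).2, huniform,
    (prob_mono hp.1 fun z hz h => hz (congrArg (fun i => (bin i).2) h)).trans herror, ?_⟩
  have hleak := mutualInfo_comp_le hp (fun z => e (x z)) y (fun i => (bin i).1) d herror
  rw [Fintype.card_option, Fintype.card_fin, Nat.cast_succ] at hleak
  linarith [h.entropy_sub_entropy_pair_le hp ha ha1 hb hΓ]

end OneShot

section Concentration

open Filter Topology

variable {ζ : Type*} [Fintype ζ] {Q : ζ → ℝ}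

lemma prob_prodMass_sum_pos_le (hQ : ∀ z, 0 ≤ Q z) (ι : Type*) [Fintype ι] [DecidableEq ι]
    (g : ζ → ℝ) {t : ℝ} (ht : 0 ≤ t) :
    prob (prodMass Q ι) (fun ω => 0 < ∑ i, g (ω i)) ≤
      (∑ z, Q z * Real.exp (t * g z)) ^ Fintype.card ι := by
  rw [prob_eq_sum_mul, Fintype.card, ← Finset.prod_const,
    ← sum_prodMass_mul_prod Q fun _ z => Real.exp (t * g z)]
  refine Finset.sum_le_sum fun ω _ => ?_
  rw [← Real.exp_sum, ← Finset.mul_sum]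
  refine mul_le_mul_of_nonneg_left ?_ (prodMass_nonneg hQ ω)
  split_ifs with h
  · exact Real.one_le_exp (mul_nonneg ht h.le)
  · exact (Real.exp_pos _).le

/- The moment generating function has value `1` and negative derivative at `0`. -/
lemma exists_sum_mul_exp_lt_one (hQ : ∑ z, Q z = 1) {g : ζ → ℝ} (hg : ∑ z, Q z * g z < 0) :
    ∃ t : ℝ, 0 < t ∧ ∑ z, Q z * Real.exp (t * g z) < 1 := by
  have hderiv : HasDerivAt (fun t : ℝ => ∑ z, Q z * Real.exp (t * g z)) (∑ z, Q z * g z) 0 := by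
    refine HasDerivAt.fun_sum fun z _ => HasDerivAt.const_mul _ ?_
    simpa using ((hasDerivAt_id (0 : ℝ)).mul_const (g z)).exp
  have hslope := hderiv.tendsto_slope_zero_right.eventually_lt_const hg
  obtain ⟨t, hlt, ht⟩ := (hslope.and self_mem_nhdsWithin).exists
  have ht : 0 < t := ht
  refine ⟨t, ht, ?_⟩
  simp only [zero_add, zero_mul, Real.exp_zero, mul_one, hQ, smul_eq_mul] at hlt
  exact sub_neg.1 (neg_of_mul_neg_right hlt (inv_pos.2 ht).le)

lemma exists_prob_sum_gt_le (hQ : Q ∈ stdSimplex ℝ ζ) (f : ζ → ℝ) {ε : ℝ} (hε : 0 < ε) :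
    ∃ ρ : ℝ, 0 ≤ ρ ∧ ρ < 1 ∧ ∀ n : ℕ, prob (prodMass Q (Fin n))
      (fun ω => n * ((∑ z, Q z * f z) + ε) < ∑ i, f (ω i)) ≤ ρ ^ n := by
  have hmean : ∑ z, Q z * (f z - ((∑ z, Q z * f z) + ε)) = -ε := by
    simp only [mul_sub, Finset.sum_sub_distrib]
    rw [← Finset.sum_mul, hQ.2]
    ring
  obtain ⟨t, ht, hlt⟩ := exists_sum_mul_exp_lt_one hQ.2 (hmean.trans_lt (neg_lt_zero.2 hε))
  refine ⟨_, Finset.sum_nonneg fun z _ => mul_nonneg (hQ.1 z) (Real.exp_pos _).le, hlt,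
    fun n => ?_⟩
  have hle := prob_prodMass_sum_pos_le hQ.1 (Fin n) (fun z => f z - ((∑ z, Q z * f z) + ε)) ht.le
  rw [Fintype.card_fin] at hle
  refine (prob_congr _ fun ω => ?_).trans_le hle
  rw [Finset.sum_sub_distrib, Finset.sum_const, Finset.card_univ, Fintype.card_fin, nsmul_eq_mul,
    sub_pos]

lemma exists_prob_abs_sum_sub_gt_le (hQ : Q ∈ stdSimplex ℝ ζ) (f : ζ → ℝ) {ε : ℝ} (hε : 0 < ε) :
    ∃ ρ : ℝ, 0 ≤ ρ ∧ ρ < 1 ∧ ∀ n : ℕ, prob (prodMass Q (Fin n))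
      (fun ω => n * ε < |∑ i, f (ω i) - n * (∑ z, Q z * f z)|) ≤ 2 * ρ ^ n := by
  obtain ⟨ρ₁, hρ₁0, hρ₁1, hupper⟩ := exists_prob_sum_gt_le hQ f hε
  obtain ⟨ρ₂, hρ₂0, hρ₂1, hlower⟩ := exists_prob_sum_gt_le hQ (fun z => -f z) hε
  refine ⟨max ρ₁ ρ₂, le_max_of_le_left hρ₁0, max_lt hρ₁1 hρ₂1, fun n => ?_⟩
  have hQn := prodMass_mem_stdSimplex hQ (Fin n)
  have hpow₁ := pow_le_pow_left₀ hρ₁0 (le_max_left ρ₁ ρ₂) n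
  have hpow₂ := pow_le_pow_left₀ hρ₂0 (le_max_right ρ₁ ρ₂) n
  refine (prob_mono hQn.1 (F := fun ω => n * ((∑ z, Q z * f z) + ε) < ∑ i, f (ω i) ∨
    n * ((∑ z, Q z * -f z) + ε) < ∑ i, -f (ω i)) fun ω hω => ?_).trans
    ((prob_or_le hQn.1 _ _).trans (by linarith [hupper n, hlower n]))
  simp only [mul_neg, Finset.sum_neg_distrib]
  exact (lt_abs.1 hω).imp (fun h => by linarith) fun h => by linarith

lemma prob_prodMass_exists_eq_zero (Q : ζ → ℝ) (ι : Type*) [Fintype ι] [DecidableEq ι] :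
    prob (prodMass Q ι) (fun ω => ∃ i, Q (ω i) = 0) = 0 := by
  rw [prob_eq_sum_mul]
  refine Finset.sum_eq_zero fun ω _ => ?_
  split_ifs with h
  · obtain ⟨i, hi⟩ := h
    rw [prodMass, Finset.prod_eq_zero (Finset.mem_univ i) hi, zero_mul]
  · rw [mul_zero]

end Concentration

section Typicality

variable {ζ α β : Type*} [Fintype ζ] {P : ζ → ℝ} {f : ζ → α} {g : ζ → β}

/-- Strings of positive probability whose empirical information density is within `ε` of the mutual
information of `f` and `g` under `P`. -/
def IsJointlyTypical [Fintype α] [Fintype β] (P : ζ → ℝ) (f : ζ → α) (g : ζ → β) (ε : ℝ) {n : ℕ}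
    (u : Fin n → α) (v : Fin n → β) : Prop :=
  (∀ i, 0 < law P (fun ω => (f ω, g ω)) (u i, v i)) ∧
    |∑ i, Real.log (law P (fun ω => (f ω, g ω)) (u i, v i) / (law P f (u i) * law P g (v i))) -
      n * mutualInfo P f g| ≤ n * ε

lemma law_prodMass_pair (P : ζ → ℝ) (f : ζ → α) (g : ζ → β) {n : ℕ} (u : Fin n → α)
    (v : Fin n → β) :
    law (prodMass P (Fin n)) (fun ω => (fun i => f (ω i), fun i => g (ω i))) (u, v) =
      ∏ i, law P (fun ω => (f ω, g ω)) (u i, v i) := by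
  rw [law_congr_of_iff (g := fun ω i => (f (ω i), g (ω i))) (b := fun i => (u i, v i)) _ fun ω => by
    simp only [Prod.mk.injEq, funext_iff, forall_and]]
  exact congrFun (law_prodMass P (Fin n) fun ω => (f ω, g ω)) _

lemma law_prodMass_mul_law_prodMass (P : ζ → ℝ) (f : ζ → α) (g : ζ → β) {n : ℕ} (u : Fin n → α)
    (v : Fin n → β) :
    law (prodMass P (Fin n)) (fun ω i => f (ω i)) u *
      law (prodMass P (Fin n)) (fun ω i => g (ω i)) v = ∏ i, law P f (u i) * law P g (v i) := by
  rw [law_prodMass, law_prodMass, Finset.prod_mul_distrib]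
  rfl

lemma law_fst_mul_law_snd_pos (hP : ∀ z, 0 ≤ P z) {a : α} {b : β}
    (h : 0 < law P (fun ω => (f ω, g ω)) (a, b)) : 0 < law P f a * law P g b :=
  mul_pos (h.trans_le (law_le_of_imp hP fun _ hω => (Prod.mk.inj hω).1))
    (h.trans_le (law_le_of_imp hP fun _ hω => (Prod.mk.inj hω).2))

section IsJointlyTypical

variable [Fintype α] [Fintype β] {ε : ℝ} {n : ℕ} {u : Fin n → α} {v : Fin n → β}

lemma IsJointlyTypical.law_mul_law_pos (hP : ∀ z, 0 ≤ P z) (h : IsJointlyTypical P f g ε u v) :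
    0 < law (prodMass P (Fin n)) (fun ω i => f (ω i)) u *
      law (prodMass P (Fin n)) (fun ω i => g (ω i)) v := by
  rw [law_prodMass_mul_law_prodMass]
  exact Finset.prod_pos fun i _ => law_fst_mul_law_snd_pos hP (h.1 i)

lemma IsJointlyTypical.law_pair_eq_exp_mul (hP : ∀ z, 0 ≤ P z)
    (h : IsJointlyTypical P f g ε u v) : ∃ c, |c - n * mutualInfo P f g| ≤ n * ε ∧
      law (prodMass P (Fin n)) (fun ω => (fun i => f (ω i), fun i => g (ω i))) (u, v) =
        Real.exp c * (law (prodMass P (Fin n)) (fun ω i => f (ω i)) u *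
          law (prodMass P (Fin n)) (fun ω i => g (ω i)) v) := by
  have hmarg (i : Fin n) := law_fst_mul_law_snd_pos hP (h.1 i)
  refine ⟨_, h.2, ?_⟩
  rw [law_prodMass_mul_law_prodMass, law_prodMass_pair, Real.exp_sum, ← Finset.prod_mul_distrib]
  refine Finset.prod_congr rfl fun i _ => ?_
  rw [Real.exp_log (div_pos (h.1 i) (hmarg i)), div_mul_cancel₀ _ (hmarg i).ne']

lemma IsJointlyTypical.law_pair_le (hP : ∀ z, 0 ≤ P z) (h : IsJointlyTypical P f g ε u v) :
    law (prodMass P (Fin n)) (fun ω => (fun i => f (ω i), fun i => g (ω i))) (u, v) ≤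
      Real.exp (n * (mutualInfo P f g + ε)) *
        (law (prodMass P (Fin n)) (fun ω i => f (ω i)) u *
          law (prodMass P (Fin n)) (fun ω i => g (ω i)) v) := by
  obtain ⟨c, hc, heq⟩ := h.law_pair_eq_exp_mul hP
  rw [heq]
  refine mul_le_mul_of_nonneg_right (Real.exp_le_exp.2 ?_) (h.law_mul_law_pos hP).le
  linarith [(abs_le.1 hc).2]

lemma IsJointlyTypical.law_mul_law_le (hP : ∀ z, 0 ≤ P z) (h : IsJointlyTypical P f g ε u v) :
    law (prodMass P (Fin n)) (fun ω i => f (ω i)) u *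
        law (prodMass P (Fin n)) (fun ω i => g (ω i)) v ≤
      Real.exp (-(n * (mutualInfo P f g - ε))) *
        law (prodMass P (Fin n)) (fun ω => (fun i => f (ω i), fun i => g (ω i))) (u, v) := by
  obtain ⟨c, hc, heq⟩ := h.law_pair_eq_exp_mul hP
  rw [heq, ← mul_assoc, ← Real.exp_add]
  refine le_mul_of_one_le_left (h.law_mul_law_pos hP).le (Real.one_le_exp ?_)
  linarith [(abs_le.1 hc).1]

end IsJointlyTypical

lemma exists_prob_not_isJointlyTypical_le [Fintype α] [Fintype β] (hP : P ∈ stdSimplex ℝ ζ)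
    (f : ζ → α) (g : ζ → β) {ε : ℝ} (hε : 0 < ε) :
    ∃ ρ : ℝ, 0 ≤ ρ ∧ ρ < 1 ∧ ∀ n : ℕ, prob (prodMass P (Fin n))
      (fun ω => ¬ IsJointlyTypical P f g ε (fun i => f (ω i)) fun i => g (ω i)) ≤ 2 * ρ ^ n := by
  obtain ⟨ρ, hρ0, hρ1, hρ⟩ := exists_prob_abs_sum_sub_gt_le hP
    (fun ω => Real.log (law P (fun ω => (f ω, g ω)) (f ω, g ω) / (law P f (f ω) * law P g (g ω))))
    hε
  rw [← mutualInfo_eq_sum_log hP.1] at hρ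
  refine ⟨ρ, hρ0, hρ1, fun n => ?_⟩
  have hPn := prodMass_mem_stdSimplex hP (Fin n)
  refine (prob_mono hPn.1 fun ω hω => ?_).trans
    ((prob_or_le hPn.1 (fun ω => ∃ i, P (ω i) = 0) _).trans
      ((add_le_add (prob_prodMass_exists_eq_zero P (Fin n)).le (hρ n)).trans_eq (zero_add _)))
  by_contra! hcon
  exact hω ⟨fun i => law_pos hP.1 (fun ω => (f ω, g ω)) ((hP.1 _).lt_of_ne' (hcon.1 i)), hcon.2⟩

lemma exists_law_prodMass_pair_le [Finite α] [Finite β] (hP : ∀ z, 0 ≤ P z) (f : ζ → α)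
    (g : ζ → β) : ∃ C : ℝ, 1 ≤ C ∧ ∀ (n : ℕ) (u : Fin n → α) (v : Fin n → β),
      law (prodMass P (Fin n)) (fun ω => (fun i => f (ω i), fun i => g (ω i))) (u, v) ≤
        C ^ n * (law (prodMass P (Fin n)) (fun ω i => f (ω i)) u *
          law (prodMass P (Fin n)) (fun ω i => g (ω i)) v) := by
  obtain ⟨C, hC⟩ := (Set.finite_range fun ab : α × β =>
    law P (fun ω => (f ω, g ω)) ab / (law P f ab.1 * law P g ab.2)).bddAbove
  refine ⟨max 1 C, le_max_left _ _, fun n u v => ?_⟩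
  have hconst : max 1 C ^ n = ∏ _i : Fin n, max 1 C := by
    rw [Finset.prod_const, Finset.card_univ, Fintype.card_fin]
  rw [law_prodMass_mul_law_prodMass, law_prodMass_pair, hconst, ← Finset.prod_mul_distrib]
  refine Finset.prod_le_prod (fun i _ => law_nonneg hP _ _) fun i _ => ?_
  rcases (law_nonneg hP (fun ω => (f ω, g ω)) (u i, v i)).eq_or_lt with h | h
  · rw [← h]
    exact mul_nonneg (zero_le_one.trans (le_max_left _ _))
      (mul_nonneg (law_nonneg hP f _) (law_nonneg hP g _))
  · rw [← div_le_iff₀ (law_fst_mul_law_snd_pos hP h)]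
    exact (hC ⟨(u i, v i), rfl⟩).trans (le_max_right _ _)

end Typicality

section ProdKernel

variable {𝒵 ξ β 𝒰 ι : Type*} [Fintype 𝒵] [Fintype 𝒰] [Fintype ι]

/-- The memoryless extension of the channel `V`. -/
def prodKernel (V : ξ → 𝒰 → ℝ) (a : ι → ξ) (u : ι → 𝒰) : ℝ := ∏ i, V (a i) (u i)

lemma prodKernel_mem_stdSimplex [DecidableEq ι] {V : ξ → 𝒰 → ℝ}
    (hV : ∀ a, V a ∈ stdSimplex ℝ 𝒰) (a : ι → ξ) : prodKernel V a ∈ stdSimplex ℝ (ι → 𝒰) := by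
  refine ⟨fun u => Finset.prod_nonneg fun i _ => (hV _).1 _, ?_⟩
  simp only [prodKernel]
  rw [← Fintype.piFinset_univ, ← Finset.prod_univ_sum]
  exact Finset.prod_eq_one fun i _ => (hV _).2

lemma prob_kernelJoint_prodMass [DecidableEq ι] (P : 𝒵 → ℝ) (x : 𝒵 → ξ) (V : ξ → 𝒰 → ℝ)
    (E : (ι → 𝒰) × (ι → 𝒵) → Prop) :
    prob (kernelJoint (prodMass P ι) (fun z i => x (z i)) (prodKernel V)) E =
      prob (prodMass (kernelJoint P x V) ι) (fun ω => E (fun i => (ω i).1, fun i => (ω i).2)) := by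
  classical
  rw [prob_eq_sum_mul, prob_eq_sum_mul,
    ← (Equiv.arrowProdEquivProdArrow ι (fun _ => 𝒰) (fun _ => 𝒵)).sum_comp]
  refine Finset.sum_congr rfl fun ω _ => ?_
  simp only [Equiv.arrowProdEquivProdArrow, Equiv.coe_fn_mk, kernelJoint, prodMass, prodKernel,
    Finset.prod_mul_distrib]
  congr 1

lemma law_kernelJoint_prodMass [DecidableEq ι] (P : 𝒵 → ℝ) (x : 𝒵 → ξ) (V : ξ → 𝒰 → ℝ)
    (F : (ι → 𝒰) × (ι → 𝒵) → β) :
    law (kernelJoint (prodMass P ι) (fun z i => x (z i)) (prodKernel V)) F =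
      law (prodMass (kernelJoint P x V) ι) (fun ω => F (fun i => (ω i).1, fun i => (ω i).2)) :=
  funext fun b => prob_kernelJoint_prodMass P x V fun ω => F ω = b

end ProdKernel

lemma natCeil_exp_le {t : ℝ} (ht : 0 ≤ t) : (⌈Real.exp t⌉₊ : ℝ) ≤ 2 * Real.exp t := by
  linarith [Nat.ceil_lt_add_one (Real.exp_pos t).le, Real.one_le_exp ht]

lemma log_natCeil_exp_le {t : ℝ} (ht : 0 ≤ t) : Real.log ⌈Real.exp t⌉₊ ≤ Real.log 2 + t := by
  have hpos : (0 : ℝ) < ⌈Real.exp t⌉₊ := (Real.exp_pos t).trans_le (Nat.le_ceil _)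
  refine (Real.log_le_log hpos (natCeil_exp_le ht)).trans_eq ?_
  rw [Real.log_mul two_ne_zero (Real.exp_ne_zero t), Real.log_exp]

lemma log_natCeil_exp_add_one_le {t : ℝ} (ht : 0 ≤ t) :
    Real.log (⌈Real.exp t⌉₊ + 1) ≤ Real.log 3 + t := by
  have hle : (⌈Real.exp t⌉₊ + 1 : ℝ) ≤ 3 * Real.exp t := by
    linarith [natCeil_exp_le ht, Real.one_le_exp ht]
  refine (Real.log_le_log (by positivity) hle).trans_eq ?_
  rw [Real.log_mul three_ne_zero (Real.exp_ne_zero t), Real.log_exp]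

lemma natCeil_exp_mul_exp_le {a b c : ℝ} (ha : 0 ≤ a) (h : a + b ≤ c) :
    ⌈Real.exp a⌉₊ * Real.exp b ≤ 2 * Real.exp c :=
  calc ⌈Real.exp a⌉₊ * Real.exp b ≤ 2 * Real.exp a * Real.exp b := by
        gcongr
        exact natCeil_exp_le ha
    _ = 2 * Real.exp (a + b) := by rw [mul_assoc, ← Real.exp_add]
    _ ≤ 2 * Real.exp c := by gcongr

lemma exp_neg_div_exp_le {i κ M : ℝ} (hM : Real.exp (i + 2 * κ) ≤ M) :
    Real.exp (-(M / Real.exp (i + κ))) ≤ Real.exp (-κ) := by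
  refine Real.exp_le_exp.2 (neg_le_neg ((le_div_iff₀ (Real.exp_pos _)).2 ?_))
  calc κ * Real.exp (i + κ) ≤ Real.exp κ * Real.exp (i + κ) := by
        gcongr
        linarith [Real.add_one_le_exp κ]
    _ = Real.exp (i + 2 * κ) := by rw [← Real.exp_add]; ring_nf
    _ ≤ M := hM

section Exponents

variable {Z X Y : Type*} [Fintype Z] {p : Z → ℝ} {x : Z → X} {y : Z → Y}

lemma exists_isCoveringCode_exp {𝒰 : Type*} [Fintype 𝒰] [Finite Y] (hp : p ∈ stdSimplex ℝ Z)
    {V : X → 𝒰 → ℝ} (hV : ∀ a, V a ∈ stdSimplex ℝ 𝒰) (T : 𝒰 → X → Prop) (G : 𝒰 → Y → Prop)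
    {i j κ κ' t Γ : ℝ} (hi : 0 ≤ i) (hκ' : 0 ≤ κ') (hκ : κ' ≤ κ) (ht : Real.exp (-κ') ≤ t)
    (hΓ : 0 ≤ Γ)
    (hT : ∀ u ξ, T u ξ → 0 < outputMass p x V u ∧
      outputMass p x V u ≤ Real.exp (-(i - κ')) * V ξ u ∧
      V ξ u ≤ Real.exp (i + κ') * outputMass p x V u)
    (hG : ∀ u υ, G u υ → outputMass p x V u * law p y υ ≤ Real.exp (-(j - κ)) *
        law (kernelJoint p x V) (fun ω => (ω.1, y ω.2)) (u, υ) ∧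
      law (kernelJoint p x V) (fun ω => (ω.1, y ω.2)) (u, υ) ≤
        Real.exp (j + κ) * (outputMass p x V u * law p y υ))
    (hratio : ∀ u υ, law (kernelJoint p x V) (fun ω => (ω.1, y ω.2)) (u, υ) ≤
      Γ * (outputMass p x V u * law p y υ))
    (hprobT : prob (kernelJoint p x V) (fun ω => ¬ T ω.1 (x ω.2)) ≤ 2 * t)
    (hprobG : Real.exp (3 * κ') * prob (kernelJoint p x V) (fun ω => ¬ G ω.1 (y ω.2)) ≤ 2 * t) :
    ∃ (M : ℕ) (e : X → Option (Fin M)) (L : Fin M → Y → Prop),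
      Real.log (M + 1) ≤ Real.log 3 + (i + 2 * κ') ∧
      IsCoveringCode p x y e L (9 * t) (12 * t) (6 * Real.exp (i - j + 3 * κ))
        (Real.exp (-(i - κ'))) (Real.exp (j + κ)) Γ := by
  have ht0 : 0 < t := (Real.exp_pos _).trans_le ht
  have hexponent : 0 ≤ i + 2 * κ' := by positivity
  set M := ⌈Real.exp (i + 2 * κ')⌉₊
  have hcover : Real.exp (-(M / Real.exp (i + κ'))) ≤ t :=
    (exp_neg_div_exp_le (Nat.le_ceil _)).trans ht
  have hlist : M * Real.exp (-(j - κ)) ≤ 2 * Real.exp (i - j + 3 * κ) :=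
    natCeil_exp_mul_exp_le hexponent (by linarith)
  have hmiss : M * (Real.exp (-(i - κ')) *
      prob (kernelJoint p x V) (fun ω => ¬ G ω.1 (y ω.2))) ≤ 4 * t := by
    have hle : M * Real.exp (-(i - κ')) ≤ 2 * Real.exp (3 * κ') :=
      natCeil_exp_mul_exp_le hexponent (by linarith)
    have hnonneg := prob_nonneg (kernelJoint_mem_stdSimplex hp x hV).1 fun ω => ¬ G ω.1 (y ω.2)
    linarith [mul_le_mul_of_nonneg_right hle hnonneg]
  obtain ⟨e, L, h⟩ := exists_isCoveringCode hp x y hV T G (Real.exp_pos _).le (Real.exp_pos _)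
    (Real.exp_pos _).le (Real.exp_pos _).le hΓ hT hG hratio M (A := 3 * t)
    (B := 2 * Real.exp (i - j + 3 * κ)) (C := 4 * t) (by positivity) (by positivity)
    (by positivity) (by linarith) hlist hmiss
  refine ⟨M, e, L, log_natCeil_exp_add_one_le hexponent, ?_⟩
  convert h using 1 <;> ring

/- With slightly more than `exp (i - j)` bins, each holds about `exp j` of the `exp i` indices, few
enough to be told apart by the side information. -/
lemma IsCoveringCode.exists_code_exp [Fintype Y] {ι : Type*} [Fintype ι] {e : X → Option ι}
    {L : ι → Y → Prop} {i j κ κ' t Γ : ℝ}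
    (h : IsCoveringCode p x y e L (9 * t) (12 * t) (6 * Real.exp (i - j + 3 * κ))
      (Real.exp (-(i - κ'))) (Real.exp (j + κ)) Γ)
    (hp : p ∈ stdSimplex ℝ Z) (hκ' : 0 ≤ κ') (hκ : κ' ≤ κ) (hji : j ≤ i)
    (ht : Real.exp (-κ) ≤ t) (hΓ : 1 ≤ Γ) {s : ℕ} [NeZero s] (hs : Real.log s + 6 * κ ≤ j) :
    ∃ w : ℕ, w ≠ 0 ∧ ∃ (enc : X → Fin w × Fin s) (dec : Fin w × Y → Fin s),
      Real.log (w * s) - entropy p (fun z => enc (x z)) ≤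
        3 * (2 * t + 9 * t * (Real.log 2 + (i - j + 4 * κ) + Real.log s)) ∧
      prob p (fun z => (enc (x z)).2 ≠ dec ((enc (x z)).1, y z)) ≤ 39 * t ∧
      mutualInfo p y (fun z => (enc (x z)).1) ≤ 2 * Real.log 2 + 6 * κ + 9 * t * i +
        12 * t * Real.log Γ + 39 * t * Real.log (Fintype.card ι + 1) ∧
      Real.log w ≤ Real.log 2 + (i - j + 4 * κ) := by
  have ht0 : 0 < t := (Real.exp_pos _).trans_le ht
  have hκ0 : 0 ≤ κ := hκ'.trans hκ
  have hexponent : 0 ≤ i - j + 4 * κ := by linarith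
  set w := ⌈Real.exp (i - j + 4 * κ)⌉₊
  have hwexp : Real.exp (i - j + 4 * κ) ≤ w := Nat.le_ceil _
  have hw : (0 : ℝ) < w := (Real.exp_pos _).trans_le hwexp
  have hs0 : (0 : ℝ) < s := Nat.cast_pos.2 (NeZero.pos s)
  have : NeZero w := ⟨(Nat.cast_pos.1 hw).ne'⟩
  have hlogw : Real.log w ≤ Real.log 2 + (i - j + 4 * κ) := log_natCeil_exp_le hexponent
  have hlogs : 0 ≤ Real.log s := Real.log_natCast_nonneg s
  have hlist : 6 * Real.exp (i - j + 3 * κ) / w ≤ 6 * t := by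
    rw [div_le_iff₀ hw]
    calc 6 * Real.exp (i - j + 3 * κ) = 6 * Real.exp (-κ) * Real.exp (i - j + 4 * κ) := by
          rw [mul_assoc, ← Real.exp_add]; ring_nf
      _ ≤ 6 * t * w := by gcongr
  have hmass : (w * s : ℝ) * Real.exp (-(i - κ')) ≤ 2 * t := by
    rw [mul_assoc, ← Real.exp_log hs0, ← Real.exp_add]
    refine (natCeil_exp_mul_exp_le hexponent (c := -κ) ?_).trans (by linarith)
    linarith
  obtain ⟨enc, dec, hdeficit, herror, hleak⟩ := h.exists_code hp (Real.exp_pos _)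
    (Real.exp_le_one_iff.2 (by linarith)) (Real.one_le_exp (by linarith)) hΓ (by positivity)
    (w := w) (s := s) (D := 2 * t + 9 * t * (Real.log 2 + (i - j + 4 * κ) + Real.log s))
    (by positivity) (by rw [Real.log_mul hw.ne' hs0.ne']; gcongr)
  refine ⟨w, NeZero.ne w, enc, dec, hdeficit, by linarith, ?_, hlogw⟩
  rw [Real.log_exp, Real.log_exp] at hleak
  have hfano : (9 * t + 12 * t + 3 * (6 * Real.exp (i - j + 3 * κ) / w)) *
      Real.log (Fintype.card ι + 1) ≤ 39 * t * Real.log (Fintype.card ι + 1) := by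
    have : 0 ≤ Real.log (Fintype.card ι + 1 : ℝ) := by
      exact_mod_cast Real.log_natCast_nonneg (Fintype.card ι + 1)
    gcongr
    linarith
  linarith [mul_nonneg ht0.le hκ']

end Exponents

section BlockCode

open Filter Topology

variable {𝒵 ξ β 𝒰 : Type*} [Fintype 𝒵] [Fintype 𝒰] {P : 𝒵 → ℝ} {x : 𝒵 → ξ} {V : ξ → 𝒰 → ℝ}
  {n : ℕ}

lemma law_kernelJoint_pair_self (P : 𝒵 → ℝ) (x : 𝒵 → ξ) (V : ξ → 𝒰 → ℝ) (u : 𝒰) (a : ξ) :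
    law (kernelJoint P x V) (fun ω => (ω.1, x ω.2)) (u, a) = V a u * law P x a := by
  classical
  rw [law_kernelJoint_pair, law_apply, law_apply, Finset.mul_sum]
  refine Finset.sum_congr rfl fun z _ => ?_
  split_ifs with h
  · rw [h, mul_comm]
  · rw [mul_zero]

lemma law_prodMass_kernelJoint_snd (hV : ∀ a, V a ∈ stdSimplex ℝ 𝒰) (P : 𝒵 → ℝ) (x : 𝒵 → ξ)
    (y : 𝒵 → β) (n : ℕ) :
    law (prodMass (kernelJoint P x V) (Fin n)) (fun ω i => y (ω i).2) =
      law (prodMass P (Fin n)) fun z i => y (z i) := by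
  rw [← law_kernelJoint_snd (prodMass P (Fin n)) (fun z i => x (z i))
    (fun a => (prodKernel_mem_stdSimplex hV a).2) fun z i => y (z i)]
  exact (law_kernelJoint_prodMass P x V fun ω i => y (ω.2 i)).symm

lemma law_prodMass_kernelJoint_fst (P : 𝒵 → ℝ) (x : 𝒵 → ξ) (V : ξ → 𝒰 → ℝ) (n : ℕ) :
    law (prodMass (kernelJoint P x V) (Fin n)) (fun ω i => (ω i).1) =
      outputMass (prodMass P (Fin n)) (fun z i => x (z i)) (prodKernel V) :=
  (law_kernelJoint_prodMass P x V fun ω => ω.1).symm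

lemma IsJointlyTypical.prodKernel_bounds [Fintype ξ] (hP : ∀ z, 0 ≤ P z)
    (hV : ∀ a, V a ∈ stdSimplex ℝ 𝒰) {ε : ℝ} {u : Fin n → 𝒰} {a : Fin n → ξ}
    (h : IsJointlyTypical (kernelJoint P x V) (fun ω => ω.1) (fun ω => x ω.2) ε u a) :
    0 < outputMass (prodMass P (Fin n)) (fun z i => x (z i)) (prodKernel V) u ∧
      outputMass (prodMass P (Fin n)) (fun z i => x (z i)) (prodKernel V) u ≤
        Real.exp (-(n * kernelInfo P x V x - n * ε)) * prodKernel V a u ∧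
      prodKernel V a u ≤ Real.exp (n * kernelInfo P x V x + n * ε) *
        outputMass (prodMass P (Fin n)) (fun z i => x (z i)) (prodKernel V) u := by
  have hJ : ∀ ω, 0 ≤ kernelJoint P x V ω := fun ω => mul_nonneg (hP _) ((hV _).1 _)
  have hpos := h.law_mul_law_pos hJ
  have hupper := h.law_pair_le hJ
  have hlower := h.law_mul_law_le hJ
  rw [← law_kernelJoint_prodMass P x V fun ω => (ω.1, fun i => x (ω.2 i)),
    law_kernelJoint_pair_self _ _ (prodKernel V)] at hupper hlower
  have hsource := pos_of_mul_pos_right hpos (law_nonneg (prodMass_nonneg hJ) _ _)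
  rw [law_prodMass_kernelJoint_snd hV] at hpos hupper hlower hsource
  rw [law_prodMass_kernelJoint_fst] at hpos hupper hlower
  rw [← mul_assoc] at hupper hlower
  rw [← mul_sub, ← mul_add]
  exact ⟨pos_of_mul_pos_left hpos hsource.le, le_of_mul_le_mul_right hlower hsource,
    le_of_mul_le_mul_right hupper hsource⟩

lemma IsJointlyTypical.sideInfo_bounds [Fintype β] {y : 𝒵 → β} (hP : ∀ z, 0 ≤ P z)
    (hV : ∀ a, V a ∈ stdSimplex ℝ 𝒰) {ε : ℝ} {u : Fin n → 𝒰} {v : Fin n → β}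
    (h : IsJointlyTypical (kernelJoint P x V) (fun ω => ω.1) (fun ω => y ω.2) ε u v) :
    outputMass (prodMass P (Fin n)) (fun z i => x (z i)) (prodKernel V) u *
        law (prodMass P (Fin n)) (fun z i => y (z i)) v ≤
      Real.exp (-(n * kernelInfo P x V y - n * ε)) *
        law (kernelJoint (prodMass P (Fin n)) (fun z i => x (z i)) (prodKernel V))
          (fun ω => (ω.1, fun i => y (ω.2 i))) (u, v) ∧
    law (kernelJoint (prodMass P (Fin n)) (fun z i => x (z i)) (prodKernel V))
        (fun ω => (ω.1, fun i => y (ω.2 i))) (u, v) ≤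
      Real.exp (n * kernelInfo P x V y + n * ε) *
        (outputMass (prodMass P (Fin n)) (fun z i => x (z i)) (prodKernel V) u *
          law (prodMass P (Fin n)) (fun z i => y (z i)) v) := by
  have hJ : ∀ ω, 0 ≤ kernelJoint P x V ω := fun ω => mul_nonneg (hP _) ((hV _).1 _)
  rw [law_kernelJoint_prodMass P x V fun ω => (ω.1, fun i => y (ω.2 i)),
    ← law_prodMass_kernelJoint_snd hV, ← law_prodMass_kernelJoint_fst, ← mul_sub, ← mul_add]
  exact ⟨h.law_mul_law_le hJ, h.law_pair_le hJ⟩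

lemma exists_law_prodKernel_pair_le [Finite β] (hP : ∀ z, 0 ≤ P z) (x : 𝒵 → ξ) (y : 𝒵 → β)
    (hV : ∀ a, V a ∈ stdSimplex ℝ 𝒰) : ∃ C : ℝ, 1 ≤ C ∧ ∀ (n : ℕ) (u : Fin n → 𝒰) (v : Fin n → β),
      law (kernelJoint (prodMass P (Fin n)) (fun z i => x (z i)) (prodKernel V))
          (fun ω => (ω.1, fun i => y (ω.2 i))) (u, v) ≤
        C ^ n * (outputMass (prodMass P (Fin n)) (fun z i => x (z i)) (prodKernel V) u *
          law (prodMass P (Fin n)) (fun z i => y (z i)) v) := by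
  have hJ : ∀ ω, 0 ≤ kernelJoint P x V ω := fun ω => mul_nonneg (hP _) ((hV _).1 _)
  obtain ⟨C, hC, hle⟩ := exists_law_prodMass_pair_le hJ (fun ω => ω.1) fun ω => y ω.2
  refine ⟨C, hC, fun n u v => ?_⟩
  rw [law_kernelJoint_prodMass P x V fun ω => (ω.1, fun i => y (ω.2 i)),
    ← law_prodMass_kernelJoint_snd hV, ← law_prodMass_kernelJoint_fst]
  exact hle n u v

lemma exists_exp_mul_lt_one {ρ ε : ℝ} (hρ : ρ < 1) (hε : 0 < ε) :
    ∃ ε' : ℝ, 0 < ε' ∧ ε' ≤ ε ∧ Real.exp (3 * ε') * ρ < 1 := by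
  have hlim : Tendsto (fun t : ℝ => Real.exp (3 * t) * ρ) (𝓝[>] 0) (𝓝 ρ) := by
    have hcont : Continuous fun t : ℝ => Real.exp (3 * t) * ρ := by fun_prop
    simpa using (hcont.tendsto 0).mono_left nhdsWithin_le_nhds
  obtain ⟨ε', hlt, hε'⟩ := ((hlim.eventually_lt_const hρ).and (Ioc_mem_nhdsGT hε)).exists
  exact ⟨ε', hε'.1, hε'.2, hlt⟩

lemma exp_neg_natCast_mul_le_pow {ε θ : ℝ} (h : Real.exp (-ε) ≤ θ) (n : ℕ) :
    Real.exp (-(n * ε)) ≤ θ ^ n := by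
  rw [← mul_neg, Real.exp_nat_mul]
  exact pow_le_pow_left₀ (Real.exp_pos _).le h n

/- The slack `ε'` of the covering step is small compared with the exponent `-log ρ` of the
probability that the side information is atypical, so that a union bound over the codebook leaves a
vanishing probability. -/
lemma exists_prob_not_isJointlyTypical_le_pow [Fintype ξ] [Fintype β] (hP : P ∈ stdSimplex ℝ 𝒵)
    (x : 𝒵 → ξ) (y : 𝒵 → β) (hV : ∀ a, V a ∈ stdSimplex ℝ 𝒰) {ε : ℝ} (hε : 0 < ε) :
    ∃ ε' θ : ℝ, 0 < ε' ∧ ε' ≤ ε ∧ Real.exp (-ε') ≤ θ ∧ θ < 1 ∧ ∀ n : ℕ,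
      prob (prodMass (kernelJoint P x V) (Fin n)) (fun ω => ¬ IsJointlyTypical (kernelJoint P x V)
        (fun ω => ω.1) (fun ω => x ω.2) ε' (fun i => (ω i).1) fun i => x (ω i).2) ≤ 2 * θ ^ n ∧
      Real.exp (3 * (n * ε')) * prob (prodMass (kernelJoint P x V) (Fin n)) (fun ω =>
        ¬ IsJointlyTypical (kernelJoint P x V) (fun ω => ω.1) (fun ω => y ω.2) ε
          (fun i => (ω i).1) fun i => y (ω i).2) ≤ 2 * θ ^ n := by
  have hJ := kernelJoint_mem_stdSimplex hP x hV
  obtain ⟨ρ, hρ0, hρ1, hprobY⟩ :=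
    exists_prob_not_isJointlyTypical_le hJ (fun ω => ω.1) (fun ω => y ω.2) hε
  obtain ⟨ε', hε'0, hε'ε, hσ⟩ := exists_exp_mul_lt_one hρ1 hε
  obtain ⟨σ, hσ0, hσ1, hprobX⟩ :=
    exists_prob_not_isJointlyTypical_le hJ (fun ω => ω.1) (fun ω => x ω.2) hε'0
  have hexp : Real.exp (-ε') < 1 := Real.exp_lt_one_iff.2 (neg_lt_zero.2 hε'0)
  refine ⟨ε', max (Real.exp (-ε')) (max σ (Real.exp (3 * ε') * ρ)), hε'0, hε'ε,
    le_max_left _ _, max_lt hexp (max_lt hσ1 hσ), fun n => ⟨(hprobX n).trans ?_, ?_⟩⟩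
  · gcongr
    exact (le_max_left _ _).trans (le_max_right _ _)
  · calc Real.exp (3 * (n * ε')) * _ ≤ Real.exp (3 * (n * ε')) * (2 * ρ ^ n) := by
          gcongr
          exact hprobY n
      _ = 2 * (Real.exp (3 * ε') * ρ) ^ n := by
          rw [mul_pow, ← Real.exp_nat_mul, mul_left_comm 3, mul_left_comm]
      _ ≤ _ := by
          gcongr
          exact (le_max_right _ _).trans (le_max_right _ _)

lemma exists_isCoveringCode_prodMass [Fintype ξ] [Fintype β] (hP : P ∈ stdSimplex ℝ 𝒵) (x : 𝒵 → ξ)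
    (y : 𝒵 → β) (hV : ∀ a, V a ∈ stdSimplex ℝ 𝒰) {ε : ℝ} (hε : 0 < ε) :
    ∃ ε' θ C : ℝ, 0 < ε' ∧ ε' ≤ ε ∧ Real.exp (-ε') ≤ θ ∧ θ < 1 ∧ 1 ≤ C ∧
      ∀ n : ℕ, ∃ (M : ℕ) (e : (Fin n → ξ) → Option (Fin M)) (L : Fin M → (Fin n → β) → Prop),
        Real.log (M + 1) ≤ Real.log 3 + (n * kernelInfo P x V x + 2 * (n * ε')) ∧
        IsCoveringCode (prodMass P (Fin n)) (fun z i => x (z i)) (fun z i => y (z i)) e L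
          (9 * θ ^ n) (12 * θ ^ n)
          (6 * Real.exp (n * kernelInfo P x V x - n * kernelInfo P x V y + 3 * (n * ε)))
          (Real.exp (-(n * kernelInfo P x V x - n * ε')))
          (Real.exp (n * kernelInfo P x V y + n * ε)) (C ^ n) := by
  have hJ := kernelJoint_mem_stdSimplex hP x hV
  obtain ⟨ε', θ, hε'0, hε'ε, hexp, hθ1, hprob⟩ :=
    exists_prob_not_isJointlyTypical_le_pow hP x y hV hε
  obtain ⟨C, hC, hratio⟩ := exists_law_prodKernel_pair_le hP.1 x y hV
  refine ⟨ε', θ, C, hε'0, hε'ε, hexp, hθ1, hC, fun n => ?_⟩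
  refine exists_isCoveringCode_exp (prodMass_mem_stdSimplex hP _) (prodKernel_mem_stdSimplex hV)
    (IsJointlyTypical (kernelJoint P x V) (fun ω => ω.1) (fun ω => x ω.2) ε')
    (IsJointlyTypical (kernelJoint P x V) (fun ω => ω.1) (fun ω => y ω.2) ε)
    (mul_nonneg n.cast_nonneg (mutualInfo_nonneg hJ _ _)) (by positivity) (by gcongr)
    (exp_neg_natCast_mul_le_pow hexp n) (by positivity) (fun u a h => h.prodKernel_bounds hP.1 hV)
    (fun u v h => h.sideInfo_bounds hP.1 hV) (hratio n) ?_ ?_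
  · rw [prob_kernelJoint_prodMass P x V]
    exact (hprob n).1
  · rw [prob_kernelJoint_prodMass P x V]
    exact (hprob n).2

lemma eventually_add_natCast_mul_mul_pow_le {θ : ℝ} (h0 : 0 ≤ θ) (h1 : θ < 1) (c d : ℝ) {δ : ℝ}
    (hδ : 0 < δ) : ∀ᶠ n : ℕ in atTop, (c + n * d) * θ ^ n ≤ δ := by
  have hlim : Tendsto (fun n : ℕ => (c + n * d) * θ ^ n) atTop (𝓝 0) := by
    have h := ((tendsto_pow_atTop_nhds_zero_of_lt_one h0 h1).const_mul c).add
      ((tendsto_self_mul_const_pow_of_lt_one h0 h1).const_mul d)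
    rw [mul_zero, mul_zero, add_zero] at h
    exact h.congr fun n => by ring
  exact hlim.eventually_le_const hδ

lemma exists_pos_add_mul_le {r j δ : ℝ} (hr : r < j) (hδ : 0 < δ) :
    ∃ ε : ℝ, 0 < ε ∧ r + 6 * ε ≤ j ∧ 12 * ε ≤ δ :=
  ⟨min ((j - r) / 6) (δ / 12), lt_min (by linarith) (by linarith),
    by linarith [min_le_left ((j - r) / 6) (δ / 12)],
    by linarith [min_le_right ((j - r) / 6) (δ / 12)]⟩

lemma exists_block_code [Fintype ξ] [Fintype β] (hP : P ∈ stdSimplex ℝ 𝒵) (x : 𝒵 → ξ) (y : 𝒵 → β)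
    (hV : ∀ a, V a ∈ stdSimplex ℝ 𝒰) {r δ : ℝ} (hr : r < kernelInfo P x V y) (hδ : 0 < δ) :
    ∀ᶠ n : ℕ in atTop, ∀ s : ℕ, s ≠ 0 → Real.log s = n * r → ∃ w : ℕ, w ≠ 0 ∧
      ∃ (enc : (Fin n → ξ) → Fin w × Fin s) (dec : Fin w × (Fin n → β) → Fin s),
        Real.log (w * s) - entropy (prodMass P (Fin n)) (fun z => enc fun i => x (z i)) ≤ δ ∧
        prob (prodMass P (Fin n)) (fun z => (enc fun i => x (z i)).2 ≠
          dec ((enc fun i => x (z i)).1, fun i => y (z i))) ≤ δ ∧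
        mutualInfo (prodMass P (Fin n)) (fun z i => y (z i)) (fun z => (enc fun i => x (z i)).1) ≤
          n * δ ∧
        Real.log w ≤ n * (kernelInfo P x V x - kernelInfo P x V y + δ) := by
  have hxy := kernelInfo_le_kernelInfo_self hP x y hV
  obtain ⟨ε, hε, hεr, hεδ⟩ := exists_pos_add_mul_le hr hδ
  obtain ⟨ε', θ, C, hε'0, hε'ε, hθ, hθ1, hC, hcover⟩ :=
    exists_isCoveringCode_prodMass hP x y hV hε
  set i := kernelInfo P x V x
  set j := kernelInfo P x V y
  have hθ0 : 0 ≤ θ := (Real.exp_pos _).le.trans hθ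
  have hlarge : ∀ᶠ n : ℕ in atTop, 2 * Real.log 2 + δ ≤ n * (δ / 2) :=
    (tendsto_natCast_atTop_atTop.atTop_mul_const (half_pos hδ)).eventually_ge_atTop _
  filter_upwards [hlarge,
    eventually_add_natCast_mul_mul_pow_le hθ0 hθ1 (6 + 27 * Real.log 2)
      (27 * (i - j + 4 * ε + r)) hδ,
    eventually_add_natCast_mul_mul_pow_le hθ0 hθ1 39 0 hδ,
    eventually_add_natCast_mul_mul_pow_le hθ0 hθ1 (39 * Real.log 3)
      (9 * i + 12 * Real.log C + 39 * (i + 2 * ε')) hδ] with n hn hn₁ hn₂ hn₃ s hs hlogs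
  have : NeZero s := ⟨hs⟩
  obtain ⟨M, e, L, hM, hcode⟩ := hcover n
  obtain ⟨w, hw, enc, dec, hdeficit, herror, hleak, hlogw⟩ := hcode.exists_code_exp
    (prodMass_mem_stdSimplex hP _) (by positivity) (by gcongr) (by gcongr)
    (exp_neg_natCast_mul_le_pow ((Real.exp_le_exp.2 (neg_le_neg hε'ε)).trans hθ) n)
    (one_le_pow₀ hC) (s := s) (by
      rw [hlogs]
      linarith [mul_le_mul_of_nonneg_left hεr n.cast_nonneg])
  have hnε : n * (12 * ε) ≤ n * δ := by gcongr
  refine ⟨w, hw, enc, dec, ?_, by linarith, ?_, by linarith [Real.log_pos one_lt_two]⟩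
  · rw [hlogs] at hdeficit
    linarith
  · rw [Real.log_pow, Fintype.card_fin] at hleak
    have := mul_le_mul_of_nonneg_left hM (by positivity : 0 ≤ 39 * θ ^ n)
    linarith

end BlockCode

section OneTimePadCode

variable {Z A B α : Type*} {w s : ℕ} [NeZero s]

/-- Encoder of the chosen-secret model obtained from an encoder of the generated-secret model: the
generated key masks the chosen key `v.2`, and the masked key is stored with the helper data. -/
def padEnc (enc : A → Fin w × Fin s) (v : A × Fin s) : Fin (w * s) :=
  finProdFinEquiv ((enc v.1).1, (enc v.1).2 + v.2)

/-- Decoder belonging to `padEnc`: the mask is reconstructed by `dec` and removed. -/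
def padDec (dec : Fin w × B → Fin s) (v : Fin (w * s) × B) : Fin s :=
  (finProdFinEquiv.symm v.1).2 - dec ((finProdFinEquiv.symm v.1).1, v.2)

lemma key_eq_padDec_iff (enc : A → Fin w × Fin s) (dec : Fin w × B → Fin s) (a : A) (b : B)
    (k : Fin s) : k = padDec dec (padEnc enc (a, k), b) ↔ (enc a).2 = dec ((enc a).1, b) := by
  rw [padDec, padEnc, Equiv.symm_apply_apply, eq_sub_iff_add_eq, add_comm, add_left_inj, eq_comm]

variable [Fintype Z]

lemma prob_key_ne_padDec (P : Z → ℝ) (x : Z → A) (y : Z → B) (enc : A → Fin w × Fin s)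
    (dec : Fin w × B → Fin s) :
    prob (fun ω : Z × Fin s => P ω.1 * (1 / (s : ℝ)))
        (fun ω => ω.2 ≠ padDec dec (padEnc enc (x ω.1, ω.2), y ω.1)) =
      prob P (fun z => (enc (x z)).2 ≠ dec ((enc (x z)).1, y z)) := by
  rw [← prob_mul_fst P (uniform_mem_stdSimplex (s := s)).2]
  exact prob_congr _ fun ω => (key_eq_padDec_iff enc dec _ _ _).not

variable {P : Z → ℝ}

lemma entropy_key (hP : ∑ z, P z = 1) :
    entropy (fun ω : Z × Fin s => P ω.1 * (1 / (s : ℝ))) (fun ω => ω.2) = Real.log s := by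
  rw [← entropy_uniform (s := s), entropy, entropy,
    law_mul_snd hP (fun _ => 1 / (s : ℝ)) fun k => k]

lemma entropy_padEnc (hP : P ∈ stdSimplex ℝ Z) (x : Z → A) (enc : A → Fin w × Fin s) :
    entropy (fun ω : Z × Fin s => P ω.1 * (1 / (s : ℝ))) (fun ω => padEnc enc (x ω.1, ω.2)) =
      entropy P (fun z => (enc (x z)).1) + Real.log s := by
  rw [← entropy_pair_add_uniform hP _ fun z => (enc (x z)).2]
  exact entropy_congr _ fun ω ω' => finProdFinEquiv.apply_eq_iff_eq

lemma entropy_pair_padEnc [Fintype α] (hP : P ∈ stdSimplex ℝ Z) (f : Z → α) (x : Z → A)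
    (enc : A → Fin w × Fin s) :
    entropy (fun ω : Z × Fin s => P ω.1 * (1 / (s : ℝ)))
        (fun ω => (f ω.1, padEnc enc (x ω.1, ω.2))) =
      entropy P (fun z => (f z, (enc (x z)).1)) + Real.log s := by
  rw [← entropy_pair_add_uniform hP _ fun z => (enc (x z)).2]
  refine entropy_congr _ fun ω ω' => ?_
  simp only [padEnc, Prod.mk.injEq, finProdFinEquiv.apply_eq_iff_eq, and_assoc]

lemma entropy_key_pair_padEnc (hP : P ∈ stdSimplex ℝ Z) (x : Z → A) (enc : A → Fin w × Fin s) :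
    entropy (fun ω : Z × Fin s => P ω.1 * (1 / (s : ℝ)))
        (fun ω => (ω.2, padEnc enc (x ω.1, ω.2))) =
      entropy P (fun z => enc (x z)) + Real.log s := by
  rw [← entropy_uniform (s := s), ← entropy_mul_pair hP uniform_mem_stdSimplex]
  refine entropy_congr _ fun ω ω' => ?_
  simp only [padEnc, Prod.ext_iff, finProdFinEquiv.apply_eq_iff_eq]
  constructor
  · rintro ⟨hkey, hhelper, hmask⟩
    exact ⟨⟨hhelper, add_right_cancel (hkey ▸ hmask)⟩, hkey⟩
  · rintro ⟨⟨hhelper, hmask⟩, hkey⟩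
    exact ⟨hkey, hhelper, by rw [hmask, hkey]⟩

lemma mutualInfo_padEnc [Fintype α] (hP : P ∈ stdSimplex ℝ Z) (f : Z → α) (x : Z → A)
    (enc : A → Fin w × Fin s) :
    mutualInfo (fun ω : Z × Fin s => P ω.1 * (1 / (s : ℝ))) (fun ω => f ω.1)
        (fun ω => padEnc enc (x ω.1, ω.2)) = mutualInfo P f (fun z => (enc (x z)).1) := by
  have hf : entropy (fun ω : Z × Fin s => P ω.1 * (1 / (s : ℝ))) (fun ω => f ω.1) =
      entropy P f := by
    rw [entropy, entropy, law_mul_fst P uniform_mem_stdSimplex.2 f]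
  rw [mutualInfo, mutualInfo, hf, entropy_padEnc hP, entropy_pair_padEnc hP]
  ring

lemma mutualInfo_key_padEnc_le [NeZero w] (hP : P ∈ stdSimplex ℝ Z) (x : Z → A)
    (enc : A → Fin w × Fin s) :
    mutualInfo (fun ω : Z × Fin s => P ω.1 * (1 / (s : ℝ))) (fun ω => ω.2)
        (fun ω => padEnc enc (x ω.1, ω.2)) ≤
      Real.log (w * s) - entropy P (fun z => enc (x z)) := by
  have hhelper := entropy_le_log_card hP fun z => (enc (x z)).1
  rw [Fintype.card_fin] at hhelper
  rw [mutualInfo, entropy_key hP.2, entropy_padEnc hP, entropy_key_pair_padEnc hP,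
    Real.log_mul (Nat.cast_ne_zero.2 (NeZero.ne w)) (Nat.cast_ne_zero.2 (NeZero.ne s))]
  linarith

end OneTimePadCode

section Achievability

variable {𝒳 𝒳t 𝒴 : Type*} [Fintype 𝒳] [Fintype 𝒳t] [Fintype 𝒴] {P : 𝒳 × 𝒳t × 𝒴 → ℝ}

/-- The code `(enc, dec)` for the generated-secret model has error probability at most `δ`, leakage
rate at most `δ` and storage rate at most `ρ + δ`. The field `deficit`, by which `(W, S)` is almost
uniform, expresses secrecy and uniformity of the key at once. -/
structure IsGoodCode (P : 𝒳 × 𝒳t × 𝒴 → ℝ) {n s w : ℕ}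
    (enc : (Fin n → 𝒳t) → Fin w × Fin s) (dec : Fin w × (Fin n → 𝒴) → Fin s) (ρ δ : ℝ) :
    Prop where
  deficit : Real.log (w * s) - entropy (iid P n) (fun ω => enc (seqXt ω)) ≤ δ
  error : prob (iid P n) (fun ω => (enc (seqXt ω)).2 ≠ dec ((enc (seqXt ω)).1, seqY ω)) ≤ δ
  leakage : mutualInfo (iid P n) seqX (fun ω => (enc (seqXt ω)).1) ≤ n * δ
  storage : Real.log w ≤ n * (ρ + δ)

lemma log_two_pow_num_mul {q : ℚ} (hq : 0 ≤ q) (m : ℕ) :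
    Real.log ((2 ^ (q.num.toNat * m) : ℕ) : ℝ) = ((q.den * m : ℕ) : ℝ) * (q * Real.log 2) := by
  have hnum : (q.num.toNat : ℝ) = q * q.den := by
    have hcast : ((q.num.toNat : ℤ) : ℚ) = q * q.den := by
      rw [Int.toNat_of_nonneg (Rat.num_nonneg.2 hq), Rat.mul_den_eq_num]
    exact_mod_cast congrArg (Rat.cast : ℚ → ℝ) hcast
  rw [Nat.cast_pow, Real.log_pow, Nat.cast_mul, Nat.cast_mul, hnum, Nat.cast_ofNat]
  ring

/- `W` is a function of `X̃ⁿ`, so degradedness gives `I(Xⁿ; W) ≤ I(Yⁿ; W)`. -/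
lemma exists_isGoodCode (hP : P ∈ stdSimplex ℝ (𝒳 × 𝒳t × 𝒴))
    (hM : IsMarkovChain P (fun ω => ω.2.1) (fun ω => ω.2.2) (fun ω => ω.1)) {k : ℕ}
    {V : 𝒳t → Fin k → ℝ} (hV : ∀ x, V x ∈ stdSimplex ℝ (Fin k)) {q : ℚ} (hq0 : 0 ≤ q)
    (hq : q * Real.log 2 < infoUY P V) {δ : ℝ} (hδ : 0 < δ) :
    ∃ n s w : ℕ, n ≠ 0 ∧ s ≠ 0 ∧ w ≠ 0 ∧ Real.log s = n * (q * Real.log 2) ∧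
      ∃ (enc : (Fin n → 𝒳t) → Fin w × Fin s) (dec : Fin w × (Fin n → 𝒴) → Fin s),
        IsGoodCode P enc dec (infoUXt P V - infoUY P V) δ := by
  obtain ⟨N, hN⟩ := Filter.eventually_atTop.1
    (exists_block_code hP (fun z => z.2.1) (fun z => z.2.2) hV hq hδ)
  have hn : N ≤ q.den * (N + 1) := N.le_succ.trans (Nat.le_mul_of_pos_left _ q.den_pos)
  have hlog := log_two_pow_num_mul hq0 (N + 1)
  have hs : 2 ^ (q.num.toNat * (N + 1)) ≠ 0 := by positivity
  obtain ⟨w, hw, enc, dec, hdeficit, herror, hleak, hstore⟩ := hN _ hn _ hs hlog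
  refine ⟨_, _, w, by positivity, hs, hw, hlog, enc, dec, hdeficit, herror, ?_, hstore⟩
  refine le_trans ?_ hleak
  rw [mutualInfo_comm, mutualInfo_comm (prodMass P _)]
  exact ((hM.prodMass_seq _).comp_left fun a => (enc a).1).mutualInfo_le
    (prodMass_mem_stdSimplex hP _)

section Feasible

variable {n s w : ℕ} {enc : (Fin n → 𝒳t) → Fin w × Fin s} {dec : Fin w × (Fin n → 𝒴) → Fin s}
  {ρ δ : ℝ} {R : ℝ × ℝ × ℝ}

lemma IsGoodCode.gsFeasible (H : IsGoodCode P enc dec ρ δ) (hP : P ∈ stdSimplex ℝ (𝒳 × 𝒳t × 𝒴))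
    (hn : n ≠ 0) (hs : s ≠ 0) (hw : w ≠ 0) (hδ : 0 ≤ δ) (hkey : Real.log s = n * R.1)
    (hleak : 0 ≤ R.2.1) (hstore : ρ ≤ R.2.2) : GSFeasible P enc dec R δ := by
  have : NeZero s := ⟨hs⟩
  have : NeZero w := ⟨hw⟩
  have hp := iid_mem_stdSimplex hP n
  have hn0 : (0 : ℝ) < n := Nat.cast_pos.2 (Nat.pos_of_ne_zero hn)
  have hδn : δ ≤ n * δ := le_mul_of_one_le_left hδ (Nat.one_le_cast.2 (Nat.pos_of_ne_zero hn))
  have hS := entropy_le_log_card hp fun ω => (enc (seqXt ω)).2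
  have hW := entropy_le_log_card hp fun ω => (enc (seqXt ω)).1
  have hSW := mutualInfo_nonneg hp (fun ω => (enc (seqXt ω)).2) (fun ω => (enc (seqXt ω)).1)
  have hpair : entropy (iid P n) (fun ω => ((enc (seqXt ω)).2, (enc (seqXt ω)).1)) =
      entropy (iid P n) (fun ω => enc (seqXt ω)) :=
    entropy_congr _ fun ω ω' => by rw [Prod.mk.injEq, and_comm, Prod.ext_iff]
  have hdeficit := H.deficit
  rw [Real.log_mul (Nat.cast_ne_zero.2 hw) (Nat.cast_ne_zero.2 hs)] at hdeficit
  rw [Fintype.card_fin] at hS hW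
  rw [mutualInfo, hpair] at hSW
  refine ⟨eq_div_of_mul_eq hn0.ne' (by rw [hkey, mul_comm]), H.error, ?_, ?_, ?_, ?_⟩
  · rw [mutualInfo, hpair]
    linarith
  · rw [one_div, inv_mul_le_iff₀ hn0]
    exact H.leakage.trans (by gcongr; linarith)
  · rw [ge_iff_le, one_div, le_inv_mul_iff₀ hn0, mul_sub, ← hkey]
    linarith
  · rw [one_div, inv_mul_le_iff₀ hn0]
    exact H.storage.trans (by gcongr)

lemma IsGoodCode.csFeasible [NeZero s] (H : IsGoodCode P enc dec ρ δ)
    (hP : P ∈ stdSimplex ℝ (𝒳 × 𝒳t × 𝒴)) (hn : n ≠ 0) (hw : w ≠ 0) (hδ : 0 ≤ δ)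
    (hkey : Real.log s = n * R.1) (hleak : 0 ≤ R.2.1) (hstore : ρ + R.1 ≤ R.2.2) :
    CSFeasible P (fun _ => 1 / (s : ℝ)) (padEnc enc) (padDec dec) R δ := by
  have : NeZero w := ⟨hw⟩
  have hp := iid_mem_stdSimplex hP n
  have hn0 : (0 : ℝ) < n := Nat.cast_pos.2 (Nat.pos_of_ne_zero hn)
  refine ⟨eq_div_of_mul_eq hn0.ne' (by rw [hkey, mul_comm]), ?_, ?_, ?_, ?_, ?_⟩
  · exact (prob_key_ne_padDec _ seqXt seqY enc dec).trans_le H.error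
  · exact (mutualInfo_key_padEnc_le hp seqXt enc).trans H.deficit
  · rw [mutualInfo_padEnc hp, one_div, inv_mul_le_iff₀ hn0]
    exact H.leakage.trans (by gcongr; linarith)
  · rw [entropy_key hp.2, ge_iff_le, one_div, le_inv_mul_iff₀ hn0, hkey]
    gcongr
    linarith
  · rw [one_div, inv_mul_le_iff₀ hn0, Nat.cast_mul,
      Real.log_mul (Nat.cast_ne_zero.2 hw) (Nat.cast_ne_zero.2 (NeZero.ne s)), hkey]
    calc Real.log w + n * R.1 ≤ n * (ρ + δ) + n * R.1 := by gcongr; exact H.storage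
      _ = n * (ρ + R.1 + δ) := by ring
      _ ≤ n * (R.2.2 + δ) := by gcongr

end Feasible

lemma meetsConstraints_of_fin_one {Ω : Type*} [Fintype Ω] {p : Ω → ℝ} (hp : ∑ ω, p ω = 1)
    {n : ℕ} (S S' W : Ω → Fin 1) (Xn : Ω → (Fin n → 𝒳)) {R : ℝ × ℝ × ℝ} (hR₁ : R.1 = 0)
    (hR₂ : 0 ≤ R.2.1) (hR₃ : 0 ≤ R.2.2) {δ : ℝ} (hδ : 0 ≤ δ) :
    MeetsConstraints p S S' W Xn R δ := by
  have herror : prob p (fun ω => S ω ≠ S' ω) = 0 := by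
    simp [prob, Subsingleton.elim S S']
  have hS : entropy p S = 0 := by
    rw [Subsingleton.elim S fun _ => 0, entropy_const hp]
  refine ⟨?_, ?_, ?_, ?_, ?_, ?_⟩
  · rw [hR₁, Nat.cast_one, Real.log_one, zero_div]
  · rwa [herror]
  · rwa [mutualInfo_of_subsingleton hp]
  · rw [mutualInfo_of_subsingleton hp, mul_zero]
    positivity
  · rw [hS, hR₁]
    linarith
  · rw [Nat.cast_one, Real.log_one, mul_zero]
    positivity

/- Key rates that are rational multiples of `log 2` are dense, and they are exactly attained by
alphabets of size `2 ^ m`. -/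
lemma mem_closure_of_forall_rat {A : Set (ℝ × ℝ × ℝ)} {R : ℝ × ℝ × ℝ} (hR : 0 < R.1)
    (h : ∀ q : ℚ, 0 ≤ q → q * Real.log 2 < R.1 → ((q * Real.log 2, R.2) : ℝ × ℝ × ℝ) ∈ A) :
    R ∈ closure A := by
  have hlog2 : 0 < Real.log 2 := Real.log_pos one_lt_two
  refine Metric.mem_closure_iff.2 fun ε hε => ?_
  obtain ⟨q, hq1, hq2⟩ := exists_rat_btwn (show max 0 (R.1 - ε) / Real.log 2 < R.1 / Real.log 2 from
    div_lt_div_of_pos_right (max_lt hR (by linarith)) hlog2)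
  have hq0 : (0 : ℝ) < q := (by positivity : (0 : ℝ) ≤ _).trans_lt hq1
  rw [div_lt_iff₀ hlog2] at hq1
  rw [lt_div_iff₀ hlog2] at hq2
  refine ⟨_, h q (Rat.cast_pos.1 hq0).le hq2, ?_⟩
  have hclose := (le_max_right 0 (R.1 - ε)).trans_lt hq1
  rw [Prod.dist_eq, dist_self, max_eq_left dist_nonneg, Real.dist_eq, abs_lt]
  constructor <;> linarith

lemma infoUY_le_infoUXt (hP : P ∈ stdSimplex ℝ (𝒳 × 𝒳t × 𝒴)) {k : ℕ} {V : 𝒳t → Fin k → ℝ}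
    (hV : ∀ x, V x ∈ stdSimplex ℝ (Fin k)) : infoUY P V ≤ infoUXt P V := by
  rw [infoUY_eq, infoUXt_eq]
  exact kernelInfo_le_kernelInfo_self hP (fun z => z.2.1) (fun z => z.2.2) hV

lemma testRegion_one_subset_gsRegion (hP : P ∈ stdSimplex ℝ (𝒳 × 𝒳t × 𝒴))
    (hM : IsMarkovChain P (fun ω => ω.2.1) (fun ω => ω.2.2) (fun ω => ω.1)) (k : ℕ) :
    testRegion P 1 k ⊆ gsRegion P := by
  rintro R ⟨V, hV, h0, hkey, hleak, hstore⟩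
  rw [one_mul] at hstore
  rcases h0.eq_or_lt with hR | hR
  · refine subset_closure fun δ hδ => ⟨1, 1, 1, le_rfl, fun _ => (0, 0), fun _ => 0, ?_⟩
    exact meetsConstraints_of_fin_one (iid_mem_stdSimplex hP 1).2 _ _ _ _ hR.symm hleak
      (by linarith [infoUY_le_infoUXt hP hV]) hδ.le
  · refine mem_closure_of_forall_rat hR fun q hq0 hq δ hδ => ?_
    obtain ⟨n, s, w, hn, hs, hw, hlog, enc, dec, hgood⟩ :=
      exists_isGoodCode hP hM hV hq0 (hq.trans_le hkey) hδ
    exact ⟨n, s, w, Nat.one_le_iff_ne_zero.2 hn, enc, dec,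
      hgood.gsFeasible hP hn hs hw hδ.le hlog hleak hstore⟩

lemma testRegion_zero_subset_csUniformRegion (hP : P ∈ stdSimplex ℝ (𝒳 × 𝒳t × 𝒴))
    (hM : IsMarkovChain P (fun ω => ω.2.1) (fun ω => ω.2.2) (fun ω => ω.1)) (k : ℕ) :
    testRegion P 0 k ⊆ csUniformRegion P := by
  rintro R ⟨V, hV, h0, hkey, hleak, hstore⟩
  rw [zero_mul, sub_zero] at hstore
  rcases h0.eq_or_lt with hR | hR
  · refine subset_closure fun δ hδ => ⟨1, 1, 1, le_rfl, le_rfl, fun _ => 0, fun _ => 0, ?_⟩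
    exact meetsConstraints_of_fin_one
      (mul_mem_stdSimplex (iid_mem_stdSimplex hP 1) (uniform_mem_stdSimplex (s := 1))).2 _ _ _ _
      hR.symm hleak (by linarith [infoUY_le_infoUXt hP hV]) hδ.le
  · refine mem_closure_of_forall_rat hR fun q hq0 hq δ hδ => ?_
    obtain ⟨n, s, w, hn, hs, hw, hlog, enc, dec, hgood⟩ :=
      exists_isGoodCode hP hM hV hq0 (hq.trans_le hkey) hδ
    have : NeZero s := ⟨hs⟩
    exact ⟨n, s, w * s, Nat.one_le_iff_ne_zero.2 hn, Nat.one_le_iff_ne_zero.2 hs, _, _,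
      hgood.csFeasible hP hn hw hδ.le hlog hleak (by dsimp only; linarith)⟩

lemma CSUniformAchievable.csAchievable {R : ℝ × ℝ × ℝ} (H : CSUniformAchievable P R) :
    CSAchievable P R := by
  intro δ hδ
  obtain ⟨n, s, w, hn, hs, enc, dec, h⟩ := H δ hδ
  have : NeZero s := ⟨Nat.one_le_iff_ne_zero.1 hs⟩
  exact ⟨n, s, w, hn, _, uniform_mem_stdSimplex, enc, dec, h⟩

lemma iUnion_testRegion (P : 𝒳 × 𝒳t × 𝒴 → ℝ) (c : ℝ) :
    ⋃ k, testRegion P c k = testRegion P c (Fintype.card 𝒳t + 1) :=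
  (Set.iUnion_subset fun k => testRegion_subset_card_add_one P c k).antisymm
    (Set.subset_iUnion (testRegion P c) _)

end Achievability

end KeyAgreement

theorem theorem2 {𝒳 𝒳t 𝒴 : Type*} [Fintype 𝒳] [Fintype 𝒳t] [Fintype 𝒴]
    (P : 𝒳 × 𝒳t × 𝒴 → ℝ) (hP : P ∈ stdSimplex ℝ (𝒳 × 𝒳t × 𝒴))
    (hMarkov : KeyAgreement.IsMarkovChain P
      (fun ω => ω.2.1) (fun ω => ω.2.2) (fun ω => ω.1)) :
    KeyAgreement.gsRegion P = KeyAgreement.regionR2 P ∧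
    KeyAgreement.csRegion P = KeyAgreement.regionR4 P ∧
    KeyAgreement.csUniformRegion P = KeyAgreement.regionR4 P ∧
    KeyAgreement.regionR2 P =
      KeyAgreement.regionR2Card P (Fintype.card 𝒳t + 1) ∧
    KeyAgreement.regionR4 P =
      KeyAgreement.regionR4Card P (Fintype.card 𝒳t + 1) := by
  open KeyAgreement in
  have h2 : regionR2 P = testRegion P 1 (Fintype.card 𝒳t + 1) := by
    simp only [regionR2, regionR2Card_eq_testRegion hP hMarkov, iUnion_testRegion]
  have h4 : regionR4 P = testRegion P 0 (Fintype.card 𝒳t + 1) := by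
    simp only [regionR4, regionR4Card_eq_testRegion hP hMarkov, iUnion_testRegion]
  have hgs : gsRegion P ⊆ testRegion P 1 (Fintype.card 𝒳t + 1) :=
    closure_minimal (fun R hR => GSAchievable.mem_testRegion hP hR) (isClosed_testRegion P 1 _)
  have hcs : csRegion P ⊆ testRegion P 0 (Fintype.card 𝒳t + 1) :=
    closure_minimal (fun R hR => CSAchievable.mem_testRegion hP hR) (isClosed_testRegion P 0 _)
  have hcsu : csUniformRegion P ⊆ csRegion P :=
    closure_mono fun R hR => CSUniformAchievable.csAchievable hR
  have hach := testRegion_zero_subset_csUniformRegion hP hMarkov (Fintype.card 𝒳t + 1)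
  rw [h2, h4, regionR2Card_eq_testRegion hP hMarkov, regionR4Card_eq_testRegion hP hMarkov]
  exact ⟨hgs.antisymm (testRegion_one_subset_gsRegion hP hMarkov _), hcs.antisymm (hach.trans hcsu),
    (hcsu.trans hcs).antisymm hach, rfl, rfl⟩
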